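/- **Setting.** There are products $\mathcal N=\{1,\dots,n\}$, $n\ge 1$, with revenues $r_i>0$, preference weights $v_i>0$ and initial inventories $c_i\in\mathbb Z_{>0}$, a horizon $T\ge 1$ and a balancing parameter $0<\alpha<1$. A customer who is offered $S\subseteq\mathcal N$ buys $i\in S$ with probability $\phi(i,S)=v_i/(1+\sum_{j\in S}v_j)$, and otherwise nothing. A policy $\pi$ maps, in each period $t\le T$, the history of the purchases so far to a probability distribution over assortments; $X^\pi_{iT}$ is the number of units of $i$ sold. BMS-Dynamic is the problem of maximizing $\sum_i r_i\mathbb E[X^\pi_{iT}]$ subject to $\mathbb P(X^\pi_{iT}\le c_i)=1$ and $\mathbb E[X^\pi_{iT}]\in\{0\}\cup[\alpha\max_j\mathbb E[X^\pi_{jT}],\infty)$ for all $i$. The Upper-Bound problem is to maximize $T\sum_i r_ix_i$ subject to $x_0+\sum_i x_i=1$, $0\le x_i\le v_ix_0$, $x_i\le c_i/T$ and $x_i\in\{0\}\cup[\alpha\max_jx_j,\infty)$ for all $i$. A (feasible) solution is a $\rho$-approximation if its value is at least $\rho$ times that of every feasible solution. Let $G(p,c)=\mathbb E[\min\{Z,c\}]$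 with $Z\sim\mathrm{Bin}(T,p)$, and $c_{\min}=\min_i c_i$. **Algorithm.** Given $\epsilon>0$, set $\epsilon_1=\epsilon/2$ and $\epsilon_2=\min\{\epsilon/2,1-\alpha\}$. (1) Compute a $(1-\epsilon_1)$-approximation $\tilde x$ to the Upper-Bound problem. Let $\bar S=\{i:\tilde x_i>0\}$ and $G_{\min}=\min_{i\in\bar S}G(\tilde x_i,c_i)$. (2) Set $\hat x_i=0$ for $i\notin\bar S$; set $\hat x_i=\tilde x_i$ if $i\in\bar S$ and $G(\tilde x_i,c_i)\le G_{\min}/\alpha$; for the other $i\in\bar S$ find, by bisection on $[0,\tilde x_i]$, some $\hat x_i$ with $(1-\epsilon_2)G_{\min}/\alpha\le G(\hat x_i,c_i)\le G_{\min}/\alpha$. (3) Policy: in each period offer an assortment drawn from a distribution under which each product $i$ is purchased with probability $\hat x_i$ if fewer than $c_i$ units of it have been sold, and with probability $0$ otherwise. **Theorem.** Let $\alpha<1$. (a) For every $\epsilon>0$ and all possible results of steps (1) and (2), a policy as in step (3) exists, and every such policy is feasible for BMS-Dynamic and is a $\max\{1/2-\epsilon,\;1-1/\sqrt{c_{\min}}-\epsilon\}$-approximation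 to BMS-Dynamic. (b) Steps (1) and (2) can be carried out, with an actual bisection search in step (2), by one fixed program of a real random access machine (unit-cost arithmetic and comparisons on real numbers, index registers and arrays; no rounding of real numbers; an evaluation of $p\mapsto G(p,c_i)$ at some $p\in[0,1]$ counts as one step) in a number of steps that is at most a fixed polynomial in $$n+\log T+\sum_i|\log v_i|+\log(1/\alpha)+1/\epsilon+\log(1/(1-\alpha)).$$ (c) There is a fixed program of this machine, without evaluations of $G$, which in each period computes a distribution as required in step (3), given as at most $n+1$ assortments with their probabilities, from the prescribed purchase probabilities, in a number of steps polynomial in $n$. There is also such a program, without evaluations of $G$, that computes $G(p,c)$ from $T$, $p\in[0,1]$ and $c\in\mathbb Z_{>0}$ in $O(T)$ steps. -/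

import Mathlib

open scoped BigOperators

noncomputable section

namespace BMS

/-! ## The dynamic assortment problem with balanced market shares -/

/-- An instance with products `Fin n`: horizon `T`, revenues `r`, MNL preference weights `v`
(the no-purchase option has weight `1`), initial inventories `c`, balancing parameter `α`. -/
structure Instance (n : ℕ) where
  T : ℕ
  r : Fin n → ℝ
  v : Fin n → ℝ
  c : Fin n → ℕ
  α : ℝ
  T_pos : 0 < T
  r_pos : ∀ i, 0 < r i
  v_pos : ∀ i, 0 < v i
  c_pos : ∀ i, 0 < c i
  α_pos : 0 < α
  α_le_one : α ≤ 1

/-- A dynamic control policy: at time `t + 1` it maps the history of the first `t` customers'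
decisions (`none` is no purchase) to a distribution over assortments. -/
abbrev Policy (n : ℕ) : Type :=
  (t : ℕ) → (Fin t → Option (Fin n)) → PMF (Finset (Fin n))

/-- Units of product `i` sold along the history `h`. -/
def sales {n t : ℕ} (h : Fin t → Option (Fin n)) (i : Fin n) : ℕ :=
  (Finset.univ.filter fun τ => h τ = some i).card

/-- `G(p, c) = 𝔼[min {Z, c}]` for a binomial variable `Z` with `T` trials and success
probability `p`. -/
def expectedSales (T c : ℕ) (p : ℝ) : ℝ :=
  ∑ k ∈ Finset.range (T + 1),
    (T.choose k : ℝ) * p ^ k * (1 - p) ^ (T - k) * (min k c : ℕ)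

/-- One step of bisection for the equation `g x = target`, `g` increasing. -/
def bisectStep (g : ℝ → ℝ) (target : ℝ) (I : ℝ × ℝ) : ℝ × ℝ :=
  if g ((I.1 + I.2) / 2) ≤ target then ((I.1 + I.2) / 2, I.2) else (I.1, (I.1 + I.2) / 2)

namespace Instance

variable {n : ℕ} (I : Instance n)

/-- MNL choice probabilities of a customer who is offered `S`. -/
def choiceProb (S : Finset (Fin n)) : Option (Fin n) → ℝ
  | none => 1 / (1 + ∑ j ∈ S, I.v j)
  | some i => if i ∈ S then I.v i / (1 + ∑ j ∈ S, I.v j) else 0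

theorem denom_pos (S : Finset (Fin n)) : 0 < 1 + ∑ j ∈ S, I.v j :=
  add_pos_of_pos_of_nonneg one_pos (Finset.sum_nonneg fun j _ => (I.v_pos j).le)

theorem choiceProb_nonneg (S : Finset (Fin n)) (o : Option (Fin n)) :
    0 ≤ I.choiceProb S o := by
  cases o with
  | none => exact (one_div_pos.2 (I.denom_pos S)).le
  | some i =>
    simp only [choiceProb]
    split_ifs
    · exact (div_pos (I.v_pos i) (I.denom_pos S)).le
    · exact le_rfl

theorem sum_choiceProb (S : Finset (Fin n)) : ∑ o, I.choiceProb S o = 1 := by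
  rw [Fintype.sum_option]
  simp only [choiceProb]
  rw [Finset.sum_ite_mem, Finset.univ_inter, ← Finset.sum_div, ← add_div]
  exact div_self (I.denom_pos S).ne'

/-- The law of the decision of a customer who is offered `S`. -/
def choice (S : Finset (Fin n)) : PMF (Option (Fin n)) :=
  PMF.ofFintype (fun o => ENNReal.ofReal (I.choiceProb S o)) (by
    rw [← ENNReal.ofReal_sum_of_nonneg fun o _ => I.choiceProb_nonneg S o,
      I.sum_choiceProb, ENNReal.ofReal_one])

/-- The law of the history of the first `t` customers under the policy `π`. -/
def historyLaw (π : Policy n) : (t : ℕ) → PMF (Fin t → Option (Fin n))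
  | 0 => PMF.pure Fin.elim0
  | t + 1 => (historyLaw π t).bind fun h => (π t h).bind fun S =>
      (I.choice S).map fun o => Fin.snoc (α := fun _ => Option (Fin n)) h o

/-- `𝔼[X_{iT}]` under `π`. -/
def meanSales (π : Policy n) (i : Fin n) : ℝ :=
  ∑ h : Fin I.T → Option (Fin n), (I.historyLaw π I.T h).toReal * (sales h i : ℝ)

/-- Total expected revenue, the objective of BMS-Dynamic. -/
def revenue (π : Policy n) : ℝ := ∑ i, I.r i * I.meanSales π i

/-- Feasibility in BMS-Dynamic: inventory almost surely, balance in expectation. -/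
structure Feasible (π : Policy n) : Prop where
  inventory : ∀ i, (I.historyLaw π I.T).toOuterMeasure {h | sales h i ≤ I.c i} = 1
  balance : ∀ i, I.meanSales π i = 0 ∨ ∀ j, I.α * I.meanSales π j ≤ I.meanSales π i

/-- `π` is a `ρ`-approximation to BMS-Dynamic. -/
def IsApprox (ρ : ℝ) (π : Policy n) : Prop :=
  I.Feasible π ∧ ∀ π', I.Feasible π' → ρ * I.revenue π' ≤ I.revenue π

/-- `c_min`. -/
def cmin [NeZero n] : ℕ := Finset.univ.inf' Finset.univ_nonempty I.c

/-! ## The Upper-Bound problem -/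

structure UBFeasible (x0 : ℝ) (x : Fin n → ℝ) : Prop where
  total : x0 + ∑ i, x i = 1
  nonneg : ∀ i, 0 ≤ x i
  mnl : ∀ i, x i ≤ I.v i * x0
  inventory : ∀ i, x i ≤ (I.c i : ℝ) / I.T
  balance : ∀ i, x i = 0 ∨ ∀ j, I.α * x j ≤ x i

def ubValue (x : Fin n → ℝ) : ℝ := I.T * ∑ i, I.r i * x i

/-- `(x0, x)` is a `ρ`-approximate solution of the Upper-Bound problem. -/
def IsUBApprox (ρ x0 : ℝ) (x : Fin n → ℝ) : Prop :=
  I.UBFeasible x0 x ∧ ∀ y0 y, I.UBFeasible y0 y → ρ * I.ubValue y ≤ I.ubValue x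

/-! ## The algorithm -/

/-- `G(p, c_i)`. -/
def G (i : Fin n) (p : ℝ) : ℝ := expectedSales I.T (I.c i) p

/-- `G_min`, the minimum of `G(x_i, c_i)` over the products with `x_i > 0`. (It is used only
when there is such a product.) -/
def Gmin (x : Fin n → ℝ) : ℝ := sInf {g | ∃ i, 0 < x i ∧ g = I.G i (x i)}

/-- The algorithm with precisions `ε₁`, `ε₂` may compute the approximate solution `(x0, xt)` of
the Upper-Bound problem and return the purchase probabilities `xh`. The search for `xh i` takes
place in the interval `[0, xt i]`. -/
structure IsOutput (ε₁ ε₂ x0 : ℝ) (xt xh : Fin n → ℝ) : Prop where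
  approx : I.IsUBApprox (1 - ε₁) x0 xt
  zero : ∀ i, xt i = 0 → xh i = 0
  keep : ∀ i, 0 < xt i → I.G i (xt i) ≤ I.Gmin xt / I.α → xh i = xt i
  search : ∀ i, 0 < xt i → I.Gmin xt / I.α < I.G i (xt i) →
    (0 ≤ xh i ∧ xh i ≤ xt i) ∧
    (1 - ε₂) * (I.Gmin xt / I.α) ≤ I.G i (xh i) ∧ I.G i (xh i) ≤ I.Gmin xt / I.α

/-- Each searched `xh i` is the left end point reached after some number of bisection steps that
start from `[0, xt i]`. -/
def ByBisection (xt xh : Fin n → ℝ) : Prop :=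
  ∀ i, 0 < xt i → I.Gmin xt / I.α < I.G i (xt i) →
    ∃ m : ℕ, xh i = ((bisectStep (I.G i) (I.Gmin xt / I.α))^[m] (0, xt i)).1

/-- The purchase probabilities `p_t` that the algorithm prescribes when `sold i` units of
product `i` have been sold. -/
def purchaseProb (xh : Fin n → ℝ) (sold : Fin n → ℕ) (i : Fin n) : ℝ :=
  if sold i < I.c i then xh i else 0

/-- `π` is a policy of the form described by the algorithm: in each period its distribution over
assortments attains the prescribed purchase probabilities. -/
def Implements (xh : Fin n → ℝ) (π : Policy n) : Prop :=
  ∀ t < I.T, ∀ (h : Fin t → Option (Fin n)) (i : Fin n),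
    ∑ S, (π t h S).toReal * I.choiceProb S (some i) = I.purchaseProb xh (sales h) i

end Instance

/-! ## Real random access machine -/

/-- A state: registers for natural numbers (used as indices), registers for real numbers, and
arrays of real numbers. -/
structure State where
  N : ℕ → ℕ
  R : ℕ → ℝ
  M : ℕ → ℕ → ℝ

/-- Elementary instructions; the numbers are names of registers or arrays, except for the constant
`k` in `setN`, `setR`. -/
inductive Instr where
  | setN (d k : ℕ)
  | addN (d a b : ℕ)
  | subN (d a b : ℕ)
  | mulN (d a b : ℕ)
  | setR (d k : ℕ)
  | addR (d a b : ℕ)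
  | subR (d a b : ℕ)
  | mulR (d a b : ℕ)
  | divR (d a b : ℕ)
  | load (d arr idx : ℕ)
  | store (arr idx a : ℕ)
  | call (d idx a : ℕ)

/-- Effect of an instruction; `call` evaluates the function `O` at the index in register `idx` and
the real number in register `a`. -/
def Instr.eval (O : ℕ → ℝ → ℝ) (s : State) : Instr → State
  | .setN d k => { s with N := Function.update s.N d k }
  | .addN d a b => { s with N := Function.update s.N d (s.N a + s.N b) }
  | .subN d a b => { s with N := Function.update s.N d (s.N a - s.N b) }
  | .mulN d a b => { s with N := Function.update s.N d (s.N a * s.N b) }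
  | .setR d k => { s with R := Function.update s.R d (k : ℝ) }
  | .addR d a b => { s with R := Function.update s.R d (s.R a + s.R b) }
  | .subR d a b => { s with R := Function.update s.R d (s.R a - s.R b) }
  | .mulR d a b => { s with R := Function.update s.R d (s.R a * s.R b) }
  | .divR d a b => { s with R := Function.update s.R d (s.R a / s.R b) }
  | .load d arr idx => { s with R := Function.update s.R d (s.M arr (s.N idx)) }
  | .store arr idx a =>
      { s with M := Function.update s.M arr (Function.update (s.M arr) (s.N idx) (s.R a)) }
  | .call d idx a => { s with R := Function.update s.R d (O (s.N idx) (s.R a)) }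

/-- Tests on two registers. -/
inductive Test where
  | leN (a b : ℕ)
  | ltN (a b : ℕ)
  | leR (a b : ℕ)
  | ltR (a b : ℕ)

def Test.Holds (s : State) : Test → Prop
  | .leN a b => s.N a ≤ s.N b
  | .ltN a b => s.N a < s.N b
  | .leR a b => s.R a ≤ s.R b
  | .ltR a b => s.R a < s.R b

/-- Programs. -/
inductive Prog where
  | instr (i : Instr)
  | seq (p q : Prog)
  | cond (b : Test) (p q : Prog)
  | loop (b : Test) (p : Prog)

/-- The program does not use `call`. -/
def Prog.CallFree : Prog → Prop
  | .instr (.call _ _ _) => False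
  | .instr _ => True
  | .seq p q => p.CallFree ∧ q.CallFree
  | .cond _ p q => p.CallFree ∧ q.CallFree
  | .loop _ p => p.CallFree

/-- `Exec O p s m s'`: started in `s`, the program `p` halts in `s'` after `m` steps; every
instruction and every evaluation of a test is one step. -/
inductive Exec (O : ℕ → ℝ → ℝ) : Prog → State → ℕ → State → Prop where
  | instr (i : Instr) (s : State) : Exec O (.instr i) s 1 (i.eval O s)
  | seq {p q : Prog} {s s' s'' : State} {a b : ℕ} :
      Exec O p s a s' → Exec O q s' b s'' → Exec O (.seq p q) s (a + b) s''
  | cond_true {b : Test} {p q : Prog} {s s' : State} {a : ℕ} :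
      b.Holds s → Exec O p s a s' → Exec O (.cond b p q) s (a + 1) s'
  | cond_false {b : Test} {p q : Prog} {s s' : State} {a : ℕ} :
      ¬ b.Holds s → Exec O q s a s' → Exec O (.cond b p q) s (a + 1) s'
  | loop_true {b : Test} {p : Prog} {s s' s'' : State} {a c : ℕ} :
      b.Holds s → Exec O p s a s' → Exec O (.loop b p) s' c s'' →
      Exec O (.loop b p) s (a + c + 1) s''
  | loop_false {b : Test} {p : Prog} {s : State} :
      ¬ b.Holds s → Exec O (.loop b p) s 1 s

/-- A vector as an array, padded by zeros. -/
def asArray {n : ℕ} (x : Fin n → ℝ) (k : ℕ) : ℝ := if h : k < n then x ⟨k, h⟩ else 0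

namespace Instance

variable {n : ℕ} (I : Instance n)

/-- The function `(i, p) ↦ G(p, c_i)`, for products `i` and probabilities `p`, as it is offered
to programs. -/
def oracle (k : ℕ) (p : ℝ) : ℝ :=
  if h : k < n ∧ 0 ≤ p ∧ p ≤ 1 then I.G ⟨k, h.1⟩ p else 0

/-- Input state of the optimization phase: `n` in index register `0`; `T`, `α`, `ε` in the real
registers `0`, `1`, `2`; `r`, `v`, `c` in the arrays `0`, `1`, `2`; zero elsewhere. -/
def input (ε : ℝ) : State where
  N := fun k => if k = 0 then n else 0
  R := fun k => if k = 0 then (I.T : ℝ) else if k = 1 then I.α else if k = 2 then ε else 0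
  M := fun a => if a = 0 then asArray I.r else if a = 1 then asArray I.v
    else if a = 2 then asArray (fun i => (I.c i : ℝ)) else fun _ => 0

/-- Input state of the computation in one period: `n` in index register `0`, preference weights and
purchase probabilities `p` in the arrays `0`, `1`; zero elsewhere. -/
def periodInput (p : Fin n → ℝ) : State where
  N := fun k => if k = 0 then n else 0
  R := fun _ => 0
  M := fun a => if a = 0 then asArray I.v else if a = 1 then asArray p else fun _ => 0

/-- The state `s` describes a distribution over assortments that attains the purchase probabilities
`p`: the assortments `S 0, …, S n`, given by the `0`-`1` rows of array `3`, are offered with the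
probabilities in array `2`. -/
def DescribesDistribution (p : Fin n → ℝ) (s : State) : Prop :=
  ∃ S : Fin (n + 1) → Finset (Fin n),
    (∀ (k : Fin (n + 1)) (j : Fin n), s.M 3 ((k : ℕ) * n + j) = if j ∈ S k then 1 else 0) ∧
    (∀ k : Fin (n + 1), 0 ≤ s.M 2 k) ∧ ∑ k : Fin (n + 1), s.M 2 k = 1 ∧
    ∀ i, ∑ k : Fin (n + 1), s.M 2 k * I.choiceProb (S k) (some i) = p i

/-- The input size: one unit per product plus the logarithmic magnitudes of `T`, `v`, `α`. (The
magnitudes of `r` and `c` are not needed.) -/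
def inputSize : ℝ := n + Real.log I.T + ∑ i, |Real.log (I.v i)| + Real.log (1 / I.α)

end Instance

/-- Input state for the evaluation of `G(p, c)`: `T`, `p`, `c` in the real registers
`0`, `1`, `2`; zero elsewhere. -/
def evalInput (T c : ℕ) (p : ℝ) : State where
  N := fun _ => 0
  R := fun k => if k = 0 then (T : ℝ) else if k = 1 then p else if k = 2 then (c : ℝ) else 0
  M := fun _ _ => 0

end BMS

end

/-!
The theorem combines a relaxation argument, a fully polynomial approximation scheme for the relaxed
problem, and programs for a random access machine that carry it out.

*Quality of the policy.* The mean sales per period of a feasible policy are feasible for the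
Upper-Bound problem (`Instance.Feasible.exists_ubFeasible`), because a product is never bought with
more than `v i` times the probability of no purchase. Conversely, under a policy that attains the
prescribed purchase probabilities the sales of product `i` are a binomial variable stopped at the
inventory, with mean `G i (xh i)` (`Instance.Implements.mean_sales`). Stopping a binomial variable
at `c`, at least its mean `μ`, costs at most `min (μ / 2) (μ / √c)` (`expectedSales_ge`). For the
products whose probabilities are lowered by the search, the balance of the fluid solution implies
that the target `Gmin / α` is at least the same fraction of their fluid sales
(`Instance.UBFeasible.mul_le_Gmin_div`), so that only the relative precision of the search is lost.

*Assortments.* Purchase probabilities `p` with `p i ≤ v i * p0`, where `p0` is the probability of no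
purchase, are attained by the nested assortments `{i | a < p i / v i}`, where `a` runs through
`0` and the distinct values of the ratios (`Instance.Attainable.sum_nestedWeight_mul`). No sorting is
needed, since the next value can be found by a scan (`nextLevel`).

*The Upper-Bound problem.* The largest amount `U` of a product is restricted to a geometric grid,
and probabilities are measured in units of `1 / N` with `N = n K`. After a feasible solution has
been scaled so that its largest amount is a grid point, with a loss of at most the fraction
`3 / K`, there is room to round the amounts of all products and the probability of no purchase up to
whole units (`Instance.UBFeasible.exists_gridValue_ge`). For given `U` and `k` units of no
purchase all caps of the amounts are explicit, so the problem becomes a knapsack problem with at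
most `N` units, solved by dynamic programming. Its solutions are exactly feasible, since every
amount is cut off at its cap, and amounts that would violate the balance are set to zero. The
largest amount can be assumed to be at least `Instance.amountBound`, whose logarithm is linear in
the size of the input; hence the grid is polynomially long.

*Bisection.* `G` is `T`-Lipschitz in the probability and the target is at least half of `T * xt i`,
so that the number of bisection steps is logarithmic in `1 / ε₂`.

*Programs.* `Run` expresses total correctness with a time bound. Registers that do not occur as a
destination in a program keep their values (`Exec.frame`), which is checked by evaluation for
concrete programs, so that specifications only speak about what changes.
-/

open scoped BigOperators

noncomputable section

namespace BMS

/-! ### Total correctness with time bounds -/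

/-- Started in `s`, the program `p` halts within `T` steps in a state that satisfies `Q`. -/
def Run (O : ℕ → ℝ → ℝ) (p : Prog) (s : State) (T : ℕ) (Q : State → Prop) : Prop :=
  ∃ m s', Exec O p s m s' ∧ m ≤ T ∧ Q s'

/-- Does the instruction write to the index register `a`? -/
def Instr.writesN : Instr → ℕ → Bool
  | .setN d _, a => a == d
  | .addN d _ _, a => a == d
  | .subN d _ _, a => a == d
  | .mulN d _ _, a => a == d
  | _, _ => false

/-- Does the instruction write to the real register `a`? -/
def Instr.writesR : Instr → ℕ → Bool
  | .setR d _, a => a == d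
  | .addR d _ _, a => a == d
  | .subR d _ _, a => a == d
  | .mulR d _ _, a => a == d
  | .divR d _ _, a => a == d
  | .load d _ _, a => a == d
  | .call d _ _, a => a == d
  | _, _ => false

/-- Does the instruction write to the array `a`? -/
def Instr.writesM : Instr → ℕ → Bool
  | .store arr _ _, a => a == arr
  | _, _ => false

/-- Does some instruction of the program satisfy `f`? -/
def Prog.anyInstr (f : Instr → Bool) : Prog → Bool
  | .instr i => f i
  | .seq p q => p.anyInstr f || q.anyInstr f
  | .cond _ p q => p.anyInstr f || q.anyInstr f
  | .loop _ p => p.anyInstr f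

/-- The states `s` and `s'` agree on all registers and arrays that `p` does not write to. -/
structure Frame (p : Prog) (s s' : State) : Prop where
  N : ∀ a, p.anyInstr (·.writesN a) = false → s'.N a = s.N a
  R : ∀ a, p.anyInstr (·.writesR a) = false → s'.R a = s.R a
  M : ∀ a, p.anyInstr (·.writesM a) = false → s'.M a = s.M a

theorem Frame.refl (p : Prog) (s : State) : Frame p s s :=
  ⟨fun _ _ => rfl, fun _ _ => rfl, fun _ _ => rfl⟩

theorem Frame.trans {p : Prog} {s s' s'' : State} (h : Frame p s s') (h' : Frame p s' s'') :
    Frame p s s'' :=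
  ⟨fun a ha => (h'.N a ha).trans (h.N a ha), fun a ha => (h'.R a ha).trans (h.R a ha),
    fun a ha => (h'.M a ha).trans (h.M a ha)⟩

theorem Frame.mono {p q : Prog} {s s' : State} (h : Frame p s s')
    (hpq : ∀ f, q.anyInstr f = false → p.anyInstr f = false) : Frame q s s' :=
  ⟨fun a ha => h.N a (hpq _ ha), fun a ha => h.R a (hpq _ ha), fun a ha => h.M a (hpq _ ha)⟩

theorem Frame.instr (O : ℕ → ℝ → ℝ) (i : Instr) (s : State) :
    Frame (.instr i) s (i.eval O s) := by
  constructor <;> intro a ha <;> cases i <;>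
    simp_all [Prog.anyInstr, Instr.writesN, Instr.writesR, Instr.writesM, Instr.eval]

theorem Exec.frame {O : ℕ → ℝ → ℝ} {p : Prog} {s s' : State} {m : ℕ} (h : Exec O p s m s') :
    Frame p s s' := by
  induction h with
  | instr i s => exact .instr O i s
  | seq _ _ ih₁ ih₂ =>
    exact (ih₁.mono fun f hf => by simp_all [Prog.anyInstr]).trans
      (ih₂.mono fun f hf => by simp_all [Prog.anyInstr])
  | cond_true _ _ ih => exact ih.mono fun f hf => by simp_all [Prog.anyInstr]
  | cond_false _ _ ih => exact ih.mono fun f hf => by simp_all [Prog.anyInstr]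
  | loop_true _ _ _ ih₁ ih₂ => exact (ih₁.mono fun f hf => by simp_all [Prog.anyInstr]).trans ih₂
  | loop_false => exact .refl _ _

variable {O : ℕ → ℝ → ℝ} {p q : Prog} {b : Test} {s : State} {Q Q' : State → Prop} {T T' c : ℕ}

theorem Run.mono (h : Run O p s T Q) (hT : T ≤ T') (hQ : ∀ s', Frame p s s' → Q s' → Q' s') :
    Run O p s T' Q' := by
  obtain ⟨m, s', he, hm, hq⟩ := h
  exact ⟨m, s', he, hm.trans hT, hQ s' he.frame hq⟩

/-- Composition; the frame of the first program is available for the second. -/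
theorem Run.seq {T₁ T₂ : ℕ} (h : Run O p s T₁ Q')
    (h' : ∀ s', Frame p s s' → Q' s' → Run O q s' T₂ Q) (hT : T₁ + T₂ ≤ T := by omega) :
    Run O (.seq p q) s T Q := by
  obtain ⟨m, s', he, hm, hq⟩ := h
  obtain ⟨m', s'', he', hm', hq'⟩ := h' s' he.frame hq
  exact ⟨m + m', s'', .seq he he', by omega, hq'⟩

theorem Run.cond (h : b.Holds s → Run O p s c Q) (h' : ¬ b.Holds s → Run O q s c Q)
    (hT : c + 1 ≤ T := by omega) : Run O (.cond b p q) s T Q := by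
  by_cases hb : b.Holds s
  · obtain ⟨m, s', he, hm, hq⟩ := h hb
    exact ⟨m + 1, s', .cond_true hb he, by omega, hq⟩
  · obtain ⟨m, s', he, hm, hq⟩ := h' hb
    exact ⟨m + 1, s', .cond_false hb he, by omega, hq⟩

theorem Run.instr {i : Instr} (h : Q (i.eval O s)) (hT : 1 ≤ T := by decide) :
    Run O (.instr i) s T Q :=
  ⟨1, _, .instr i s, hT, h⟩

/-- Straight-line code. -/
def block : Instr → List Instr → Prog
  | i, [] => .instr i
  | i, j :: l => .seq (.instr i) (block j l)

theorem Run.block (i : Instr) (l : List Instr)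
    (h : Q (l.foldl (fun s i => i.eval O s) (i.eval O s))) (hT : l.length + 1 ≤ T := by decide) :
    Run O (block i l) s T Q := by
  induction l generalizing i s T with
  | nil => exact ⟨1, _, .instr i s, hT, h⟩
  | cons j l ih =>
    obtain ⟨m, s', he, hm, hq⟩ := ih (s := i.eval O s) (T := l.length + 1) j h le_rfl
    refine ⟨1 + m, s', .seq (.instr i s) he, ?_, hq⟩
    simp only [List.length_cons] at hT
    omega

/-- A loop that is run through `L` times, with the invariant `Inv`. -/
theorem Run.loop (L c : ℕ) (Inv : ℕ → State → Prop) (h0 : Inv 0 s)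
    (htest : ∀ j s', j ≤ L → Frame p s s' → Inv j s' → (b.Holds s' ↔ j < L))
    (hbody : ∀ j s', j < L → Frame p s s' → Inv j s' → Run O p s' c (Inv (j + 1)))
    (hT : L * (c + 1) + 1 ≤ T := by omega)
    (hQ : ∀ s', Frame p s s' → Inv L s' → Q s') :
    Run O (.loop b p) s T Q := by
  have key : ∀ k j s', j + k = L → Frame p s s' → Inv j s' →
      Run O (.loop b p) s' (k * (c + 1) + 1) (fun s'' => Frame p s s'' ∧ Inv L s'') := by
    intro k
    induction k with
    | zero =>
      intro j s' hj hF hI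
      obtain rfl : j = L := by omega
      refine ⟨1, s', .loop_false ?_, by omega, hF, hI⟩
      rw [htest j s' le_rfl hF hI]
      exact lt_irrefl _
    | succ k ih =>
      intro j s' hj hF hI
      obtain ⟨m, s₁, he, hm, hI₁⟩ := hbody j s' (by omega) hF hI
      obtain ⟨m', s₂, he', hm', h₂⟩ := ih (j + 1) s₁ (by omega) (hF.trans he.frame) hI₁
      refine ⟨m + m' + 1, s₂, .loop_true ((htest j s' (by omega) hF hI).2 (by omega)) he he', ?_,
        h₂⟩
      rw [Nat.succ_mul]
      omega
  obtain ⟨m, s', he, hm, hF, hI⟩ := key L 0 s (by omega) (.refl _ _) h0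
  exact ⟨m, s', he, hm.trans hT, hQ s' hF hI⟩

/-- The loop in which the index register `i` runs from `0` to `N n - 1`, the content of the index
register `n` less one. Index register `1` has to hold the number `1`. -/
def forN (i n : ℕ) (p : Prog) : Prog :=
  .seq (.instr (.setN i 0)) (.loop (.ltN i n) (.seq p (.instr (.addN i i 1))))

/-- The invariant for `j` holds at the start of round `j`, after the counter has been set to `j`.
The body has to establish it for the state in which the counter is already increased. -/
theorem Run.forN {i n : ℕ} (c : ℕ) (Inv : ℕ → State → Prop)
    (h1 : s.N 1 = 1)
    (h0 : Inv 0 { s with N := Function.update s.N i 0 })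
    (hbody : ∀ j s', j < s.N n → s'.N i = j → Frame (.seq p (.instr (.addN i i 1))) s s' →
      Inv j s' → Run O p s' c (fun s'' => Inv (j + 1)
        { s'' with N := Function.update s''.N i (j + 1) }))
    (hQ : ∀ s', Frame (forN i n p) s s' → Inv (s.N n) s' → Q s')
    (hT : s.N n * (c + 2) + 2 ≤ T := by first | omega | nlinarith)
    (hin : (i == n) = false := by rfl) (hi1 : (i == 1) = false := by rfl)
    (hpi : p.anyInstr (·.writesN i) = false := by rfl)
    (hpn : p.anyInstr (·.writesN n) = false := by rfl)
    (hp1 : p.anyInstr (·.writesN 1) = false := by rfl) :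
    Run O (forN i n p) s T Q := by
  have hin' : n ≠ i := fun h => by simp [h] at hin
  have hi1' : 1 ≠ i := fun h => by simp [← h] at hi1
  set s₁ : State := { s with N := Function.update s.N i 0 } with hs₁
  have hF₁ : Frame (.seq p (.instr (.addN i i 1))) s s₁ := by
    refine ⟨fun a ha => ?_, fun _ _ => rfl, fun _ _ => rfl⟩
    have : a ≠ i := fun h => by simp [Prog.anyInstr, Instr.writesN, h] at ha
    simp [hs₁, this]
  have hloop : Run O (.loop (.ltN i n) (.seq p (.instr (.addN i i 1)))) s₁
      (s.N n * (c + 1 + 1) + 1) (fun s' => Inv (s.N n) s') := by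
    refine Run.loop (s.N n) (c + 1) (fun j s' => s'.N i = j ∧ Inv j s') ⟨by simp [hs₁], h0⟩
      ?_ ?_ le_rfl fun _ _ h => h.2
    · intro j s' _ hF hI
      have : s'.N n = s.N n := by
        have hw : (Prog.seq p (.instr (.addN i i 1))).anyInstr (·.writesN n) = false := by
          rw [Prog.anyInstr, hpn]
          simp [Prog.anyInstr, Instr.writesN, hin']
        rw [(hF₁.trans hF).N n hw]
      simp [Test.Holds, this, hI.1]
    · rintro j s' hj hF ⟨hij, hI⟩
      refine Run.seq (T₁ := c) (T₂ := 1) (hbody j s' hj hij (hF₁.trans hF) hI) ?_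
      intro s'' hF'' hI''
      refine Run.instr ?_
      have e1 : s''.N i = j := by rw [hF''.N i hpi, hij]
      have hw : (Prog.seq p (.instr (.addN i i 1))).anyInstr (·.writesN 1) = false := by
        rw [Prog.anyInstr, hp1]
        simp [Prog.anyInstr, Instr.writesN, hi1']
      have e2 : s''.N 1 = 1 := by rw [hF''.N 1 hp1, (hF₁.trans hF).N 1 hw, h1]
      simpa [Instr.eval, e1, e2] using hI''
  obtain ⟨m, s', he, hm, hI⟩ := hloop
  have hex : Exec O (BMS.forN i n p) s (1 + m) s' := .seq (.instr _ _) he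
  exact ⟨1 + m, s', hex, by ring_nf at hm hT ⊢; omega, hQ s' hex.frame hI⟩

/-! ### Evaluation of the expected truncated binomial by arithmetic operations -/

theorem binomial_weight_succ (T k : ℕ) (hk : k ≤ T) {p : ℝ} (hp : 1 - p ≠ 0) :
    (T.choose (k + 1) : ℝ) * p ^ (k + 1) * (1 - p) ^ (T - (k + 1)) =
      T.choose k * p ^ k * (1 - p) ^ (T - k) * (T - k) * (p / (1 - p)) / (k + 1) := by
  have hk1 : (k + 1 : ℝ) ≠ 0 := by positivity
  have hc : (T.choose (k + 1) : ℝ) * (k + 1) = T.choose k * (T - k) := by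
    rw [← Nat.cast_sub hk]
    exact_mod_cast Nat.choose_succ_right_eq T k
  rcases hk.eq_or_lt with rfl | hlt
  · simp
  · obtain ⟨d, rfl⟩ : ∃ d, T = k + 1 + d := ⟨T - (k + 1), by omega⟩
    rw [show k + 1 + d - (k + 1) = d by omega, show k + 1 + d - k = d + 1 by omega, eq_div_iff hk1]
    calc _ = ((k + 1 + d).choose (k + 1) * (k + 1) : ℝ) * p ^ (k + 1) * (1 - p) ^ d := by ring
      _ = _ := by
        rw [hc]
        field_simp
        ring

theorem expectedSales_one (T c : ℕ) : expectedSales T c 1 = (min T c : ℕ) := by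
  rw [expectedSales, Finset.sum_range_succ, Finset.sum_eq_zero]
  · simp
  · intro k hk
    have : T - k ≠ 0 := by have := Finset.mem_range.1 hk; omega
    simp [this]

/-- Computes `G(p, c)` from `T`, `p`, `c` in the real registers `0`, `1`, `2`. Real register `4`
is the counter `k`, register `6` holds the binomial probability of `k`, register `7` the partial
sum, register `5` the odds `p / (1 - p)`; register `9` stays zero. The odds are not defined for
`p = 1`, where the value is `min T c`. -/
def evalProg : Prog :=
  .seq (block (.setR 3 1) [.subR 5 3 1])
    (.cond (.ltR 1 3)
      (.seq (block (.setR 6 1) [.setR 4 0])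
        (.seq (.loop (.ltR 4 0) (block (.mulR 6 6 5) [.addR 4 4 3]))
          (.seq (block (.divR 5 1 5) [.setR 4 0, .setR 7 0])
            (.seq
              (.loop (.leR 4 0)
                (.seq (.cond (.leR 4 2) (.instr (.addR 8 4 9)) (.instr (.addR 8 2 9)))
                  (block (.mulR 8 8 6) [.addR 7 7 8, .subR 8 0 4, .mulR 6 6 8, .mulR 6 6 5,
                    .addR 4 4 3, .divR 6 6 4])))
              (.instr (.addR 0 7 9))))))
      (.cond (.leR 0 2) (.instr (.addR 0 0 9)) (.instr (.addR 0 2 9))))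

theorem run_evalProg (O : ℕ → ℝ → ℝ) (T c : ℕ) (p : ℝ) (hp1 : p ≤ 1) :
    Run O evalProg (evalInput T c p) (13 * T + 24) fun s => s.R 0 = expectedSales T c p := by
  refine Run.seq (T₁ := 2) (T₂ := 13 * T + 22)
    (Q' := fun s => s.R 0 = T ∧ s.R 1 = p ∧ s.R 2 = c ∧ s.R 3 = 1 ∧ s.R 5 = 1 - p ∧ s.R 9 = 0)
    (Run.block _ _ (by simp [Instr.eval, evalInput])) ?_
  rintro s - ⟨h0, h1, h2, h3, h5, h9⟩
  refine Run.cond (c := 13 * T + 21) (fun hb => ?_) (fun hb => ?_)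
  · have hp : p < 1 := by simpa [Test.Holds, h1, h3] using hb
    have hp' : 1 - p ≠ 0 := by linarith
    refine Run.seq (T₁ := 2) (T₂ := 13 * T + 19)
      (Q' := fun s => s.R 6 = 1 ∧ s.R 4 = 0) (Run.block _ _ (by simp [Instr.eval])) ?_
    rintro s₁ hF₁ ⟨h6, h4⟩
    refine Run.seq (T₁ := 3 * T + 1) (T₂ := 10 * T + 18) (Q' := fun s => s.R 6 = (1 - p) ^ T)
      (Run.loop T 2 (fun j s => s.R 6 = (1 - p) ^ j ∧ s.R 4 = j) (by simp [h6, h4])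
        ?_ ?_ (by omega) fun _ _ h => h.1) ?_
    · rintro j s₂ - hF₂ ⟨-, h4⟩
      have e0 : s₂.R 0 = T := by rw [hF₂.R 0 rfl, hF₁.R 0 rfl, h0]
      simp [Test.Holds, h4, e0]
    · rintro j s₂ - hF₂ ⟨h6, h4⟩
      have e3 : s₂.R 3 = 1 := by rw [hF₂.R 3 rfl, hF₁.R 3 rfl, h3]
      have e5 : s₂.R 5 = 1 - p := by rw [hF₂.R 5 rfl, hF₁.R 5 rfl, h5]
      refine Run.block _ _ ?_
      simp [Instr.eval, h6, h4, e3, e5, pow_succ]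
    intro s₂ hF₂ h6
    have f0 : s₂.R 0 = T := by rw [hF₂.R 0 rfl, hF₁.R 0 rfl, h0]
    have f1 : s₂.R 1 = p := by rw [hF₂.R 1 rfl, hF₁.R 1 rfl, h1]
    have f2 : s₂.R 2 = c := by rw [hF₂.R 2 rfl, hF₁.R 2 rfl, h2]
    have f3 : s₂.R 3 = 1 := by rw [hF₂.R 3 rfl, hF₁.R 3 rfl, h3]
    have f5 : s₂.R 5 = 1 - p := by rw [hF₂.R 5 rfl, hF₁.R 5 rfl, h5]
    have f9 : s₂.R 9 = 0 := by rw [hF₂.R 9 rfl, hF₁.R 9 rfl, h9]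
    refine Run.seq (T₁ := 3) (T₂ := 10 * T + 15)
      (Q' := fun s => s.R 5 = p / (1 - p) ∧ s.R 4 = 0 ∧ s.R 7 = 0)
      (Run.block _ _ (by simp [Instr.eval, f1, f5])) ?_
    rintro s₃ hF₃ ⟨h5, h4, h7⟩
    refine Run.seq (T₁ := 10 * T + 11) (T₂ := 1) (Q' := fun s => s.R 7 = expectedSales T c p)
      (Run.loop (T + 1) 9 (fun j s => s.R 4 = j ∧
        s.R 6 = T.choose j * p ^ j * (1 - p) ^ (T - j) ∧
        s.R 7 = ∑ k ∈ Finset.range j,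
          (T.choose k : ℝ) * p ^ k * (1 - p) ^ (T - k) * (min k c : ℕ))
        ?_ ?_ ?_ (by omega) fun _ _ h => h.2.2) ?_
    · simp [h4, h7, hF₃.R 6 rfl, h6]
    · rintro j s₄ - hF₄ ⟨h4, -⟩
      have e0 : s₄.R 0 = T := by rw [hF₄.R 0 rfl, hF₃.R 0 rfl, f0]
      simp [Test.Holds, h4, e0]
    · rintro j s₄ hj hF₄ ⟨h4, h6, h7⟩
      have e0 : s₄.R 0 = T := by rw [hF₄.R 0 rfl, hF₃.R 0 rfl, f0]
      have e2 : s₄.R 2 = c := by rw [hF₄.R 2 rfl, hF₃.R 2 rfl, f2]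
      have e3 : s₄.R 3 = 1 := by rw [hF₄.R 3 rfl, hF₃.R 3 rfl, f3]
      have e5 : s₄.R 5 = p / (1 - p) := by rw [hF₄.R 5 rfl, h5]
      have e9 : s₄.R 9 = 0 := by rw [hF₄.R 9 rfl, hF₃.R 9 rfl, f9]
      refine Run.seq (T₁ := 2) (T₂ := 7) (Q' := fun s => s.R 8 = (min j c : ℕ)) ?_ ?_
      · refine Run.cond (c := 1) (fun hb => Run.instr ?_) (fun hb => Run.instr ?_)
        · have : j ≤ c := by simpa [Test.Holds, h4, e2] using hb
          simp [Instr.eval, h4, e9, this]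
        · have : c ≤ j := le_of_lt (by simpa [Test.Holds, h4, e2] using hb)
          simp [Instr.eval, e2, e9, this]
      · intro s₅ hF₅ h8
        refine Run.block _ _ ?_
        have g0 : s₅.R 0 = T := by rw [hF₅.R 0 rfl, e0]
        have g3 : s₅.R 3 = 1 := by rw [hF₅.R 3 rfl, e3]
        have g4 : s₅.R 4 = j := by rw [hF₅.R 4 rfl, h4]
        have g5 : s₅.R 5 = p / (1 - p) := by rw [hF₅.R 5 rfl, e5]
        rw [binomial_weight_succ T j (by omega) hp', Finset.sum_range_succ]
        simp only [List.foldl, Instr.eval]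
        simp [h8, g0, g3, g4, g5, hF₅.R 6 rfl, h6, hF₅.R 7 rfl, h7, mul_comm]
    · intro s₄ hF₄ h7
      refine Run.instr ?_
      simp [Instr.eval, h7, hF₄.R 9 rfl, hF₃.R 9 rfl, f9]
  · obtain rfl : p = 1 := le_antisymm hp1 (by simpa [Test.Holds, h1, h3] using hb)
    rw [expectedSales_one]
    refine Run.cond (c := 1) (fun hb => Run.instr ?_) (fun hb => Run.instr ?_)
    · have : T ≤ c := by simpa [Test.Holds, h0, h2] using hb
      simp [Instr.eval, h0, h9, this]
    · have : c ≤ T := le_of_lt (by simpa [Test.Holds, h0, h2] using hb)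
      simp [Instr.eval, h2, h9, this]

theorem evalProg_callFree : evalProg.CallFree := by
  simp [evalProg, block, Prog.CallFree]

theorem asArray_fin {n : ℕ} (x : Fin n → ℝ) (i : Fin n) : asArray x i = x i := by
  simp [asArray]

theorem asArray_lt {n : ℕ} (x : Fin n → ℝ) {j : ℕ} (h : j < n) : asArray x j = x ⟨j, h⟩ := by
  simp [asArray, h]

theorem sum_range_asArray {n : ℕ} (x : Fin n → ℝ) :
    ∑ j ∈ Finset.range n, asArray x j = ∑ i, x i := by
  rw [Finset.sum_range]
  exact Finset.sum_congr rfl fun i _ => asArray_fin x i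

/-! ### Row-major indices -/

theorem row_index_div {n j : ℕ} (r : ℕ) (hj : j < n) : (r * n + j) / n = r := by
  rw [mul_comm, Nat.mul_add_div (by omega), Nat.div_eq_of_lt hj, add_zero]

theorem row_index_mod {n j : ℕ} (r : ℕ) (hj : j < n) : (r * n + j) % n = j := by
  rw [mul_comm, Nat.mul_add_mod, Nat.mod_eq_of_lt hj]

theorem row_index_lt {n m j r : ℕ} (hr : r < m) (hj : j < n) : r * n + j < m * n := by
  nlinarith

/-! ### Purchase probabilities as mixtures of nested assortments -/

/-- The least of `top` and those `u 0, …, u (j - 1)` that exceed `a`. -/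
def nextLevel (u : ℕ → ℝ) (top a : ℝ) : ℕ → ℝ
  | 0 => top
  | j + 1 => if a < u j ∧ u j < nextLevel u top a j then u j else nextLevel u top a j

/-- The distinct values among `0`, `u 0, …, u (n - 1)` and `top` in increasing order, constant from
`top` on. -/
def level (u : ℕ → ℝ) (top : ℝ) (n : ℕ) : ℕ → ℝ
  | 0 => 0
  | r + 1 => nextLevel u top (level u top n r) n

section levels

variable {u : ℕ → ℝ} {top a : ℝ} {n : ℕ}

theorem nextLevel_le_top (j : ℕ) : nextLevel u top a j ≤ top := by
  induction j with
  | zero => exact le_rfl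
  | succ j ih =>
    rw [nextLevel]
    split_ifs with h
    · exact h.2.le.trans ih
    · exact ih

theorem nextLevel_le {i j : ℕ} (hij : i < j) (hi : a < u i) : nextLevel u top a j ≤ u i := by
  induction j with
  | zero => omega
  | succ j ih =>
    rw [nextLevel]
    rcases Nat.lt_succ_iff_lt_or_eq.1 hij with h | rfl
    · have := ih h
      split_ifs with h'
      · exact h'.2.le.trans this
      · exact this
    · split_ifs with h'
      · exact le_rfl
      · exact not_lt.1 fun h => h' ⟨hi, h⟩

theorem nextLevel_attained (j : ℕ) :
    nextLevel u top a j = top ∨ ∃ i < j, a < u i ∧ nextLevel u top a j = u i := by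
  induction j with
  | zero => exact .inl rfl
  | succ j ih =>
    rw [nextLevel]
    split_ifs with h
    · exact .inr ⟨j, j.lt_succ_self, h.1, rfl⟩
    · rcases ih with h | ⟨i, hi, h⟩
      · exact .inl h
      · exact .inr ⟨i, hi.trans j.lt_succ_self, h⟩

theorem level_le_top (htop : 0 ≤ top) (r : ℕ) : level u top n r ≤ top := by
  cases r with
  | zero => exact htop
  | succ r => exact nextLevel_le_top n

theorem level_le_succ (htop : 0 ≤ top) (r : ℕ) : level u top n r ≤ level u top n (r + 1) := by
  rcases nextLevel_attained (u := u) (top := top) (a := level u top n r) n with h | ⟨i, _, h, h'⟩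
  · rw [level, h]
    exact level_le_top htop r
  · rw [level, h']
    exact h.le

/-- The steps that start below `u i` end at most at `u i`, since no step passes over a value. -/
theorem sum_level_steps {i : ℕ} (hi : i < n) (hui : 0 ≤ u i) (htop : 0 ≤ top) (r : ℕ) :
    ∑ k ∈ Finset.range r,
      (if level u top n k < u i then level u top n (k + 1) - level u top n k else 0) =
      min (u i) (level u top n r) := by
  induction r with
  | zero => simp [level, hui]
  | succ r ih =>
    rw [Finset.sum_range_succ, ih]
    split_ifs with h
    · rw [min_eq_right h.le,
        min_eq_right (show level u top n (r + 1) ≤ u i from nextLevel_le hi h)]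
      ring
    · rw [min_eq_left (not_lt.1 h), min_eq_left ((not_lt.1 h).trans (level_le_succ htop r)),
        add_zero]

/-- Each step of the levels passes at least one of the values `u i`. -/
theorem card_above_level (hu : ∀ i < n, u i ≤ top) (r : ℕ) :
    ((Finset.range n).filter fun i => level u top n r < u i).card ≤ n - r := by
  induction r with
  | zero => exact (Finset.card_filter_le _ _).trans (by simp)
  | succ r ih =>
    set A := (Finset.range n).filter fun i => level u top n (r + 1) < u i
    set B := (Finset.range n).filter fun i => level u top n r < u i
    rcases nextLevel_attained (u := u) (top := top) (a := level u top n r) n with h | ⟨i, hi, h, h'⟩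
    · have : A = ∅ := by
        refine Finset.filter_eq_empty_iff.2 fun i hi => ?_
        rw [level, h]
        exact not_lt.2 (hu i (Finset.mem_range.1 hi))
      simp [this]
    · have : A ⊂ B := by
        refine (Finset.ssubset_iff_of_subset fun j hj => ?_).2
          ⟨i, Finset.mem_filter.2 ⟨Finset.mem_range.2 hi, h⟩, ?_⟩
        · rw [Finset.mem_filter] at hj ⊢
          refine ⟨hj.1, lt_trans ?_ hj.2⟩
          rwa [level, h']
        · rw [Finset.mem_filter, level, h']
          exact fun h => lt_irrefl _ h.2
      have := Finset.card_lt_card this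
      omega

/-- After `n` steps no value is left above the level, so the next step leads to `top`. -/
theorem level_last (hu : ∀ i < n, u i ≤ top) : level u top n (n + 1) = top := by
  rcases nextLevel_attained (u := u) (top := top) (a := level u top n n) n with h | ⟨i, hi, h, -⟩
  · exact h
  · have h0 := card_above_level hu n
    rw [Nat.sub_self, Nat.le_zero, Finset.card_eq_zero, Finset.filter_eq_empty_iff] at h0
    exact absurd h (h0 (Finset.mem_range.2 hi))

end levels

namespace Instance

variable {n : ℕ} (I : Instance n) (p : Fin n → ℝ)

/-- Purchase probability of `i` in multiples of its preference weight. -/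
def ratio : ℕ → ℝ := asArray fun i => p i / I.v i

/-- The `k`-th of the nested assortments: the products whose ratio exceeds the `k`-th level. -/
def nested (k : ℕ) : Finset (Fin n) :=
  Finset.univ.filter fun i => level (I.ratio p) (1 - ∑ j, p j) n k < I.ratio p i

/-- The probability with which the `k`-th nested assortment is offered. -/
def nestedWeight (k : ℕ) : ℝ :=
  (level (I.ratio p) (1 - ∑ j, p j) n (k + 1) - level (I.ratio p) (1 - ∑ j, p j) n k) *
    (1 + ∑ j ∈ I.nested p k, I.v j)

/-- Purchase probabilities that the multinomial logit model can attain. -/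
def Attainable : Prop := ∀ i, 0 ≤ p i ∧ p i ≤ I.v i * (1 - ∑ j, p j)

variable {I p}

theorem Attainable.top_nonneg (hp : I.Attainable p) : 0 ≤ 1 - ∑ j, p j := by
  by_contra h
  obtain ⟨i, -, hi⟩ := Finset.exists_lt_of_sum_lt
    (show ∑ _i : Fin n, (0 : ℝ) < ∑ j, p j by simp; linarith)
  have := (hp i).2
  have := mul_neg_of_pos_of_neg (I.v_pos i) (not_le.1 h)
  linarith

theorem Attainable.ratio_nonneg (hp : I.Attainable p) (i : Fin n) : 0 ≤ I.ratio p i := by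
  rw [ratio, asArray_fin]
  exact div_nonneg (hp i).1 (I.v_pos i).le

theorem Attainable.ratio_le (hp : I.Attainable p) (i : ℕ) (hi : i < n) :
    I.ratio p i ≤ 1 - ∑ j, p j := by
  rw [ratio, asArray_lt _ hi, div_le_iff₀ (I.v_pos _), mul_comm]
  exact (hp _).2

theorem Attainable.nestedWeight_nonneg (hp : I.Attainable p) (k : ℕ) : 0 ≤ I.nestedWeight p k :=
  mul_nonneg (sub_nonneg.2 (level_le_succ hp.top_nonneg k)) (I.denom_pos _).le

theorem Attainable.sum_nestedWeight_mul (hp : I.Attainable p) (i : Fin n) :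
    ∑ k ∈ Finset.range (n + 1), I.nestedWeight p k * I.choiceProb (I.nested p k) (some i) =
      p i := by
  have h := sum_level_steps (u := I.ratio p) i.2 (hp.ratio_nonneg i) hp.top_nonneg (n + 1)
  rw [level_last hp.ratio_le, min_eq_left (hp.ratio_le i i.2)] at h
  calc _ = ∑ k ∈ Finset.range (n + 1), I.v i *
        (if level (I.ratio p) (1 - ∑ j, p j) n k < I.ratio p i then
          level (I.ratio p) (1 - ∑ j, p j) n (k + 1) - level (I.ratio p) (1 - ∑ j, p j) n k
          else 0) := by
        refine Finset.sum_congr rfl fun k _ => ?_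
        have := (I.denom_pos (I.nested p k)).ne'
        simp only [nestedWeight, choiceProb]
        by_cases hk : level (I.ratio p) (1 - ∑ j, p j) n k < I.ratio p i
        · have hi : i ∈ I.nested p k := Finset.mem_filter.2 ⟨Finset.mem_univ _, hk⟩
          rw [if_pos hi, if_pos hk]
          field_simp
        · have hi : i ∉ I.nested p k := fun h => hk (Finset.mem_filter.1 h).2
          rw [if_neg hi, if_neg hk, mul_zero, mul_zero]
    _ = p i := by
        rw [← Finset.mul_sum, h, ratio, asArray_fin, mul_div_cancel₀ _ (I.v_pos i).ne']

theorem Attainable.sum_nestedWeight (hp : I.Attainable p) :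
    ∑ k ∈ Finset.range (n + 1), I.nestedWeight p k = 1 := by
  have h0 : ∑ k ∈ Finset.range (n + 1), I.nestedWeight p k * I.choiceProb (I.nested p k) none =
      1 - ∑ j, p j := by
    rw [← level_last hp.ratio_le, ← sub_zero (level (I.ratio p) _ n (n + 1))]
    refine (Finset.sum_congr rfl fun k _ => ?_).trans
      (Finset.sum_range_sub (level (I.ratio p) (1 - ∑ j, p j) n) (n + 1))
    have := (I.denom_pos (I.nested p k)).ne'
    simp only [nestedWeight, choiceProb]
    field_simp
  calc _ = ∑ k ∈ Finset.range (n + 1), ∑ o, I.nestedWeight p k * I.choiceProb (I.nested p k) o := by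
        refine Finset.sum_congr rfl fun k _ => ?_
        rw [← Finset.mul_sum, I.sum_choiceProb, mul_one]
    _ = 1 := by
        rw [Finset.sum_comm, Fintype.sum_option, h0,
          Finset.sum_congr rfl fun i _ => hp.sum_nestedWeight_mul i]
        ring

end Instance

/-- Computes the nested assortments, as the rows of array `3`, and their probabilities in array
`2`. Array `4` receives the ratios, real register `8` the no-purchase probability. In each round
real register `2` holds the current level, `3` the next one, `4` the denominator of the choice
probabilities; index register `4` is the position in array `3`. -/
def sampleProg : Prog :=
  .seq (block (.setN 1 1) [.setR 1 1, .setR 8 1])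
    (.seq (forN 3 0 (block (.load 6 1 3) [.load 7 0 3, .subR 8 8 6, .divR 6 6 7, .store 4 3 6]))
      (.seq (.instr (.addN 5 0 1))
        (forN 2 5
          (.seq (block (.setR 4 1) [.addR 3 8 0])
            (.seq
              (forN 3 0
                (.seq (.instr (.load 6 4 3))
                  (.seq
                    (.cond (.ltR 2 6)
                      (.seq (block (.load 7 0 3) [.addR 4 4 7, .store 3 4 1])
                        (.cond (.ltR 6 3) (.instr (.addR 3 6 0)) (.instr (.addR 3 3 0))))
                      (.instr (.store 3 4 0)))
                    (.instr (.addN 4 4 1)))))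
              (block (.subR 5 3 2) [.mulR 5 5 4, .store 2 2 5, .addR 2 3 0]))))))

theorem sampleProg_callFree : sampleProg.CallFree := by
  simp [sampleProg, forN, block, Prog.CallFree]

theorem Instance.run_sampleProg (O : ℕ → ℝ → ℝ) {n : ℕ} (I : Instance n) (p : Fin n → ℝ)
    (hp : I.Attainable p) :
    Run O sampleProg (I.periodInput p) ((n + 1) * (n * 12 + 20) + n * 7 + 20)
      (I.DescribesDistribution p) := by
  set u := I.ratio p with hu
  set top := 1 - ∑ j, p j with htop
  refine Run.seq (T₁ := 3) (T₂ := (n + 1) * (n * 12 + 20) + n * 7 + 17)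
    (Q' := fun s => s.N 0 = n ∧ s.N 1 = 1 ∧ s.N 4 = 0 ∧ s.R 0 = 0 ∧ s.R 1 = 1 ∧ s.R 2 = 0 ∧
      s.R 8 = 1 ∧ s.M 0 = asArray I.v ∧ s.M 1 = asArray p)
    (Run.block _ _ (by simp [Instr.eval, periodInput])) ?_
  rintro s - ⟨hN0, hN1, hN4, hR0, hR1, hR2, hR8, hM0, hM1⟩
  refine Run.seq (T₁ := n * 7 + 2) (T₂ := (n + 1) * (n * 12 + 20) + 15)
    (Q' := fun s => s.R 8 = top ∧ ∀ i < n, s.M 4 i = u i)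
    (Run.forN 5 (fun j s => s.R 8 = 1 - ∑ i ∈ Finset.range j, asArray p i ∧
      ∀ i < j, s.M 4 i = asArray p i / asArray I.v i) hN1 (by simp [hR8]) ?_ ?_ (by rw [hN0])) ?_
  · rintro j s₁ hj h3 hF ⟨h8, h4⟩
    have e0 : s₁.M 0 = asArray I.v := by rw [hF.M 0 rfl, hM0]
    have e1 : s₁.M 1 = asArray p := by rw [hF.M 1 rfl, hM1]
    refine Run.block _ _ ⟨?_, fun i hi => ?_⟩
    · simp [Instr.eval, h8, e1, h3, Finset.sum_range_succ, sub_sub]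
    · simp only [List.foldl, Instr.eval]
      rcases Nat.lt_succ_iff_lt_or_eq.1 hi with hi | rfl
      · simp [h3, hi.ne, h4 i hi]
      · simp [h3, e0, e1]
  · rintro s₁ - ⟨h8, h4⟩
    rw [hN0] at h8 h4
    refine ⟨by rw [h8, sum_range_asArray], fun i hi => ?_⟩
    rw [h4 i hi, hu, ratio, asArray_lt _ hi, asArray_lt _ hi, asArray_lt _ hi]
  rintro s₁ hF₁ ⟨h8, h4⟩
  refine Run.seq (T₁ := 1) (T₂ := (n + 1) * (n * 12 + 20) + 14)
    (Q' := fun s => s.N 5 = n + 1)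
    (Run.instr (by simp [Instr.eval, hF₁.N 0 rfl, hF₁.N 1 rfl, hN0, hN1])) ?_
  intro s₂ hF₂ h5
  refine Run.forN (n * 12 + 17) (fun r s => s.N 4 = r * n ∧ s.R 2 = level u top n r ∧
      (∀ k < r, s.M 2 k = I.nestedWeight p k) ∧
      ∀ k < r * n, s.M 3 k = if level u top n (k / n) < u (k % n) then 1 else 0)
    (by rw [hF₂.N 1 rfl, hF₁.N 1 rfl, hN1])
    (by simp [hF₂.N 4 rfl, hF₁.N 4 rfl, hN4, hF₂.R 2 rfl, hF₁.R 2 rfl, hR2, level])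
    ?_ ?_ (by rw [h5]; nlinarith)
  · rintro r s₃ hr h2 hF₃ ⟨g4, g2, gM2, gM3⟩
    have f0 : s₃.R 0 = 0 := by rw [hF₃.R 0 rfl, hF₂.R 0 rfl, hF₁.R 0 rfl, hR0]
    have f1 : s₃.R 1 = 1 := by rw [hF₃.R 1 rfl, hF₂.R 1 rfl, hF₁.R 1 rfl, hR1]
    have f8 : s₃.R 8 = top := by rw [hF₃.R 8 rfl, hF₂.R 8 rfl, h8]
    have fN0 : s₃.N 0 = n := by rw [hF₃.N 0 rfl, hF₂.N 0 rfl, hF₁.N 0 rfl, hN0]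
    have fN1 : s₃.N 1 = 1 := by rw [hF₃.N 1 rfl, hF₂.N 1 rfl, hF₁.N 1 rfl, hN1]
    have fM0 : s₃.M 0 = asArray I.v := by rw [hF₃.M 0 rfl, hF₂.M 0 rfl, hF₁.M 0 rfl, hM0]
    have fM4 : ∀ i < n, s₃.M 4 i = u i := by rw [hF₃.M 4 rfl, hF₂.M 4 rfl]; exact h4
    set a := level u top n r with ha
    refine Run.seq (T₁ := 2) (T₂ := n * 12 + 15) (Q' := fun s => s.R 3 = top ∧ s.R 4 = 1)
      (Run.block _ _ (by simp [Instr.eval, f8, f0])) ?_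
    rintro s₄ hF₄ ⟨k3, k4⟩
    refine Run.seq (T₁ := n * 12 + 2) (T₂ := 4)
      (Q' := fun s => s.R 3 = level u top n (r + 1) ∧
        s.R 4 = 1 + ∑ j ∈ I.nested p r, I.v j ∧ s.N 4 = (r + 1) * n ∧
        ∀ k < (r + 1) * n, s.M 3 k = if level u top n (k / n) < u (k % n) then 1 else 0)
      (Run.forN 10 (fun j s => s.R 3 = nextLevel u top a j ∧
        s.R 4 = 1 + ∑ i ∈ Finset.range j, (if a < u i then asArray I.v i else 0) ∧
        s.N 4 = r * n + j ∧
        ∀ k < r * n + j, s.M 3 k = if level u top n (k / n) < u (k % n) then 1 else 0)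
        (by rw [hF₄.N 1 rfl, fN1]) ?_ ?_ ?_ (by rw [hF₄.N 0 rfl, fN0])) ?_
    · simpa [k3, k4, hF₄.N 4 rfl, g4, hF₄.M 3 rfl, nextLevel] using gM3
    · rintro j s₅ hj hj3 hF₅ ⟨l3, l4, lN4, lM3⟩
      rw [hF₄.N 0 rfl, fN0] at hj
      have e1 := row_index_div r hj
      have e2 := row_index_mod r hj
      have m0 : s₅.R 0 = 0 := by rw [hF₅.R 0 rfl, hF₄.R 0 rfl, f0]
      have m1 : s₅.R 1 = 1 := by rw [hF₅.R 1 rfl, hF₄.R 1 rfl, f1]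
      have m2 : s₅.R 2 = a := by rw [hF₅.R 2 rfl, hF₄.R 2 rfl, g2]
      have mM0 : s₅.M 0 = asArray I.v := by rw [hF₅.M 0 rfl, hF₄.M 0 rfl, fM0]
      have mM4 : s₅.M 4 j = u j := by rw [hF₅.M 4 rfl, hF₄.M 4 rfl, fM4 j hj]
      have mN1 : s₅.N 1 = 1 := by rw [hF₅.N 1 rfl, hF₄.N 1 rfl, fN1]
      refine Run.seq (T₁ := 1) (T₂ := 9) (Q' := fun s => s.R 6 = u j)
        (Run.instr (by simp [Instr.eval, hj3, mM4])) ?_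
      intro s₆ hF₆ l6
      have n4 : s₆.N 4 = r * n + j := by rw [hF₆.N 4 rfl, lN4]
      have nM3 : s₆.M 3 = s₅.M 3 := hF₆.M 3 rfl
      refine Run.seq (T₁ := 6) (T₂ := 1) (Q' := fun s => s.R 3 = nextLevel u top a (j + 1) ∧
        s.R 4 = 1 + ∑ i ∈ Finset.range (j + 1), (if a < u i then asArray I.v i else 0) ∧
        ∀ k < r * n + (j + 1), s.M 3 k = if level u top n (k / n) < u (k % n) then 1 else 0) ?_ ?_
      · refine Run.cond (c := 5) (fun hb => ?_) (fun hb => ?_)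
        · have hb' : a < u j := by simpa [Test.Holds, hF₆.R 2 rfl, m2, l6] using hb
          refine Run.seq (T₁ := 3) (T₂ := 2) (Q' := fun s =>
            s.R 4 = 1 + ∑ i ∈ Finset.range (j + 1), (if a < u i then asArray I.v i else 0) ∧
            ∀ k < r * n + (j + 1), s.M 3 k = if level u top n (k / n) < u (k % n) then 1 else 0)
            (Run.block _ _ ⟨?_, fun k hk => ?_⟩) ?_
          · simp [Instr.eval, hF₆.R 4 rfl, l4, hF₆.M 0 rfl, mM0, hF₆.N 3 rfl, hj3,
              Finset.sum_range_succ, hb', add_assoc]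
          · simp only [List.foldl, Instr.eval]
            rcases (show k < r * n + j ∨ k = r * n + j by omega) with hk | rfl
            · simp [n4, nM3, hk.ne, lM3 k hk]
            · simp [n4, hF₆.R 1 rfl, m1, e1, e2, ← ha, hb']
          · rintro s₇ hF₇ ⟨l4', lM3'⟩
            have e3 : s₇.R 3 = nextLevel u top a j := by rw [hF₇.R 3 rfl, hF₆.R 3 rfl, l3]
            have e6 : s₇.R 6 = u j := by rw [hF₇.R 6 rfl, l6]
            have e0 : s₇.R 0 = 0 := by rw [hF₇.R 0 rfl, hF₆.R 0 rfl, m0]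
            refine Run.cond (c := 1) (fun hc => Run.instr ?_) (fun hc => Run.instr ?_)
            · have hc' : u j < nextLevel u top a j := by simpa [Test.Holds, e6, e3] using hc
              refine ⟨?_, by simpa [Instr.eval] using l4', lM3'⟩
              simp [Instr.eval, nextLevel, hb', hc', e6, e0]
            · have hc' : ¬ u j < nextLevel u top a j := by simpa [Test.Holds, e6, e3] using hc
              refine ⟨?_, by simpa [Instr.eval] using l4', lM3'⟩
              simp [Instr.eval, nextLevel, hc', e3, e0]
        · have hb' : ¬ a < u j := by simpa [Test.Holds, hF₆.R 2 rfl, m2, l6] using hb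
          refine (Run.instr (T := 1) ⟨?_, ?_, fun k hk => ?_⟩).mono (by omega) fun _ _ h => h
          · simp [Instr.eval, hF₆.R 3 rfl, l3, nextLevel, hb']
          · simp [Instr.eval, hF₆.R 4 rfl, l4, Finset.sum_range_succ, hb']
          · simp only [Instr.eval]
            rcases (show k < r * n + j ∨ k = r * n + j by omega) with hk | rfl
            · simp [n4, nM3, hk.ne, lM3 k hk]
            · simp [n4, hF₆.R 0 rfl, m0, e1, e2, ← ha, hb']
      · rintro s₇ hF₇ ⟨l3', l4', lM3'⟩
        refine Run.instr ⟨l3', l4', ?_, lM3'⟩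
        simp [Instr.eval, hF₇.N 4 rfl, n4, hF₇.N 1 rfl, hF₆.N 1 rfl, mN1, add_assoc]
    · rintro s₅ - ⟨l3, l4, lN4, lM3⟩
      rw [hF₄.N 0 rfl, fN0] at l3 l4 lN4 lM3
      rw [← Nat.succ_mul] at lN4 lM3
      refine ⟨l3, ?_, lN4, lM3⟩
      rw [l4, nested, Finset.sum_filter, Finset.sum_range]
      simp only [asArray_fin]
      rfl
    · rintro s₅ hF₅ ⟨l3, l4, lN4, lM3⟩
      have e2 : s₅.R 2 = a := by rw [hF₅.R 2 rfl, hF₄.R 2 rfl, g2]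
      have e0 : s₅.R 0 = 0 := by rw [hF₅.R 0 rfl, hF₄.R 0 rfl, f0]
      have eN2 : s₅.N 2 = r := by rw [hF₅.N 2 rfl, hF₄.N 2 rfl, h2]
      refine Run.block _ _ ⟨?_, ?_, fun k hk => ?_, ?_⟩
      · simp [Instr.eval, lN4]
      · simp [Instr.eval, l3, e0]
      · simp only [List.foldl, Instr.eval]
        rcases Nat.lt_succ_iff_lt_or_eq.1 hk with hk | rfl
        · simp [eN2, hk.ne, hF₅.M 2 rfl, hF₄.M 2 rfl, gM2 k hk]
        · simp [eN2, l3, e2, l4, nestedWeight, ha, ← hu, ← htop]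
      · simpa [Instr.eval] using lM3
  · rintro s₃ - ⟨-, -, gM2, gM3⟩
    rw [h5] at gM2 gM3
    refine ⟨fun k => I.nested p k, fun k j => ?_, fun k => ?_, ?_, fun i => ?_⟩
    · rw [gM3 _ (row_index_lt k.2 j.2), row_index_div _ j.2, row_index_mod _ j.2]
      simp [nested, hu, htop]
    · rw [gM2 _ k.2]
      exact hp.nestedWeight_nonneg k
    · rw [← hp.sum_nestedWeight, Finset.sum_range]
      exact Finset.sum_congr rfl fun k _ => gM2 _ k.2
    · rw [← hp.sum_nestedWeight_mul i, Finset.sum_range]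
      exact Finset.sum_congr rfl fun k _ => by rw [gM2 _ k.2]

/-! ### Binomial expectations -/

/-- `𝔼[g(Z)]` for a binomial variable `Z` with `T` trials and success probability `p`. -/
def binomialMean (T : ℕ) (p : ℝ) (g : ℕ → ℝ) : ℝ :=
  ∑ k ∈ Finset.range (T + 1), (T.choose k : ℝ) * p ^ k * (1 - p) ^ (T - k) * g k

theorem expectedSales_eq (T c : ℕ) (p : ℝ) :
    expectedSales T c p = binomialMean T p fun k => (min k c : ℕ) := rfl

theorem binomialMean_zero (p : ℝ) (g : ℕ → ℝ) : binomialMean 0 p g = g 0 := by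
  simp [binomialMean]

theorem binomialMean_add (T : ℕ) (p : ℝ) (f g : ℕ → ℝ) :
    binomialMean T p (fun k => f k + g k) = binomialMean T p f + binomialMean T p g := by
  simp only [binomialMean, mul_add, Finset.sum_add_distrib]

theorem binomialMean_mul (T : ℕ) (p a : ℝ) (g : ℕ → ℝ) :
    binomialMean T p (fun k => a * g k) = a * binomialMean T p g := by
  simp only [binomialMean, Finset.mul_sum]
  exact Finset.sum_congr rfl fun k _ => by ring

/-- Conditioning on one of the trials. -/
theorem binomialMean_succ (T : ℕ) (p : ℝ) (g : ℕ → ℝ) :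
    binomialMean (T + 1) p g = binomialMean T p fun k => p * g (k + 1) + (1 - p) * g k := by
  have key : ∀ (T : ℕ) (g : ℕ → ℝ), binomialMean T p g =
      ∑ ij ∈ Finset.HasAntidiagonal.antidiagonal T,
        (T.choose ij.1 : ℝ) * (p ^ ij.1 * (1 - p) ^ ij.2 * g ij.1) := by
    intro T g
    rw [Finset.Nat.sum_antidiagonal_eq_sum_range_succ
      (fun i j => (T.choose i : ℝ) * (p ^ i * (1 - p) ^ j * g i))]
    exact Finset.sum_congr rfl fun k _ => by ring
  rw [key, key, Finset.sum_antidiagonal_choose_succ_mul (fun i j => p ^ i * (1 - p) ^ j * g i),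
    ← Finset.sum_add_distrib]
  refine Finset.sum_congr rfl fun ij hij => ?_
  rw [Finset.HasAntidiagonal.mem_antidiagonal] at hij
  rw [← Nat.choose_symm_of_eq_add hij.symm]
  ring

theorem binomialMean_mono {T : ℕ} {p : ℝ} (h0 : 0 ≤ p) (h1 : p ≤ 1) {f g : ℕ → ℝ}
    (h : ∀ k, f k ≤ g k) : binomialMean T p f ≤ binomialMean T p g :=
  Finset.sum_le_sum fun k _ => mul_le_mul_of_nonneg_left (h k)
    (mul_nonneg (by positivity) (pow_nonneg (sub_nonneg.2 h1) _))

theorem binomialMean_quadratic (T : ℕ) (p a b c : ℝ) :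
    binomialMean T p (fun k => a + b * k + c * (k : ℝ) ^ 2) =
      a + b * (T * p) + c * (T * p * (1 - p) + (T * p) ^ 2) := by
  induction T generalizing a b c with
  | zero => simp [binomialMean_zero]
  | succ T ih =>
    rw [binomialMean_succ]
    have : (fun k : ℕ => p * (a + b * ((k + 1 : ℕ) : ℝ) + c * ((k + 1 : ℕ) : ℝ) ^ 2) +
        (1 - p) * (a + b * k + c * (k : ℝ) ^ 2)) =
        fun k : ℕ => (a + p * (b + c)) + (b + 2 * p * c) * (k : ℝ) + c * (k : ℝ) ^ 2 := by
      funext k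
      push_cast
      ring
    rw [this, ih]
    push_cast
    ring

/-- The mean of a function with increments in `[0, 1]` is `T`-Lipschitz in the success
probability. -/
theorem binomialMean_sub_le (T : ℕ) {a b : ℝ} (ha : 0 ≤ a) (hab : a ≤ b) (hb : b ≤ 1)
    (g : ℕ → ℝ) (hg : ∀ k, g (k + 1) ≤ g k + 1) (hg' : ∀ k, g k ≤ g (k + 1)) :
    binomialMean T b g - binomialMean T a g ≤ T * (b - a) := by
  induction T generalizing g with
  | zero => simp [binomialMean_zero]
  | succ T ih =>
    simp only [binomialMean_succ, binomialMean_add, binomialMean_mul]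
    have h1 := ih g hg hg'
    have h2 := ih (fun k => g (k + 1)) (fun k => hg (k + 1)) fun k => hg' (k + 1)
    have h3 : binomialMean T a (fun k => g (k + 1)) ≤ binomialMean T a g + 1 := by
      have := binomialMean_mono (T := T) ha (hab.trans hb) hg
      have e := binomialMean_quadratic T a 1 0 0
      simp only [zero_mul, add_zero] at e
      rwa [binomialMean_add, e] at this
    push_cast
    nlinarith [mul_le_mul_of_nonneg_left h2 (ha.trans hab),
      mul_le_mul_of_nonneg_left h1 (sub_nonneg.2 hb),
      mul_le_mul_of_nonneg_left h3 (sub_nonneg.2 hab)]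

theorem expectedSales_sub_le (T c : ℕ) {a b : ℝ} (ha : 0 ≤ a) (hab : a ≤ b) (hb : b ≤ 1) :
    expectedSales T c b - expectedSales T c a ≤ T * (b - a) := by
  refine binomialMean_sub_le T ha hab hb _ (fun k => ?_) fun k => ?_
  · exact_mod_cast (by omega : min (k + 1) c ≤ min k c + 1)
  · exact_mod_cast (by omega : min k c ≤ min (k + 1) c)

theorem expectedSales_zero (T c : ℕ) : expectedSales T c 0 = 0 := by
  rw [expectedSales]
  refine Finset.sum_eq_zero fun k _ => ?_
  rcases Nat.eq_zero_or_pos k with rfl | hk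
  · simp
  · simp [hk.ne']

theorem expectedSales_nonneg (T c : ℕ) {p : ℝ} (h0 : 0 ≤ p) (h1 : p ≤ 1) :
    0 ≤ expectedSales T c p :=
  Finset.sum_nonneg fun k _ =>
    mul_nonneg (mul_nonneg (by positivity) (pow_nonneg (sub_nonneg.2 h1) _)) (Nat.cast_nonneg _)

theorem expectedSales_le (T c : ℕ) {p : ℝ} (h0 : 0 ≤ p) (h1 : p ≤ 1) :
    expectedSales T c p ≤ T * p := by
  have := expectedSales_sub_le T c le_rfl h0 h1
  rwa [expectedSales_zero, sub_zero, sub_zero] at this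

/-- With mean `μ ≤ c` and `d = c - μ`, the quadratic bound
`max (k - c) 0 ≤ (k - c + s) ^ 2 / (4 * s)` at `s = √(μ + d ^ 2)` shows that at most `(s - d) / 2`
is lost by truncation. -/
theorem expectedSales_ge_sqrt (T c : ℕ) {p : ℝ} (h0 : 0 < p) (h1 : p ≤ 1) (hT : 0 < T) :
    T * p - (√(T * p + (c - T * p) ^ 2) - (c - T * p)) / 2 ≤ expectedSales T c p := by
  have hμ : 0 < T * p := mul_pos (Nat.cast_pos.2 hT) h0
  set μ := T * p with hμ'
  set d := (c : ℝ) - μ with hd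
  set s := √(μ + d ^ 2) with hs
  have hs0 : 0 < s := Real.sqrt_pos.2 (by positivity)
  have hs2 : s ^ 2 = μ + d ^ 2 := Real.sq_sqrt (by positivity)
  have hpt : ∀ k : ℕ, (-(s - c) ^ 2 / (4 * s)) + (1 - 2 * (s - c) / (4 * s)) * (k : ℝ) +
      (-1 / (4 * s)) * (k : ℝ) ^ 2 ≤ ((min k c : ℕ) : ℝ) := by
    intro k
    have e : (-(s - c) ^ 2 / (4 * s)) + (1 - 2 * (s - c) / (4 * s)) * (k : ℝ) +
      (-1 / (4 * s)) * (k : ℝ) ^ 2 = k - (k - c + s) ^ 2 / (4 * s) := by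
      field_simp
      ring
    rw [e]
    rcases le_total k c with h | h
    · rw [min_eq_left h]
      have : 0 ≤ (k - c + s) ^ 2 / (4 * s) := by positivity
      linarith
    · rw [min_eq_right h]
      have : (k - c : ℝ) ≤ (k - c + s) ^ 2 / (4 * s) := by
        rw [le_div_iff₀ (by positivity)]
        nlinarith [sq_nonneg ((k : ℝ) - c - s)]
      linarith
  have := binomialMean_mono (T := T) h0.le h1 hpt
  rw [binomialMean_quadratic, ← expectedSales_eq, ← hμ'] at this
  refine le_trans ?_ this
  have e : -(s - c) ^ 2 / (4 * s) + (1 - 2 * (s - c) / (4 * s)) * μ +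
      -1 / (4 * s) * (μ * (1 - p) + μ ^ 2) = μ - (μ * (1 - p) + (s - d) ^ 2) / (4 * s) := by
    rw [hd]
    field_simp
    ring
  rw [e]
  have : (μ * (1 - p) + (s - d) ^ 2) / (4 * s) ≤ (s - d) / 2 := by
    rw [div_le_div_iff₀ (by positivity) two_pos]
    nlinarith [mul_pos hμ h0]
  linarith

/-- Truncation at `c`, at least the mean, loses at most half of the mean and at most the fraction
`1 / √c` of it. -/
theorem expectedSales_ge (T c : ℕ) (hT : 0 < T) (hc : 0 < c) {p : ℝ} (h0 : 0 ≤ p) (h1 : p ≤ 1)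
    (hp : T * p ≤ c) : max (1 / 2) (1 - 1 / √c) * (T * p) ≤ expectedSales T c p := by
  rcases h0.eq_or_lt with rfl | h0
  · simp [expectedSales_zero]
  have hμ : 0 < T * p := mul_pos (Nat.cast_pos.2 hT) h0
  have h := expectedSales_ge_sqrt T c h0 h1 hT
  have hc1 : (1 : ℝ) ≤ c := by exact_mod_cast hc
  set μ := T * p with hμ'
  obtain ⟨d, hd⟩ : ∃ d, d = (c : ℝ) - μ := ⟨_, rfl⟩
  rw [← hd] at h
  have hd0 : 0 ≤ d := by linarith
  have hcd : (c : ℝ) = μ + d := by linarith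
  set s := √(μ + d ^ 2) with hs
  have hs0 : 0 < s := Real.sqrt_pos.2 (by positivity)
  have hs2 : s ^ 2 = μ + d ^ 2 := Real.sq_sqrt (by positivity)
  rw [max_mul_of_nonneg _ _ hμ.le, max_le_iff]
  refine ⟨le_trans ?_ h, le_trans ?_ h⟩
  · have : s ≤ μ + d := by
      refine Real.sqrt_le_iff.2 ⟨by linarith, ?_⟩
      nlinarith
    linarith
  · set w := √(c : ℝ) with hw
    have hw0 : 0 < w := Real.sqrt_pos.2 (by linarith)
    have hw2 : w ^ 2 = c := Real.sq_sqrt (by linarith)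
    have hws : w ≤ 2 * (s + d) := by
      refine Real.sqrt_le_iff.2 ⟨by linarith, ?_⟩
      rcases le_total d (1 / 2) with h | h <;> nlinarith [mul_nonneg hs0.le hd0]
    have hsd : (s - d) * (s + d) = μ := by nlinarith
    have : (s - d) / 2 ≤ 1 / w * μ := by
      rw [div_mul_eq_mul_div, one_mul, div_le_div_iff₀ two_pos hw0]
      have hsd0 : 0 ≤ s - d := by
        by_contra hneg
        have := mul_neg_of_neg_of_pos (not_le.1 hneg) (show 0 < s + d by linarith)
        linarith
      nlinarith [mul_le_mul_of_nonneg_left hws hsd0]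
    linarith

/-! ### Sales of a dynamic policy -/

/-- The mean of `F` under a probability mass function on a finite type. -/
def pmfMean {α : Type*} [Fintype α] (p : PMF α) (F : α → ℝ) : ℝ := ∑ a, (p a).toReal * F a

section pmfMean

variable {α β : Type*} [Fintype α] [Fintype β] (p : PMF α)

theorem pmfMean_const (c : ℝ) : pmfMean p (fun _ => c) = c := by
  have h : ∑ a, p a = 1 := by rw [← p.tsum_coe, tsum_fintype]
  rw [pmfMean, ← Finset.sum_mul, ← ENNReal.toReal_sum fun a _ => p.apply_ne_top a, h,
    ENNReal.toReal_one, one_mul]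

theorem pmfMean_add (F G : α → ℝ) :
    pmfMean p (fun a => F a + G a) = pmfMean p F + pmfMean p G := by
  simp only [pmfMean, mul_add, Finset.sum_add_distrib]

theorem pmfMean_mul_left (c : ℝ) (F : α → ℝ) :
    pmfMean p (fun a => c * F a) = c * pmfMean p F := by
  simp only [pmfMean, Finset.mul_sum]
  exact Finset.sum_congr rfl fun k _ => by ring

theorem pmfMean_mono {F G : α → ℝ} (h : ∀ a ∈ p.support, F a ≤ G a) :
    pmfMean p F ≤ pmfMean p G := by
  refine Finset.sum_le_sum fun a _ => ?_
  by_cases ha : p a = 0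
  · simp [ha]
  · exact mul_le_mul_of_nonneg_left (h a ((p.mem_support_iff a).2 ha)) ENNReal.toReal_nonneg

theorem pmfMean_bind (f : α → PMF β) (F : β → ℝ) :
    pmfMean (p.bind f) F = pmfMean p fun a => pmfMean (f a) F := by
  simp only [pmfMean, PMF.bind_apply, tsum_fintype]
  simp_rw [ENNReal.toReal_sum fun a _ =>
    ENNReal.mul_ne_top (p.apply_ne_top a) ((f a).apply_ne_top _), ENNReal.toReal_mul,
    Finset.sum_mul, Finset.mul_sum]
  rw [Finset.sum_comm]
  exact Finset.sum_congr rfl fun a _ => Finset.sum_congr rfl fun b _ => by ring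

theorem pmfMean_pure (a : α) (F : α → ℝ) : pmfMean (PMF.pure a) F = F a := by
  classical
  rw [pmfMean, Finset.sum_eq_single a]
  · simp
  · intro b _ hb
    simp [PMF.pure_apply, hb]
  · simp

theorem pmfMean_map (f : α → β) (F : β → ℝ) :
    pmfMean (p.map f) F = pmfMean p fun a => F (f a) := by
  rw [PMF.map, pmfMean_bind]
  exact Finset.sum_congr rfl fun a _ => by simp only [Function.comp_apply, pmfMean_pure]

end pmfMean

/-- The number of customers in the history `h` with decision `o`. -/
def decisions {n t : ℕ} (h : Fin t → Option (Fin n)) (o : Option (Fin n)) : ℕ :=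
  (Finset.univ.filter fun τ => h τ = o).card

theorem decisions_some {n t : ℕ} (h : Fin t → Option (Fin n)) (i : Fin n) :
    decisions h (some i) = sales h i := rfl

theorem decisions_snoc {n t : ℕ} (h : Fin t → Option (Fin n)) (a o : Option (Fin n)) :
    decisions (Fin.snoc (α := fun _ => Option (Fin n)) h a) o =
      decisions h o + if a = o then 1 else 0 := by
  simp only [decisions, Finset.card_filter]
  rw [Fin.sum_univ_castSucc]
  simp

theorem sum_decisions {n t : ℕ} (h : Fin t → Option (Fin n)) : ∑ o, decisions h o = t := by
  have := Finset.card_eq_sum_card_fiberwise (f := h) (s := Finset.univ) (t := Finset.univ)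
    fun _ _ => Finset.mem_coe.2 (Finset.mem_univ _)
  rw [Finset.card_univ, Fintype.card_fin] at this
  exact this.symm

namespace Instance

variable {n : ℕ} (I : Instance n)

theorem choice_toReal (S : Finset (Fin n)) (o : Option (Fin n)) :
    (I.choice S o).toReal = I.choiceProb S o := by
  rw [choice, PMF.ofFintype_apply, ENNReal.toReal_ofReal (I.choiceProb_nonneg S o)]

theorem pmfMean_choice (S : Finset (Fin n)) (F : Option (Fin n) → ℝ) :
    pmfMean (I.choice S) F = ∑ o, I.choiceProb S o * F o := by
  simp only [pmfMean, choice_toReal]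

theorem pmfMean_historyLaw_succ (π : Policy n) (t : ℕ) (F : (Fin (t + 1) → Option (Fin n)) → ℝ) :
    pmfMean (I.historyLaw π (t + 1)) F = pmfMean (I.historyLaw π t) fun h =>
      pmfMean (π t h) fun S => ∑ o, I.choiceProb S o *
        F (Fin.snoc (α := fun _ => Option (Fin n)) h o) := by
  simp only [historyLaw, pmfMean_bind, pmfMean_map, pmfMean_choice]

theorem meanSales_eq (π : Policy n) (i : Fin n) :
    I.meanSales π i = pmfMean (I.historyLaw π I.T) fun h => (sales h i : ℝ) := rfl

theorem meanSales_nonneg (π : Policy n) (i : Fin n) : 0 ≤ I.meanSales π i :=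
  Finset.sum_nonneg fun _ _ => mul_nonneg ENNReal.toReal_nonneg (Nat.cast_nonneg _)

theorem revenue_nonneg (π : Policy n) : 0 ≤ I.revenue π :=
  Finset.sum_nonneg fun i _ => mul_nonneg (I.r_pos i).le (I.meanSales_nonneg π i)

/-! ### The fluid upper bound -/

theorem mean_decisions_succ (π : Policy n) (t : ℕ) (o : Option (Fin n)) :
    pmfMean (I.historyLaw π (t + 1)) (fun h => (decisions h o : ℝ)) =
      pmfMean (I.historyLaw π t) (fun h => (decisions h o : ℝ)) +
      pmfMean (I.historyLaw π t) fun h => pmfMean (π t h) fun S => I.choiceProb S o := by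
  rw [pmfMean_historyLaw_succ, ← pmfMean_add]
  congr 1
  funext h
  rw [← pmfMean_const (π t h) (decisions h o : ℝ), ← pmfMean_add]
  congr 1
  funext S
  simp only [decisions_snoc]
  push_cast
  simp only [mul_add, Finset.sum_add_distrib, ← Finset.sum_mul, I.sum_choiceProb, one_mul]
  simp

theorem choiceProb_some_le (S : Finset (Fin n)) (i : Fin n) :
    I.choiceProb S (some i) ≤ I.v i * I.choiceProb S none := by
  simp only [choiceProb]
  split_ifs
  · rw [mul_one_div]
  · exact mul_nonneg (I.v_pos i).le (one_div_pos.2 (I.denom_pos S)).le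

theorem mean_decisions_some_le (π : Policy n) (t : ℕ) (i : Fin n) :
    pmfMean (I.historyLaw π t) (fun h => (decisions h (some i) : ℝ)) ≤
      I.v i * pmfMean (I.historyLaw π t) fun h => (decisions h none : ℝ) := by
  induction t with
  | zero => simp [decisions, pmfMean]
  | succ t ih =>
    rw [mean_decisions_succ, mean_decisions_succ, mul_add]
    refine add_le_add ih ?_
    rw [← pmfMean_mul_left]
    refine pmfMean_mono _ fun h _ => ?_
    rw [← pmfMean_mul_left]
    exact pmfMean_mono _ fun S _ => I.choiceProb_some_le S i

variable {I} in
/-- Mean sales per period of a feasible policy are feasible for the Upper-Bound problem. -/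
theorem Feasible.exists_ubFeasible {π : Policy n} (hπ : I.Feasible π) :
    ∃ y0 y, I.UBFeasible y0 y ∧ I.ubValue y = I.revenue π := by
  have hT : (0 : ℝ) < I.T := Nat.cast_pos.2 I.T_pos
  set m0 := pmfMean (I.historyLaw π I.T) fun h => (decisions h none : ℝ) with hm0
  refine ⟨m0 / I.T, fun i => I.meanSales π i / I.T, ⟨?_, fun i => ?_, fun i => ?_, fun i => ?_,
    fun i => ?_⟩, ?_⟩
  · have : m0 + ∑ i, I.meanSales π i = I.T := by
      have h1 : pmfMean (I.historyLaw π I.T) (fun h => ∑ o, (decisions h o : ℝ)) = I.T := by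
        rw [← pmfMean_const (I.historyLaw π I.T) (I.T : ℝ)]
        congr 1
        funext h
        exact_mod_cast sum_decisions h
      rw [← h1]
      simp only [Fintype.sum_option, pmfMean_add]
      congr 1
      simp only [meanSales, pmfMean, Finset.mul_sum]
      exact Finset.sum_comm
    rw [← Finset.sum_div, ← add_div, this, div_self hT.ne']
  · exact div_nonneg (I.meanSales_nonneg π i) hT.le
  · rw [← mul_div_assoc]
    exact div_le_div_of_nonneg_right (I.mean_decisions_some_le π I.T i) hT.le
  · refine div_le_div_of_nonneg_right ?_ hT.le
    rw [meanSales_eq, ← pmfMean_const (I.historyLaw π I.T) (I.c i : ℝ)]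
    refine pmfMean_mono _ fun h hh => ?_
    exact_mod_cast ((PMF.toOuterMeasure_apply_eq_one_iff _ _).1 (hπ.inventory i)) hh
  · refine (hπ.balance i).imp (fun h => by rw [h, zero_div]) fun h j => ?_
    rw [← mul_div_assoc]
    exact div_le_div_of_nonneg_right (h j) hT.le
  · simp only [ubValue, revenue, Finset.mul_sum]
    exact Finset.sum_congr rfl fun i _ => by field_simp

/-! ### Policies with prescribed purchase probabilities -/

variable {I} {π : Policy n} {xh : Fin n → ℝ}

theorem Implements.pmfMean_choiceProb (hπ : I.Implements xh π) {t : ℕ} (ht : t < I.T)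
    (h : Fin t → Option (Fin n)) (i : Fin n) :
    pmfMean (π t h) (fun S => I.choiceProb S (some i)) = I.purchaseProb xh (sales h) i :=
  hπ t ht h i

/-- The sales of each product form a binomial variable that is stopped at the inventory. -/
theorem Implements.mean_sales (hπ : I.Implements xh π) (i : Fin n) {t : ℕ} (ht : t ≤ I.T)
    (f : ℕ → ℝ) : pmfMean (I.historyLaw π t) (fun h => f (sales h i)) =
      binomialMean t (xh i) fun k => f (min k (I.c i)) := by
  induction t generalizing f with
  | zero => simp [historyLaw, pmfMean_pure, binomialMean_zero, sales]
  | succ t ih =>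
    have hstep : ∀ (h : Fin t → Option (Fin n)) (S : Finset (Fin n)),
        ∑ o, I.choiceProb S o * f (sales (Fin.snoc (α := fun _ => Option (Fin n)) h o) i) =
          f (sales h i) + (f (sales h i + 1) - f (sales h i)) * I.choiceProb S (some i) := by
      intro h S
      have e : ∀ o, I.choiceProb S o * f (sales (Fin.snoc (α := fun _ => Option (Fin n)) h o) i) =
          I.choiceProb S o * f (sales h i) + if o = some i then
            (f (sales h i + 1) - f (sales h i)) * I.choiceProb S (some i) else 0 := by
        intro o
        rw [← decisions_some, decisions_snoc, decisions_some]
        split_ifs with ho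
        · rw [ho]
          ring
        · rw [add_zero, add_zero]
      simp only [e, Finset.sum_add_distrib, ← Finset.sum_mul, I.sum_choiceProb, one_mul,
        Finset.sum_ite_eq', Finset.mem_univ, if_true]
    rw [pmfMean_historyLaw_succ, binomialMean_succ]
    simp only [hstep, pmfMean_add, pmfMean_const, pmfMean_mul_left]
    simp only [hπ.pmfMean_choiceProb ht, purchaseProb]
    rw [← pmfMean_add, ih (Nat.le_of_succ_le ht) fun s => f s + (f (s + 1) - f s) *
      if s < I.c i then xh i else 0]
    congr 1
    funext k
    rcases lt_or_ge k (I.c i) with hk | hk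
    · rw [min_eq_left hk.le, min_eq_left (Nat.succ_le_of_lt hk), if_pos hk]
      ring
    · rw [min_eq_right hk, min_eq_right (hk.trans k.le_succ), if_neg (lt_irrefl _)]
      ring

theorem Implements.meanSales_eq_G (hπ : I.Implements xh π) (i : Fin n) :
    I.meanSales π i = I.G i (xh i) :=
  hπ.mean_sales i le_rfl fun k => (k : ℝ)

theorem Implements.sales_le (hπ : I.Implements xh π) {t : ℕ} (ht : t ≤ I.T)
    (h : Fin t → Option (Fin n)) (hh : h ∈ (I.historyLaw π t).support) (i : Fin n) :
    sales h i ≤ I.c i := by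
  induction t with
  | zero => simp [sales]
  | succ t ih =>
    simp only [historyLaw, PMF.mem_support_bind_iff, PMF.mem_support_map_iff] at hh
    obtain ⟨h, hh, S, hS, o, ho, rfl⟩ := hh
    have hle := ih (Nat.le_of_succ_le ht) h hh
    rw [← decisions_some, decisions_snoc, decisions_some]
    split_ifs with hoi
    swap
    · exact hle
    refine Nat.succ_le_of_lt (lt_of_le_of_ne hle fun heq => ?_)
    have h0 := hπ t ht h i
    rw [purchaseProb, if_neg heq.not_lt, Finset.sum_eq_zero_iff_of_nonneg fun S _ =>
      mul_nonneg ENNReal.toReal_nonneg (I.choiceProb_nonneg S _)] at h0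
    rw [PMF.mem_support_iff] at hS ho
    rcases mul_eq_zero.1 (h0 S (Finset.mem_univ _)) with h0 | h0
    · exact (ENNReal.toReal_ne_zero.2 ⟨hS, (π t h).apply_ne_top S⟩) h0
    · rw [← hoi, ← choice_toReal] at h0
      exact (ENNReal.toReal_ne_zero.2 ⟨ho, (I.choice S).apply_ne_top o⟩) h0

theorem exists_implements (hx : ∀ sold, I.Attainable (I.purchaseProb xh sold)) :
    ∃ π : Policy n, I.Implements xh π := by
  have key : ∀ sold : Fin n → ℕ, ∃ q : PMF (Finset (Fin n)), ∀ i,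
      ∑ S, (q S).toReal * I.choiceProb S (some i) = I.purchaseProb xh sold i := by
    intro sold
    set p := I.purchaseProb xh sold with hp
    have hA : I.Attainable p := hx sold
    have hsum : ∑ k : Fin (n + 1), ENNReal.ofReal (I.nestedWeight p k) = 1 := by
      rw [← Finset.sum_range fun k => ENNReal.ofReal (I.nestedWeight p k),
        ← ENNReal.ofReal_sum_of_nonneg fun k _ => hA.nestedWeight_nonneg k, hA.sum_nestedWeight,
        ENNReal.ofReal_one]
    refine ⟨(PMF.ofFintype _ hsum).map fun k : Fin (n + 1) => I.nested p k, fun i => ?_⟩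
    refine (pmfMean_map _ _ fun S => I.choiceProb S (some i)).trans ?_
    rw [← hA.sum_nestedWeight_mul i, Finset.sum_range]
    refine Finset.sum_congr rfl fun k _ => ?_
    rw [PMF.ofFintype_apply, ENNReal.toReal_ofReal (hA.nestedWeight_nonneg k)]
  choose q hq using key
  exact ⟨fun t h => q (sales h), fun t _ h i => hq (sales h) i⟩

/-! ### Every output of the algorithm gives a near-optimal policy -/

theorem UBFeasible.le_one {x0 : ℝ} {x : Fin n → ℝ} (hx : I.UBFeasible x0 x) (i : Fin n) :
    x i ≤ 1 := by
  have h1 : x i ≤ ∑ j, x j := Finset.single_le_sum (fun j _ => hx.nonneg j) (Finset.mem_univ i)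
  have h2 := hx.total
  by_contra h
  have h3 : x0 < 0 := by linarith
  have := mul_neg_of_pos_of_neg (I.v_pos i) h3
  have := hx.mnl i
  linarith

theorem UBFeasible.mul_le {x0 : ℝ} {x : Fin n → ℝ} (hx : I.UBFeasible x0 x) (i : Fin n) :
    I.T * x i ≤ I.c i := by
  have hT : (0 : ℝ) < I.T := Nat.cast_pos.2 I.T_pos
  have := hx.inventory i
  rwa [le_div_iff₀ hT, mul_comm] at this

theorem UBFeasible.G_ge {x0 : ℝ} {x : Fin n → ℝ} (hx : I.UBFeasible x0 x) (i : Fin n) :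
    max (1 / 2) (1 - 1 / √(I.c i : ℝ)) * (I.T * x i) ≤ I.G i (x i) :=
  expectedSales_ge _ _ I.T_pos (I.c_pos i) (hx.nonneg i) (hx.le_one i) (hx.mul_le i)

theorem exists_Gmin_eq (I : Instance n) {x : Fin n → ℝ} {i : Fin n} (hi : 0 < x i) :
    ∃ j, 0 < x j ∧ I.Gmin x = I.G j (x j) := by
  have hfin : {g | ∃ i, 0 < x i ∧ g = I.G i (x i)}.Finite :=
    (Set.finite_range fun i => I.G i (x i)).subset fun g ⟨i, _, hg⟩ => ⟨i, hg.symm⟩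
  exact Set.Nonempty.csInf_mem (s := {g | ∃ i, 0 < x i ∧ g = I.G i (x i)}) ⟨_, i, hi, rfl⟩ hfin

theorem Gmin_le (I : Instance n) {x : Fin n → ℝ} {i : Fin n} (hi : 0 < x i) :
    I.Gmin x ≤ I.G i (x i) := by
  have hfin : {g | ∃ i, 0 < x i ∧ g = I.G i (x i)}.Finite :=
    (Set.finite_range fun i => I.G i (x i)).subset fun g ⟨i, _, hg⟩ => ⟨i, hg.symm⟩
  exact csInf_le hfin.bddBelow ⟨i, hi, rfl⟩

/-- The balance of the fluid solution bounds the target of the search from below. -/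
theorem UBFeasible.mul_le_Gmin_div {x0 : ℝ} {x : Fin n → ℝ} (hx : I.UBFeasible x0 x) {ρ : ℝ}
    (hρ : 0 ≤ ρ) (hG : ∀ i, ρ * (I.T * x i) ≤ I.G i (x i)) {i : Fin n} (hi : 0 < x i) :
    ρ * (I.T * x i) ≤ I.Gmin x / I.α := by
  obtain ⟨j, hj, e⟩ := I.exists_Gmin_eq hi
  rw [e, le_div_iff₀ I.α_pos]
  refine le_trans ?_ (hG j)
  have h1 := ((hx.balance j).resolve_left hj.ne') i
  calc _ = ρ * (I.T * (I.α * x i)) := by ring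
    _ ≤ _ := by gcongr

variable {ε₁ ε₂ x0 : ℝ} {xt : Fin n → ℝ}

theorem IsOutput.mem_Icc (h : I.IsOutput ε₁ ε₂ x0 xt xh) (i : Fin n) :
    0 ≤ xh i ∧ xh i ≤ xt i := by
  rcases (h.approx.1.nonneg i).eq_or_lt with h0 | h0
  · rw [h.zero i h0.symm, ← h0]
    exact ⟨le_rfl, le_rfl⟩
  · rcases le_or_gt (I.G i (xt i)) (I.Gmin xt / I.α) with hk | hk
    · rw [h.keep i h0 hk]
      exact ⟨h0.le, le_rfl⟩
    · exact (h.search i h0 hk).1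

theorem IsOutput.attainable (h : I.IsOutput ε₁ ε₂ x0 xt xh) (sold : Fin n → ℕ) :
    I.Attainable (I.purchaseProb xh sold) := by
  have hle : ∀ i, 0 ≤ I.purchaseProb xh sold i ∧ I.purchaseProb xh sold i ≤ xt i := by
    intro i
    rw [purchaseProb]
    split_ifs
    · exact h.mem_Icc i
    · exact ⟨le_rfl, h.approx.1.nonneg i⟩
  refine fun i => ⟨(hle i).1, (hle i).2.trans ((h.approx.1.mnl i).trans ?_)⟩
  refine mul_le_mul_of_nonneg_left ?_ (I.v_pos i).le
  have := Finset.sum_le_sum fun i (_ : i ∈ Finset.univ) => (hle i).2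
  have := h.approx.1.total
  linarith

theorem IsOutput.feasible (h : I.IsOutput ε₁ ε₂ x0 xt xh) (hε : ε₂ ≤ 1 - I.α)
    (hπ : I.Implements xh π) : I.Feasible π := by
  have hmean := hπ.meanSales_eq_G
  have hG0 : ∀ i, 0 ≤ I.G i (xt i) := fun i =>
    expectedSales_nonneg _ _ (h.approx.1.nonneg i) (h.approx.1.le_one i)
  have hmin : ∀ i, 0 < xt i → 0 ≤ I.Gmin xt := fun i hi => by
    obtain ⟨j, -, e⟩ := I.exists_Gmin_eq hi
    exact e ▸ hG0 j
  have hzero : ∀ i, xt i = 0 → I.meanSales π i = 0 := fun i hi => by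
    rw [hmean, h.zero i hi]
    exact expectedSales_zero _ _
  -- All positive mean sales lie between `Gmin` and `Gmin / α`.
  have hup : ∀ i, 0 < xt i → I.meanSales π i ≤ I.Gmin xt / I.α := fun i hi => by
    rw [hmean]
    rcases le_or_gt (I.G i (xt i)) (I.Gmin xt / I.α) with hk | hk
    · rwa [h.keep i hi hk]
    · exact (h.search i hi hk).2.2
  have hlow : ∀ i, 0 < xt i → I.Gmin xt ≤ I.meanSales π i := fun i hi => by
    rw [hmean]
    rcases le_or_gt (I.G i (xt i)) (I.Gmin xt / I.α) with hk | hk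
    · rw [h.keep i hi hk]
      exact I.Gmin_le hi
    · refine le_trans ?_ (h.search i hi hk).2.1
      calc I.Gmin xt = I.α * (I.Gmin xt / I.α) := (mul_div_cancel₀ _ I.α_pos.ne').symm
        _ ≤ _ := mul_le_mul_of_nonneg_right (by linarith) (div_nonneg (hmin i hi) I.α_pos.le)
  refine ⟨fun i => (PMF.toOuterMeasure_apply_eq_one_iff _ _).2 fun g hg =>
    hπ.sales_le le_rfl g hg i, fun i => ?_⟩
  rcases (h.approx.1.nonneg i).eq_or_lt with hi | hi
  · exact .inl (hzero i hi.symm)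
  · refine .inr fun j => ?_
    rcases (h.approx.1.nonneg j).eq_or_lt with hj | hj
    · rw [hzero j hj.symm, mul_zero]
      exact I.meanSales_nonneg π i
    · refine le_trans ?_ (hlow i hi)
      have := hup j hj
      rwa [le_div_iff₀ I.α_pos, mul_comm] at this

/-- The loss factors of the fluid relaxation, the approximation and the search multiply. -/
theorem IsOutput.revenue_ge (h : I.IsOutput ε₁ ε₂ x0 xt xh) (h0 : 0 ≤ ε₂) (h1 : ε₂ ≤ 1) {ρ : ℝ}
    (hρ : 0 ≤ ρ) (hG : ∀ i, ρ * (I.T * xt i) ≤ I.G i (xt i)) (hπ : I.Implements xh π) :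
    (1 - ε₂) * ρ * I.ubValue xt ≤ I.revenue π := by
  simp only [ubValue, revenue, Finset.mul_sum]
  refine Finset.sum_le_sum fun i _ => ?_
  rw [hπ.meanSales_eq_G]
  suffices (1 - ε₂) * (ρ * (I.T * xt i)) ≤ I.G i (xh i) by
    calc _ = I.r i * ((1 - ε₂) * (ρ * (I.T * xt i))) := by ring
      _ ≤ _ := mul_le_mul_of_nonneg_left this (I.r_pos i).le
  rcases (h.approx.1.nonneg i).eq_or_lt with hi | hi
  · rw [h.zero i hi.symm, ← hi]
    exact (by simp : (1 - ε₂) * (ρ * (I.T * 0)) = 0).trans_le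
      (expectedSales_nonneg _ _ le_rfl zero_le_one)
  rcases le_or_gt (I.G i (xt i)) (I.Gmin xt / I.α) with hk | hk
  · rw [h.keep i hi hk]
    refine le_trans (mul_le_of_le_one_left ?_ (by linarith)) (hG i)
    positivity
  · exact (mul_le_mul_of_nonneg_left (h.approx.1.mul_le_Gmin_div hρ hG hi) (by linarith)).trans
      (h.search i hi hk).2.1

theorem IsOutput.isApprox [NeZero n] {ε : ℝ} (hε : 0 < ε) (hα : I.α < 1)
    (h : I.IsOutput (ε / 2) (min (ε / 2) (1 - I.α)) x0 xt xh) (hπ : I.Implements xh π) :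
    I.IsApprox (max (1 / 2 - ε) (1 - 1 / √(I.cmin : ℝ) - ε)) π := by
  refine ⟨h.feasible (min_le_right _ _) hπ, fun π' hπ' => ?_⟩
  obtain ⟨y0, y, hy, hval⟩ := hπ'.exists_ubFeasible
  set ε₂ := min (ε / 2) (1 - I.α) with hε₂
  have h0 : 0 ≤ ε₂ := le_min (by linarith) (by linarith)
  have h1 : ε₂ ≤ 1 := (min_le_right _ _).trans (by linarith [I.α_pos])
  have h2 : ε₂ ≤ ε / 2 := min_le_left _ _
  have hcmin : 0 < I.cmin := (Finset.lt_inf'_iff _).2 fun i _ => I.c_pos i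
  set ρ := max (1 / 2) (1 - 1 / √(I.cmin : ℝ)) with hρ
  have hρ0 : 0 ≤ ρ := le_max_of_le_left (by norm_num)
  have hρ1 : ρ ≤ 1 := max_le (by norm_num) (sub_le_self _ (by positivity))
  have hG : ∀ i, ρ * (I.T * xt i) ≤ I.G i (xt i) := by
    intro i
    refine le_trans (mul_le_mul_of_nonneg_right ?_ ?_) (h.approx.1.G_ge i)
    · have : (I.cmin : ℝ) ≤ I.c i := by exact_mod_cast Finset.inf'_le _ (Finset.mem_univ i)
      have h' : (0 : ℝ) < √(I.cmin : ℝ) := Real.sqrt_pos.2 (by exact_mod_cast hcmin)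
      refine max_le_max le_rfl ?_
      gcongr
    · exact mul_nonneg (Nat.cast_nonneg _) (h.approx.1.nonneg i)
  have hrev := h.revenue_ge h0 h1 hρ0 hG hπ
  have hub := h.approx.2 y0 y hy
  rw [hval] at hub
  refine le_trans ?_ hrev
  have hpos : 0 ≤ (1 - ε₂) * ρ := mul_nonneg (by linarith) hρ0
  refine le_trans ?_ (mul_le_mul_of_nonneg_left hub hpos)
  rw [← mul_assoc]
  refine mul_le_mul_of_nonneg_right ?_ (I.revenue_nonneg π')
  rw [max_sub_sub_right, ← hρ]
  have h3 : 1 - ε ≤ (1 - ε₂) * (1 - ε / 2) := by nlinarith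
  nlinarith [mul_le_mul_of_nonneg_left h3 hρ0, mul_nonneg hε.le (sub_nonneg.2 hρ1)]

end Instance

/-! ### The knapsack recursion -/

/-- Largest total profit of the items `0, …, j - 1` that share at most `w` units, when `q` units
of item `i` have profit `f i q`. -/
def knapsack (f : ℕ → ℕ → ℝ) : ℕ → ℕ → ℝ
  | 0, _ => 0
  | j + 1, w => (Finset.range (w + 1)).sup' Finset.nonempty_range_add_one
      fun q => f j q + knapsack f j (w - q)

theorem knapsack_succ_eq {f : ℕ → ℕ → ℝ} {j w q : ℕ} (hq : q ≤ w)
    (h : ∀ q' ≤ w, f j q' + knapsack f j (w - q') ≤ f j q + knapsack f j (w - q)) :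
    f j q + knapsack f j (w - q) = knapsack f (j + 1) w := by
  rw [knapsack]
  refine le_antisymm ?_ (Finset.sup'_le _ _ fun q' hq' =>
    h q' (by simpa [Nat.lt_succ_iff] using hq'))
  exact Finset.le_sup' (fun q => f j q + knapsack f j (w - q)) (by simpa [Nat.lt_succ_iff] using hq)

theorem sum_le_knapsack (f : ℕ → ℕ → ℝ) (q : ℕ → ℕ) (j w : ℕ)
    (h : ∑ i ∈ Finset.range j, q i ≤ w) :
    ∑ i ∈ Finset.range j, f i (q i) ≤ knapsack f j w := by
  induction j generalizing w with
  | zero => simp [knapsack]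
  | succ j ih =>
    rw [Finset.sum_range_succ] at h ⊢
    have := ih (w - q j) (by omega)
    refine le_trans ?_ (Finset.le_sup' (fun q => f j q + knapsack f j (w - q))
      (b := q j) (by simp; omega))
    linarith

namespace Instance

/-! ### Discretization of the Upper-Bound problem -/

variable {n : ℕ} (I : Instance n)

/-- The largest amount of product `j` when no amount exceeds `U` and the no-purchase probability
is at least `z`. -/
def cap (U z : ℝ) (j : ℕ) : ℝ :=
  min (min U (asArray I.v j * z)) (asArray (fun i => (I.c i : ℝ)) j / I.T)

/-- The amount of product `j` that is bought with the purchase probability `y`, reduced to its cap.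
It is `0` if the balance with the amount `U` would be violated. -/
def amount (U z y : ℝ) (j : ℕ) : ℝ :=
  if I.α * U ≤ min (I.cap U z j) y then min (I.cap U z j) y else 0

/-- The profit of `q` units of product `j` when the unit of probability is `δ` and `k` units are
reserved for no purchase. -/
def unitProfit (δ U : ℝ) (k j q : ℕ) : ℝ := asArray I.r j * I.amount U (k * δ) (q * δ) j

/-- The optimal value of the discretized problem with `N` units of probability. -/
def gridValue (N : ℕ) (δ U : ℝ) (k : ℕ) : ℝ := knapsack (I.unitProfit δ U k) n (N - k)

variable {I}

theorem amount_cases {U z y : ℝ} (hU : 0 ≤ U) (j : ℕ) :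
    I.amount U z y j = 0 ∨ (I.α * U ≤ I.amount U z y j ∧ 0 ≤ I.amount U z y j ∧
      I.amount U z y j ≤ I.cap U z j ∧ I.amount U z y j ≤ y) := by
  rw [amount]
  split_ifs with h
  · exact .inr ⟨h, (mul_nonneg I.α_pos.le hU).trans h, min_le_left _ _, min_le_right _ _⟩
  · exact .inl rfl

theorem amount_nonneg {U z y : ℝ} (hU : 0 ≤ U) (j : ℕ) : 0 ≤ I.amount U z y j := by
  rcases amount_cases (I := I) (z := z) (y := y) hU j with h | h
  · exact h.ge
  · exact h.2.1

theorem amount_zero {U z : ℝ} (hU : 0 < U) (j : ℕ) : I.amount U z 0 j = 0 := by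
  rw [amount, if_neg]
  exact not_le.2 ((min_le_right _ _).trans_lt (mul_pos I.α_pos hU))

/-- Every solution of the discretized problem is feasible for the Upper-Bound problem. -/
theorem ubFeasible_amount {N k : ℕ} {δ U : ℝ} (hδ : 0 ≤ δ) (hN : N * δ = 1) (hk : k ≤ N)
    (hU : 0 ≤ U) (q : ℕ → ℕ) (hq : ∑ i ∈ Finset.range n, q i ≤ N - k) (x : Fin n → ℝ)
    (hx : ∀ i : Fin n, x i = I.amount U (k * δ) (q i * δ) i) :
    I.UBFeasible (1 - ∑ i, x i) x := by
  have hz : 0 ≤ (k : ℝ) * δ := by positivity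
  have hle : ∀ i, x i ≤ q i * δ := fun i => by
    rw [hx]
    rcases amount_cases (I := I) (z := k * δ) (y := q i * δ) hU i with h | h
    · rw [h]
      positivity
    · exact h.2.2.2
  have hx0 : k * δ ≤ 1 - ∑ i, x i := by
    have h1 := Finset.sum_le_sum fun i (_ : i ∈ Finset.univ) => hle i
    rw [← Finset.sum_mul, ← Nat.cast_sum, ← Finset.sum_range q] at h1
    have h2 : ((∑ i ∈ Finset.range n, q i : ℕ) : ℝ) + k ≤ N := by exact_mod_cast (by omega)
    have h3 := mul_le_mul_of_nonneg_right h2 hδ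
    linarith
  have hcap : ∀ i : Fin n, I.cap U (k * δ) i =
      min (min U (I.v i * (k * δ))) (I.c i / I.T) := fun i => by simp only [cap, asArray_fin]
  refine ⟨by ring, fun i => hx i ▸ amount_nonneg hU _, fun i => ?_, fun i => ?_, fun i => ?_⟩
  · have hv := mul_le_mul_of_nonneg_left hx0 (I.v_pos i).le
    rcases amount_cases (I := I) (z := k * δ) (y := q i * δ) hU i with h | h
    · rw [hx, h]
      exact (mul_nonneg (I.v_pos i).le hz).trans hv
    · rw [hx]
      exact (h.2.2.1.trans ((hcap i).trans_le (min_le_left _ _))).trans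
        ((min_le_right _ _).trans hv)
  · rw [hx]
    rcases amount_cases (I := I) (z := k * δ) (y := q i * δ) hU i with h | h
    · rw [h]
      positivity
    · exact h.2.2.1.trans ((hcap i).trans_le (min_le_right _ _))
  · rcases amount_cases (I := I) (z := k * δ) (y := q i * δ) hU i with h | h
    · exact .inl ((hx i).trans h)
    · refine .inr fun j => le_trans (mul_le_mul_of_nonneg_left ?_ I.α_pos.le) ((hx i).symm ▸ h.1)
      rw [hx]
      rcases amount_cases (I := I) (z := k * δ) (y := q j * δ) hU j with h | h
      · rw [h]
        exact hU
      · exact h.2.2.1.trans ((hcap j).trans_le ((min_le_left _ _).trans (min_le_left _ _)))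

theorem UBFeasible.nonneg_zero [NeZero n] {y0 : ℝ} {y : Fin n → ℝ} (hy : I.UBFeasible y0 y) :
    0 ≤ y0 := by
  by_contra h
  have h1 := hy.mnl 0
  have h2 := hy.nonneg 0
  have := mul_neg_of_pos_of_neg (I.v_pos 0) (not_le.1 h)
  linarith

/-- A scaled solution leaves the slack that is needed to round all amounts up to whole units. -/
theorem UBFeasible.exists_gridValue_ge [NeZero n] {y0 : ℝ} {y : Fin n → ℝ}
    (hy : I.UBFeasible y0 y) {K : ℕ} (hK : 0 < K) {lam U : ℝ} (h0 : 0 < lam)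
    (h1 : lam ≤ 1 - 2 / K) (hU : 0 ≤ U) (hle : ∀ i, lam * y i ≤ U)
    (hbal : ∀ i, y i = 0 ∨ I.α * U ≤ lam * y i) :
    ∃ k ≤ n * K, lam * ∑ i, I.r i * y i ≤ I.gridValue (n * K) (1 / (n * K)) U k := by
  have hn : 0 < n := NeZero.pos n
  have hn' : (0 : ℝ) < n := Nat.cast_pos.2 hn
  have hK' : (0 : ℝ) < K := Nat.cast_pos.2 hK
  have hN : (0 : ℝ) < n * K := mul_pos hn' hK'
  set N : ℝ := n * K with hNdef
  have hy0 := hy.nonneg_zero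
  have hlam1 : lam ≤ 1 := h1.trans (sub_le_self _ (by positivity))
  set k := ⌈lam * y0 * N⌉₊ with hk
  set q : Fin n → ℕ := fun i => ⌈lam * y i * N⌉₊ with hq
  have hkN : lam * y0 ≤ k * (1 / N) := by
    rw [mul_one_div, le_div_iff₀ hN]
    exact Nat.le_ceil _
  have hqN : ∀ i, lam * y i ≤ q i * (1 / N) := fun i => by
    rw [mul_one_div, le_div_iff₀ hN]
    exact Nat.le_ceil _
  have hsum : k + ∑ i, q i ≤ n * K := by
    have e1 : (k : ℝ) ≤ lam * y0 * N + 1 := (Nat.ceil_lt_add_one (by positivity)).le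
    have e2 : ∀ i ∈ Finset.univ, (q i : ℝ) ≤ lam * y i * N + 1 := fun i _ =>
      (Nat.ceil_lt_add_one (mul_nonneg (mul_nonneg h0.le (hy.nonneg i)) hN.le)).le
    have e3 := Finset.sum_le_sum e2
    rw [Finset.sum_add_distrib, ← Finset.sum_mul, ← Finset.mul_sum] at e3
    simp only [Finset.sum_const, Finset.card_univ, Fintype.card_fin, nsmul_eq_mul, mul_one] at e3
    have e4 : lam * N ≤ N - 2 * n := by
      have := mul_le_mul_of_nonneg_right h1 hN.le
      refine this.trans_eq ?_
      rw [hNdef]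
      field_simp
    have e5 : (1 : ℝ) ≤ n := by exact_mod_cast hn
    have e6 : lam * y0 * N + lam * (∑ i, y i) * N = lam * N := by
      calc _ = lam * N * (y0 + ∑ i, y i) := by ring
        _ = _ := by rw [hy.total, mul_one]
    have : ((k + ∑ i, q i : ℕ) : ℝ) ≤ ((n * K : ℕ) : ℝ) := by
      push_cast
      rw [← hNdef]
      linarith
    exact_mod_cast this
  refine ⟨k, by omega, ?_⟩
  have hpt : ∀ i : Fin n, lam * y i ≤ I.amount U (k * (1 / N)) (q i * (1 / N)) i := by
    intro i
    rcases hbal i with h | h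
    · rw [h, mul_zero]
      exact amount_nonneg hU _
    · have hmin : lam * y i ≤ min (I.cap U (k * (1 / N)) i) (q i * (1 / N)) := by
        rw [cap, asArray_fin, asArray_fin]
        refine le_min (le_min (le_min (hle i) ?_) ?_) (hqN i)
        · refine le_trans ?_ (mul_le_mul_of_nonneg_left hkN (I.v_pos i).le)
          calc lam * y i ≤ lam * (I.v i * y0) := mul_le_mul_of_nonneg_left (hy.mnl i) h0.le
            _ = _ := by ring
        · exact (mul_le_of_le_one_left (hy.nonneg i) hlam1).trans (hy.inventory i)
      rw [amount, if_pos (h.trans hmin)]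
      exact hmin
  set q' : ℕ → ℕ := fun i => if h : i < n then q ⟨i, h⟩ else 0 with hq'
  have hq'i : ∀ i : Fin n, q' i = q i := fun i => by simp [hq']
  have hsum' : ∑ i ∈ Finset.range n, q' i ≤ n * K - k := by
    rw [Finset.sum_range, Finset.sum_congr rfl fun i _ => hq'i i]
    exact Nat.le_sub_of_add_le (by rw [add_comm]; exact hsum)
  refine le_trans ?_ (sum_le_knapsack _ q' n _ hsum')
  rw [Finset.sum_range, Finset.mul_sum]
  refine Finset.sum_le_sum fun i _ => ?_
  rw [unitProfit, asArray_fin, hq'i]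
  calc _ = I.r i * (lam * y i) := by ring
    _ ≤ _ := mul_le_mul_of_nonneg_left (hpt i) (I.r_pos i).le

/-- The least of `1 / T` and of `v i / (1 + n * v i)` for the first `j` products. If all amounts
are equal to `b = amountBound n`, then the no-purchase probability is at least `1 - n * b`, so that
`b ≤ v i * (1 - n * b)` and `b ≤ c i / T`; hence a solution whose largest amount is less than `b`
can be scaled up. -/
def amountBound (I : Instance n) : ℕ → ℝ
  | 0 => 1 / I.T
  | j + 1 => min (amountBound I j) (asArray I.v j / (1 + n * asArray I.v j))

theorem amountBound_pos (j : ℕ) (hj : j ≤ n) : 0 < I.amountBound j := by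
  induction j with
  | zero => exact one_div_pos.2 (Nat.cast_pos.2 I.T_pos)
  | succ j ih =>
    have := I.v_pos ⟨j, hj⟩
    refine lt_min (ih (by omega)) ?_
    rw [asArray_lt _ hj]
    positivity

theorem amountBound_le_inv (j : ℕ) : I.amountBound j ≤ 1 / I.T := by
  induction j with
  | zero => exact le_rfl
  | succ j ih => exact (min_le_left _ _).trans ih

theorem amountBound_le {i j : ℕ} (hij : i < j) :
    I.amountBound j ≤ asArray I.v i / (1 + n * asArray I.v i) := by
  induction j with
  | zero => omega
  | succ j ih =>
    rcases Nat.lt_succ_iff_lt_or_eq.1 hij with h | rfl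
    · exact (min_le_left _ _).trans (ih h)
    · exact min_le_right _ _

theorem amountBound_ge (j : ℕ) (hj : j ≤ n) {b : ℝ} (hT : b ≤ 1 / I.T)
    (hb : ∀ i : Fin n, b ≤ I.v i / (1 + n * I.v i)) : b ≤ I.amountBound j := by
  induction j with
  | zero => exact hT
  | succ j ih =>
    refine le_min (ih (by omega)) ?_
    rw [asArray_lt _ hj]
    exact hb _

/-- Scaling up a nonzero solution until its largest amount is at least `amountBound`. -/
theorem UBFeasible.exists_scaled {y0 : ℝ} {y : Fin n → ℝ} (hy : I.UBFeasible y0 y)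
    {i : Fin n} (hi : 0 < y i) (hmax : ∀ j, y j ≤ y i) :
    ∃ y0' y', I.UBFeasible y0' y' ∧ (∀ j, y' j ≤ y' i) ∧ I.amountBound n ≤ y' i ∧
      ∑ j, I.r j * y j ≤ ∑ j, I.r j * y' j := by
  set b := I.amountBound n with hb
  have hb0 : 0 < b := amountBound_pos n le_rfl
  rcases le_or_gt b (y i) with h | h
  · exact ⟨y0, y, hy, hmax, h, le_rfl⟩
  set lam := b / y i with hlam
  have h1 : 1 < lam := (one_lt_div hi).2 h
  have h0 : 0 < lam := one_pos.trans h1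
  have hlami : lam * y i = b := div_mul_cancel₀ _ hi.ne'
  have hle : ∀ j, lam * y j ≤ b := fun j => hlami ▸ mul_le_mul_of_nonneg_left (hmax j) h0.le
  have hsum : ∑ j, lam * y j ≤ n * b := by
    refine (Finset.sum_le_sum fun j (_ : j ∈ Finset.univ) => hle j).trans ?_
    simp
  refine ⟨1 - ∑ j, lam * y j, fun j => lam * y j, ⟨by ring, fun j => ?_, fun j => ?_, fun j => ?_,
    fun j => ?_⟩, fun j => mul_le_mul_of_nonneg_left (hmax j) h0.le, hlami.ge, ?_⟩
  · exact mul_nonneg h0.le (hy.nonneg j)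
  · refine (hle j).trans ?_
    have hv := I.v_pos j
    have hbj := amountBound_le (I := I) j.2
    rw [asArray_fin, ← hb, le_div_iff₀ (by positivity)] at hbj
    nlinarith [mul_le_mul_of_nonneg_left hsum hv.le]
  · refine (hle j).trans ((amountBound_le_inv n).trans ?_)
    have : (1 : ℝ) ≤ I.c j := by exact_mod_cast I.c_pos j
    gcongr
  · refine (hy.balance j).imp (fun h => by rw [h, mul_zero]) fun h k => ?_
    calc I.α * (lam * y k) = lam * (I.α * y k) := by ring
      _ ≤ _ := mul_le_mul_of_nonneg_left (h k) h0.le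
  · refine Finset.sum_le_sum fun j _ => mul_le_mul_of_nonneg_left ?_ (I.r_pos j).le
    exact le_mul_of_one_le_left (hy.nonneg j) h1.le

/-- The geometric grid of candidates for the largest amount. -/
def gridPoint (I : Instance n) (K a : ℕ) : ℝ := I.amountBound n / 2 * (1 + 1 / K) ^ a

theorem gridPoint_pos (K a : ℕ) : 0 < I.gridPoint K a :=
  mul_pos (half_pos (amountBound_pos n le_rfl)) (by positivity)

/-- The best grid solution is nearly optimal. -/
theorem UBFeasible.exists_grid_ge [NeZero n] {y0 : ℝ} {y : Fin n → ℝ} (hy : I.UBFeasible y0 y)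
    {i : Fin n} (hi : 0 < y i) {K L : ℕ} (hK : 4 ≤ K) (hL : 1 < I.gridPoint K L) :
    ∃ a < L, ∃ k ≤ n * K,
      (1 - 3 / K) * ∑ j, I.r j * y j ≤ I.gridValue (n * K) (1 / (n * K)) (I.gridPoint K a) k := by
  obtain ⟨i, -, hmax⟩ := Finset.exists_max_image Finset.univ y ⟨i, Finset.mem_univ i⟩
  replace hi := hi.trans_le (hmax _ (Finset.mem_univ _))
  obtain ⟨y0', y', hy', hmax', hbound, hval⟩ :=
    hy.exists_scaled hi fun j => hmax j (Finset.mem_univ j)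
  have hM : 0 < y' i := (amountBound_pos n le_rfl).trans_le hbound
  have hK4 : (4 : ℝ) ≤ K := by exact_mod_cast hK
  have hK0 : (0 : ℝ) < K := by linarith
  have hhalf : 2 / (K : ℝ) ≤ 1 / 2 := by
    rw [div_le_div_iff₀ hK0 two_pos]
    linarith
  -- The largest grid point below the amount that leaves the slack `2 / K`.
  set M := y' i * (1 - 2 / K) with hMdef
  have hex : ∃ a, M < I.gridPoint K a := ⟨L, lt_of_le_of_lt
    ((mul_le_of_le_one_right hM.le (sub_le_self _ (by positivity))).trans (hy'.le_one i)) hL⟩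
  classical
  obtain ⟨a, ha⟩ : ∃ a, Nat.find hex = a + 1 := by
    refine Nat.exists_eq_succ_of_ne_zero fun h0 => ?_
    have := Nat.find_spec hex
    rw [h0, gridPoint, pow_zero, mul_one] at this
    nlinarith
  have hlt : M < I.gridPoint K (a + 1) := ha ▸ Nat.find_spec hex
  have hge : I.gridPoint K a ≤ M := not_lt.1 (Nat.find_min hex (by omega))
  have haL : a < L := by
    have : Nat.find hex ≤ L := Nat.find_min' hex <| lt_of_le_of_lt
      ((mul_le_of_le_one_right hM.le (sub_le_self _ (by positivity))).trans (hy'.le_one i)) hL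
    omega
  set U := I.gridPoint K a with hU
  have hU0 : 0 < U := gridPoint_pos K a
  have hstep : I.gridPoint K (a + 1) = U * (1 + 1 / K) := by
    rw [hU, gridPoint, gridPoint, pow_succ, mul_assoc]
  set lam := U / y' i with hlam
  have hlam0 : 0 < lam := div_pos hU0 hM
  have hlami : lam * y' i = U := div_mul_cancel₀ _ hM.ne'
  obtain ⟨k, hk, hgrid⟩ := hy'.exists_gridValue_ge (K := K) (by omega) hlam0
    (by rw [hlam, div_le_iff₀ hM, mul_comm]; exact hge) hU0.le
    (fun j => hlami ▸ mul_le_mul_of_nonneg_left (hmax' j) hlam0.le)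
    (fun j => (hy'.balance j).imp id fun h => by
      calc I.α * U = lam * (I.α * y' i) := by rw [← hlami]; ring
        _ ≤ _ := mul_le_mul_of_nonneg_left (h i) hlam0.le)
  refine ⟨a, haL, k, hk, le_trans ?_ hgrid⟩
  have hlamge : 1 - 3 / (K : ℝ) ≤ lam := by
    rw [hlam, le_div_iff₀ hM]
    rw [hstep, hMdef] at hlt
    have e : (1 - 3 / (K : ℝ)) * (1 + 1 / K) ≤ 1 - 2 / K := by
      have : (1 - 3 / (K : ℝ)) * (1 + 1 / K) = 1 - 2 / K - 3 / K ^ 2 := by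
        field_simp
        ring
      rw [this]
      exact sub_le_self _ (by positivity)
    have hpos : (0 : ℝ) < 1 + 1 / K := by positivity
    refine le_of_mul_le_mul_right ?_ hpos
    nlinarith [mul_le_mul_of_nonneg_left e hM.le]
  have hnonneg : 0 ≤ ∑ j, I.r j * y j :=
    Finset.sum_nonneg fun j _ => mul_nonneg (I.r_pos j).le (hy.nonneg j)
  exact (mul_le_mul_of_nonneg_right hlamge hnonneg).trans
    (mul_le_mul_of_nonneg_left hval hlam0.le)

end Instance

/-! ### The dynamic program -/

/-- The registers and arrays that stay constant during the search: the input, the number `N` of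
units, and the unit `δ`. -/
structure Env {n : ℕ} (I : Instance n) (N : ℕ) (δ : ℝ) (s : State) : Prop where
  N0 : s.N 0 = n
  N1 : s.N 1 = 1
  N3 : s.N 3 = N
  N4 : s.N 4 = N + 1
  N15 : s.N 15 = 0
  R0 : s.R 0 = I.T
  R1 : s.R 1 = I.α
  R3 : s.R 3 = 1
  R9 : s.R 9 = 0
  R12 : s.R 12 = δ
  M0 : s.M 0 = asArray I.r
  M1 : s.M 1 = asArray I.v
  M2 : s.M 2 = asArray fun i => (I.c i : ℝ)

theorem Env.frame {n : ℕ} {I : Instance n} {N : ℕ} {δ : ℝ} {s s' : State} {p : Prog}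
    (h : Env I N δ s) (hF : Frame p s s')
    (hN : ([0, 1, 3, 4, 15].any fun a => p.anyInstr (·.writesN a)) = false := by rfl)
    (hR : ([0, 1, 3, 9, 12].any fun a => p.anyInstr (·.writesR a)) = false := by rfl)
    (hM : ([0, 1, 2].any fun a => p.anyInstr (·.writesM a)) = false := by rfl) :
    Env I N δ s' := by
  simp only [List.any_cons, List.any_nil, Bool.or_false, Bool.or_eq_false_iff] at hN hR hM
  exact ⟨by rw [hF.N _ hN.1, h.N0], by rw [hF.N _ hN.2.1, h.N1], by rw [hF.N _ hN.2.2.1, h.N3],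
    by rw [hF.N _ hN.2.2.2.1, h.N4], by rw [hF.N _ hN.2.2.2.2, h.N15],
    by rw [hF.R _ hR.1, h.R0], by rw [hF.R _ hR.2.1, h.R1], by rw [hF.R _ hR.2.2.1, h.R3],
    by rw [hF.R _ hR.2.2.2.1, h.R9], by rw [hF.R _ hR.2.2.2.2, h.R12],
    by rw [hF.M _ hM.1, h.M0], by rw [hF.M _ hM.2.1, h.M1], by rw [hF.M _ hM.2.2, h.M2]⟩

/-- Fills array `5`, row by row, with the amounts that correspond to `0, …, N` units of each
product, for the largest amount in real register `10` and the no-purchase probability in real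
register `11`. Real register `14` holds the cap of the product, `15` the amount of the units. -/
def fillProg : Prog :=
  .seq (block (.setN 11 0) [.mulR 17 1 10])
    (forN 7 0
      (.seq (block (.load 14 1 7) [.mulR 14 14 11, .load 16 2 7, .divR 16 16 0, .setR 15 0])
        (.seq (.cond (.ltR 10 14) (.instr (.addR 14 10 9)) (.instr (.addR 14 14 9)))
          (.seq (.cond (.ltR 16 14) (.instr (.addR 14 16 9)) (.instr (.addR 14 14 9)))
            (forN 8 4
              (.seq (.cond (.ltR 15 14) (.instr (.addR 16 15 9)) (.instr (.addR 16 14 9)))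
                (.seq (.cond (.leR 17 16) (.instr (.store 5 11 16)) (.instr (.store 5 11 9)))
                  (block (.addR 15 15 12) [.addN 11 11 1]))))))))

/-- For the product `j` in index register `7` and the budget `w` in index register `8`, finds the
best number of units of `j` (index register `13`) and the resulting profit (real register `20`)
from row `j` of the amounts (array `5`) and row `j` of the dynamic program (array `6`). -/
def argmaxProg : Prog :=
  .seq (block (.mulN 12 7 4) [.addN 14 12 8, .load 20 6 14, .setN 13 0, .addN 10 8 1, .load 21 0 7])
    (forN 9 10
      (.seq (block (.addN 14 12 9) [.load 22 5 14, .mulR 22 22 21, .subN 14 8 9, .addN 14 12 14,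
          .load 23 6 14, .addR 22 22 23])
        (.cond (.ltR 20 22) (block (.addR 20 22 9) [.addN 13 9 15]) (.instr (.addR 20 20 9)))))

/-- Fills the rows `1, …, n` of the dynamic program in array `6`. Row `0` is never written to and
remains zero from one round of the search to the next. -/
def dpProg : Prog :=
  forN 7 0 (forN 8 4 (.seq argmaxProg (block (.addN 14 12 4) [.addN 14 14 8, .store 6 14 20])))

/-- Traces an optimal solution back from the budget in index register `8` and writes it to
array `7`. -/
def traceProg : Prog :=
  forN 17 0
    (.seq (block (.subN 7 0 17) [.subN 7 7 1])
      (.seq argmaxProg (block (.addN 14 12 13) [.load 22 5 14, .store 7 7 22, .subN 8 8 13])))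

/-- Solves the discretized problem for one choice of the largest amount (real register `10`) and
of the units for no purchase (index register `6`, as a probability in real register `11`), and
replaces the incumbent in array `7` with its profit in real register `26` if that is better. -/
def roundProg : Prog :=
  .seq fillProg
    (.seq dpProg
      (.seq (block (.mulN 14 0 4) [.subN 8 3 6, .addN 14 14 8, .load 25 6 14])
        (.cond (.ltR 26 25) (.seq (.instr (.addR 26 25 9)) traceProg) (.instr (.addR 26 26 9)))))

section

variable {O : ℕ → ℝ → ℝ} {n : ℕ} {I : Instance n} {N : ℕ} {δ : ℝ} {s : State}

theorem run_fillProg (hE : Env I N δ s) {U : ℝ} {k : ℕ} (hU : s.R 10 = U) (hk : s.R 11 = k * δ) :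
    Run O fillProg s (n * ((N + 1) * 8 + 13) + 4) fun s' => ∀ j < n, ∀ q ≤ N,
      s'.M 5 (j * (N + 1) + q) = I.amount U (k * δ) (q * δ) j := by
  refine Run.seq (T₁ := 2) (T₂ := n * ((N + 1) * 8 + 13) + 2)
    (Q' := fun s => s.N 11 = 0 ∧ s.R 17 = I.α * U)
    (Run.block _ _ (by simp [Instr.eval, hE.R1, hU])) ?_
  rintro s₁ hF₁ ⟨h11, h17⟩
  have hE₁ := hE.frame hF₁
  refine Run.forN ((N + 1) * 8 + 11) (fun j s => s.N 11 = j * (N + 1) ∧ ∀ m < j * (N + 1),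
    s.M 5 m = I.amount U (k * δ) ((m % (N + 1) : ℕ) * δ) (m / (N + 1))) hE₁.N1
    (by simp [h11]) ?_ ?_ (by rw [hE₁.N0])
  · rintro j s₂ hj h7 hF₂ ⟨g11, gM⟩
    have hE₂ := hE₁.frame hF₂
    have g10 : s₂.R 10 = U := by rw [hF₂.R 10 rfl, hF₁.R 10 rfl, hU]
    have g11' : s₂.R 11 = k * δ := by rw [hF₂.R 11 rfl, hF₁.R 11 rfl, hk]
    have g17 : s₂.R 17 = I.α * U := by rw [hF₂.R 17 rfl, h17]
    refine Run.seq (T₁ := 5) (T₂ := (N + 1) * 8 + 6)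
      (Q' := fun s => s.R 14 = asArray I.v j * (k * δ) ∧
        s.R 16 = asArray (fun i => (I.c i : ℝ)) j / I.T ∧ s.R 15 = 0)
      (Run.block _ _ (by simp [Instr.eval, hE₂.M1, hE₂.M2, hE₂.R0, h7, g11'])) ?_
    rintro s₃ hF₃ ⟨k14, k16, k15⟩
    have hE₃ := hE₂.frame hF₃
    have k10 : s₃.R 10 = U := by rw [hF₃.R 10 rfl, g10]
    refine Run.seq (T₁ := 2) (T₂ := (N + 1) * 8 + 4)
      (Q' := fun s => s.R 14 = min U (asArray I.v j * (k * δ)))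
      (Run.cond (c := 1) (fun hb => Run.instr ?_) (fun hb => Run.instr ?_)) ?_
    · rw [Test.Holds, k10, k14] at hb
      simp [Instr.eval, hE₃.R9, k10, hb.le]
    · rw [Test.Holds, k10, k14] at hb
      simp [Instr.eval, hE₃.R9, k14, not_lt.1 hb]
    intro s₄ hF₄ l14
    have hE₄ := hE₃.frame hF₄
    have l16 : s₄.R 16 = asArray (fun i => (I.c i : ℝ)) j / I.T := by rw [hF₄.R 16 rfl, k16]
    refine Run.seq (T₁ := 2) (T₂ := (N + 1) * 8 + 2)
      (Q' := fun s => s.R 14 = I.cap U (k * δ) j)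
      (Run.cond (c := 1) (fun hb => Run.instr ?_) (fun hb => Run.instr ?_)) ?_
    · rw [Test.Holds, l16, l14] at hb
      rw [Instance.cap, min_eq_right hb.le]
      simp [Instr.eval, hE₄.R9, l16]
    · rw [Test.Holds, l16, l14] at hb
      rw [Instance.cap, min_eq_left (not_lt.1 hb)]
      simp [Instr.eval, hE₄.R9, l14]
    intro s₅ hF₅ m14
    have hE₅ := hE₄.frame hF₅
    refine Run.forN 6 (fun q s => s.R 15 = q * δ ∧ s.N 11 = j * (N + 1) + q ∧
      ∀ m < j * (N + 1) + q,
        s.M 5 m = I.amount U (k * δ) ((m % (N + 1) : ℕ) * δ) (m / (N + 1))) hE₅.N1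
      ?_ ?_ ?_ (by rw [hE₅.N4])
    · simpa [hF₅.R 15 rfl, hF₄.R 15 rfl, k15, hF₅.N 11 rfl, hF₄.N 11 rfl, hF₃.N 11 rfl, g11,
        hF₅.M 5 rfl, hF₄.M 5 rfl, hF₃.M 5 rfl] using gM
    · rintro q s₆ hq - hF₆ ⟨o15, o11, oM⟩
      rw [hE₅.N4] at hq
      have hE₆ := hE₅.frame hF₆
      have o14 : s₆.R 14 = I.cap U (k * δ) j := by rw [hF₆.R 14 rfl, m14]
      have o17 : s₆.R 17 = I.α * U := by
        rw [hF₆.R 17 rfl, hF₅.R 17 rfl, hF₄.R 17 rfl, hF₃.R 17 rfl, g17]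
      refine Run.seq (T₁ := 2) (T₂ := 4)
        (Q' := fun s => s.R 16 = min (I.cap U (k * δ) j) (q * δ))
        (Run.cond (c := 1) (fun hb => Run.instr ?_) (fun hb => Run.instr ?_)) ?_
      · rw [Test.Holds, o15, o14] at hb
        simp [Instr.eval, hE₆.R9, o15, hb.le]
      · rw [Test.Holds, o15, o14] at hb
        simp [Instr.eval, hE₆.R9, o14, not_lt.1 hb]
      intro s₇ hF₇ p16
      have hE₇ := hE₆.frame hF₇
      have p17 : s₇.R 17 = I.α * U := by rw [hF₇.R 17 rfl, o17]
      have p11 : s₇.N 11 = j * (N + 1) + q := by rw [hF₇.N 11 rfl, o11]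
      refine Run.seq (T₁ := 2) (T₂ := 2) (Q' := fun s => ∀ m < j * (N + 1) + (q + 1),
        s.M 5 m = I.amount U (k * δ) ((m % (N + 1) : ℕ) * δ) (m / (N + 1)))
        (Run.cond (c := 1) (fun hb => Run.instr fun m hm => ?_)
          (fun hb => Run.instr fun m hm => ?_)) ?_
      · rw [Test.Holds, p17, p16] at hb
        rcases (show m < j * (N + 1) + q ∨ m = j * (N + 1) + q by omega) with hm | rfl
        · simp [Instr.eval, p11, hm.ne, hF₇.M 5 rfl, oM m hm]
        · rw [row_index_div j hq, row_index_mod j hq, Instance.amount, if_pos hb]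
          simp [Instr.eval, p11, p16]
      · rw [Test.Holds, p17, p16] at hb
        rcases (show m < j * (N + 1) + q ∨ m = j * (N + 1) + q by omega) with hm | rfl
        · simp [Instr.eval, p11, hm.ne, hF₇.M 5 rfl, oM m hm]
        · rw [row_index_div j hq, row_index_mod j hq, Instance.amount, if_neg hb]
          simp [Instr.eval, p11, hE₇.R9]
      · intro s₈ hF₈ qM
        have hE₈ := hE₇.frame hF₈
        refine Run.block _ _ ⟨?_, ?_, ?_⟩
        · simp [Instr.eval, hF₈.R 15 rfl, hF₇.R 15 rfl, o15, hE₈.R12, add_mul]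
        · simp [Instr.eval, hF₈.N 11 rfl, p11, hE₈.N1, add_assoc]
        · simpa [Instr.eval] using qM
    · rintro s₆ - ⟨-, o11, oM⟩
      rw [hE₅.N4, ← Nat.succ_mul] at o11 oM
      exact ⟨by simpa using o11, oM⟩
  · rintro s₂ - ⟨-, gM⟩ j hj q hq
    rw [hE₁.N0] at gM
    rw [gM _ (row_index_lt hj (Nat.lt_succ_of_le hq)), row_index_div j (Nat.lt_succ_of_le hq),
      row_index_mod j (Nat.lt_succ_of_le hq)]

variable {A : ℕ → ℕ → ℝ}

theorem run_argmaxProg (hE : Env I N δ s) {j w : ℕ} (hj : s.N 7 = j) (hw : s.N 8 = w)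
    (hwN : w ≤ N) (hA0 : A j 0 = 0) (hA : ∀ q ≤ N, s.M 5 (j * (N + 1) + q) = A j q)
    (hD : ∀ q ≤ N, s.M 6 (j * (N + 1) + q) = knapsack (fun j q => asArray I.r j * A j q) j q) :
    Run O argmaxProg s ((N + 1) * 12 + 8) fun s' => s'.N 12 = j * (N + 1) ∧ s'.N 13 ≤ w ∧
      s'.R 20 = knapsack (fun j q => asArray I.r j * A j q) (j + 1) w ∧
      asArray I.r j * A j (s'.N 13) +
          knapsack (fun j q => asArray I.r j * A j q) j (w - s'.N 13) =
        knapsack (fun j q => asArray I.r j * A j q) (j + 1) w := by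
  set f : ℕ → ℕ → ℝ := fun j q => asArray I.r j * A j q with hf
  refine Run.seq (T₁ := 6) (T₂ := (w + 1) * 12 + 2)
    (Q' := fun s => s.N 12 = j * (N + 1) ∧ s.R 20 = knapsack f j w ∧ s.N 13 = 0 ∧
      s.N 10 = w + 1 ∧ s.R 21 = asArray I.r j)
    (Run.block _ _ ?_) ?_
    (by have := Nat.mul_le_mul_right 12 (Nat.add_le_add_right hwN 1); omega)
  · simp [Instr.eval, hj, hw, hE.N4, hE.N1, hE.M0, hD w hwN]
  rintro s₁ hF₁ ⟨h12, h20, h13, h10, h21⟩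
  have hE₁ := hE.frame hF₁
  refine Run.forN 10 (fun m s => s.N 13 ≤ w ∧ s.R 20 = f j (s.N 13) + knapsack f j (w - s.N 13) ∧
    ∀ q < m, f j q + knapsack f j (w - q) ≤ s.R 20) hE₁.N1 ?_ ?_ ?_ (by rw [h10])
  · simp [h13, h20, hf, hA0]
  · rintro q s₂ hq h9 hF₂ ⟨g13, g20, gle⟩
    rw [h10] at hq
    have hE₂ := hE₁.frame hF₂
    have g12 : s₂.N 12 = j * (N + 1) := by rw [hF₂.N 12 rfl, h12]
    have g21 : s₂.R 21 = asArray I.r j := by rw [hF₂.R 21 rfl, h21]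
    have g8 : s₂.N 8 = w := by rw [hF₂.N 8 rfl, hF₁.N 8 rfl, hw]
    have gA : s₂.M 5 (j * (N + 1) + q) = A j q := by
      rw [hF₂.M 5 rfl, hF₁.M 5 rfl, hA q (by omega)]
    have gD : s₂.M 6 (j * (N + 1) + (w - q)) = knapsack f j (w - q) := by
      rw [hF₂.M 6 rfl, hF₁.M 6 rfl, hD _ (by omega)]
    refine Run.seq (T₁ := 7) (T₂ := 3)
      (Q' := fun s => s.R 22 = f j q + knapsack f j (w - q)) (Run.block _ _ ?_) ?_
    · simp [Instr.eval, g12, h9, gA, g21, g8, gD, hf, mul_comm]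
    intro s₃ hF₃ k22
    have hE₃ := hE₂.frame hF₃
    have k20 : s₃.R 20 = s₂.R 20 := hF₃.R 20 rfl
    have k13 : s₃.N 13 = s₂.N 13 := hF₃.N 13 rfl
    have k9 : s₃.N 9 = q := by rw [hF₃.N 9 rfl, h9]
    refine Run.cond (c := 2) (fun hb => Run.block _ _ ?_) (fun hb => Run.instr ?_)
    · rw [Test.Holds, k20, k22] at hb
      have e : ∀ q' < q + 1, f j q' + knapsack f j (w - q') ≤ f j q + knapsack f j (w - q) := by
        intro q' hq'
        rcases Nat.lt_succ_iff_lt_or_eq.1 hq' with h | rfl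
        · exact (gle q' h).trans hb.le
        · exact le_rfl
      simpa [Instr.eval, hE₃.R9, hE₃.N15, k22, k9, Nat.lt_succ_iff.1 hq] using e
    · rw [Test.Holds, k20, k22] at hb
      have e : ∀ q' < q + 1, f j q' + knapsack f j (w - q') ≤ s₂.R 20 := by
        intro q' hq'
        rcases Nat.lt_succ_iff_lt_or_eq.1 hq' with h | rfl
        · exact gle q' h
        · exact not_lt.1 hb
      simpa [Instr.eval, hE₃.R9, k20, k13, g13, ← g20] using e
  · rintro s₂ hF₂ ⟨g13, g20, gle⟩
    rw [h10] at gle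
    have e := knapsack_succ_eq (f := f) g13 fun q' hq' => (gle q' (by omega)).trans g20.le
    exact ⟨by rw [hF₂.N 12 rfl, h12], g13, g20.trans e, e⟩

theorem run_dpProg (hE : Env I N δ s) (hA0 : ∀ j, A j 0 = 0)
    (hA : ∀ j < n, ∀ q ≤ N, s.M 5 (j * (N + 1) + q) = A j q) (hD : ∀ q ≤ N, s.M 6 q = 0) :
    Run O dpProg s (n * ((N + 1) * ((N + 1) * 12 + 13) + 4) + 2) fun s' => ∀ j ≤ n, ∀ q ≤ N,
      s'.M 6 (j * (N + 1) + q) = knapsack (fun j q => asArray I.r j * A j q) j q := by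
  set f : ℕ → ℕ → ℝ := fun j q => asArray I.r j * A j q with hf
  refine Run.forN ((N + 1) * ((N + 1) * 12 + 13) + 2) (fun j s => ∀ m < (j + 1) * (N + 1),
    s.M 6 m = knapsack f (m / (N + 1)) (m % (N + 1))) hE.N1 ?_ ?_ ?_ (by rw [hE.N0])
  · intro m hm
    rw [zero_add, one_mul] at hm
    rw [Nat.div_eq_of_lt hm]
    exact hD m (by omega)
  · intro j s₁ hj h7 hF₁ hI
    rw [hE.N0] at hj
    have hE₁ := hE.frame hF₁
    refine Run.forN ((N + 1) * 12 + 11) (fun w s => ∀ m < (j + 1) * (N + 1) + w,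
      s.M 6 m = knapsack f (m / (N + 1)) (m % (N + 1))) hE₁.N1 hI ?_ ?_ (by rw [hE₁.N4])
    · intro w s₂ hw h8 hF₂ hI₂
      rw [hE₁.N4] at hw
      have hE₂ := hE₁.frame hF₂
      refine Run.seq (T₁ := (N + 1) * 12 + 8) (T₂ := 3)
        (run_argmaxProg (A := A) hE₂ (by rw [hF₂.N 7 rfl, h7]) h8 (by omega) (hA0 j)
        (fun q hq => by rw [hF₂.M 5 rfl, hF₁.M 5 rfl, hA j hj q hq]) fun q hq => ?_) ?_
      · have hlt : j * (N + 1) + q < (j + 1) * (N + 1) :=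
          row_index_lt j.lt_succ_self (Nat.lt_succ_of_le hq)
        rw [hI₂ _ (by omega), row_index_div j (Nat.lt_succ_of_le hq),
          row_index_mod j (Nat.lt_succ_of_le hq)]
      · rintro s₃ hF₃ ⟨g12, -, g20, -⟩
        have hE₃ := hE₂.frame hF₃
        have g8 : s₃.N 8 = w := by rw [hF₃.N 8 rfl, h8]
        have gidx : j * (N + 1) + (N + 1) + w = (j + 1) * (N + 1) + w := by ring
        refine Run.block _ _ fun m hm => ?_
        rcases (show m < (j + 1) * (N + 1) + w ∨ m = (j + 1) * (N + 1) + w by omega) with hm | rfl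
        · simp [Instr.eval, g12, hE₃.N4, g8, gidx, hm.ne, hF₃.M 6 rfl, hI₂ m hm]
        · rw [row_index_div _ hw, row_index_mod _ hw]
          simp [Instr.eval, g12, hE₃.N4, g8, gidx, g20, hf]
    · intro s₂ _ hI₂ m hm
      rw [hE₁.N4] at hI₂
      exact hI₂ m (by rw [← Nat.succ_mul]; exact hm)
  · intro s₁ _ hI j hj q hq
    rw [hE.N0] at hI
    rw [hI _ (row_index_lt (Nat.lt_succ_of_le hj) (Nat.lt_succ_of_le hq)),
      row_index_div j (Nat.lt_succ_of_le hq), row_index_mod j (Nat.lt_succ_of_le hq)]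

theorem run_traceProg (hE : Env I N δ s) {w : ℕ} (hw : s.N 8 = w) (hwN : w ≤ N)
    (hA0 : ∀ j, A j 0 = 0) (hA : ∀ j < n, ∀ q ≤ N, s.M 5 (j * (N + 1) + q) = A j q)
    (hD : ∀ j ≤ n, ∀ q ≤ N,
      s.M 6 (j * (N + 1) + q) = knapsack (fun j q => asArray I.r j * A j q) j q) :
    Run O traceProg s (n * ((N + 1) * 12 + 16) + 2) fun s' => ∃ q : ℕ → ℕ,
      ∑ i ∈ Finset.range n, q i ≤ w ∧ (∀ i < n, s'.M 7 i = A i (q i)) ∧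
      ∑ i ∈ Finset.range n, asArray I.r i * A i (q i) =
        knapsack (fun j q => asArray I.r j * A j q) n w := by
  set f : ℕ → ℕ → ℝ := fun j q => asArray I.r j * A j q with hf
  refine Run.forN ((N + 1) * 12 + 14) (fun t s => ∃ q : ℕ → ℕ,
    ∑ i ∈ Finset.Ico (n - t) n, q i + s.N 8 = w ∧
    (∀ i ∈ Finset.Ico (n - t) n, s.M 7 i = A i (q i)) ∧
    ∑ i ∈ Finset.Ico (n - t) n, f i (q i) + knapsack f (n - t) (s.N 8) = knapsack f n w) hE.N1
    ⟨fun _ => 0, by simp [hw]⟩ ?_ ?_ (by rw [hE.N0])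
  · rintro t s₁ ht h17 hF₁ ⟨q, hq, hM, hsum⟩
    rw [hE.N0] at ht
    have hE₁ := hE.frame hF₁
    obtain ⟨j, hj⟩ : ∃ j, n - t = j + 1 := ⟨n - t - 1, by omega⟩
    have hj' : n - (t + 1) = j := by omega
    have hjn : j < n := by omega
    rw [hj] at hq hM hsum
    rw [hj']
    refine Run.seq (T₁ := 2) (T₂ := (N + 1) * 12 + 12) (Q' := fun s => s.N 7 = j)
      (Run.block _ _ (by simp [Instr.eval, hE₁.N0, hE₁.N1, h17, hj])) ?_
    intro s₂ hF₂ h7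
    have hE₂ := hE₁.frame hF₂
    have h8 : s₂.N 8 = s₁.N 8 := hF₂.N 8 rfl
    refine Run.seq (T₁ := (N + 1) * 12 + 8) (T₂ := 4)
      (run_argmaxProg (A := A) hE₂ h7 h8 (by omega) (hA0 j)
        (fun q hq => by rw [hF₂.M 5 rfl, hF₁.M 5 rfl, hA j hjn q hq])
        fun q hq => by rw [hF₂.M 6 rfl, hF₁.M 6 rfl, hD j hjn.le q hq]) ?_
    rintro s₃ hF₃ ⟨g12, g13, -, gsum⟩
    have hE₃ := hE₂.frame hF₃
    set qb := s₃.N 13 with hqb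
    have g8 : s₃.N 8 = s₁.N 8 := by rw [hF₃.N 8 rfl, h8]
    have g7 : s₃.N 7 = j := by rw [hF₃.N 7 rfl, h7]
    have gM5 : s₃.M 5 (j * (N + 1) + qb) = A j qb := by
      rw [hF₃.M 5 rfl, hF₂.M 5 rfl, hF₁.M 5 rfl, hA j hjn qb (by omega)]
    have gM7 : s₃.M 7 = s₁.M 7 := by rw [hF₃.M 7 rfl, hF₂.M 7 rfl]
    have hne : ∀ i ∈ Finset.Ico (j + 1) n, i ≠ j := fun i hi => by
      have := (Finset.mem_Ico.1 hi).1
      omega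
    refine (Run.block (T := 4) (Q := fun s => s.N 8 = s₁.N 8 - qb ∧
      s.M 7 = Function.update (s₁.M 7) j (A j qb)) _ _ ?_).mono le_rfl ?_
    · simp [Instr.eval, g12, ← hqb, gM5, g7, g8, gM7]
    rintro s₄ - ⟨k8, kM⟩
    refine ⟨Function.update q j qb, ?_, fun i hi => ?_, ?_⟩
    · rw [Finset.sum_eq_sum_Ico_succ_bot hjn, Finset.sum_congr rfl fun i hi =>
        Function.update_of_ne (hne i hi) qb q, Function.update_self]
      simp only [Function.update_of_ne (show (8 : ℕ) ≠ 17 by decide), k8]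
      have hq' : (Finset.Ico (j + 1) n).sum q + s₁.N 8 = w := hq
      omega
    · rcases eq_or_ne i j with rfl | hij
      · simp [kM]
      · have hi' : i ∈ Finset.Ico (j + 1) n := by
          rw [Finset.mem_Ico] at hi ⊢
          omega
        simp [kM, hij, hM i hi']
    · rw [Finset.sum_eq_sum_Ico_succ_bot hjn, Finset.sum_congr rfl fun i hi =>
        (by rw [Function.update_of_ne (hne i hi)] : f i (Function.update q j qb i) = f i (q i))]
      simp only [Function.update_of_ne (show (8 : ℕ) ≠ 17 by decide), Function.update_self, k8]
      rw [← hsum, ← gsum]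
      simp only [hf]
      ring
  · rintro s₁ - ⟨q, hq, hM, hsum⟩
    rw [hE.N0, Nat.sub_self] at hq hM hsum
    rw [Nat.Ico_zero_eq_range] at hq hM hsum
    refine ⟨q, by omega, fun i hi => hM i (Finset.mem_range.2 hi), ?_⟩
    rw [← hsum, knapsack, add_zero]

/-- Array `7` holds a feasible solution of the Upper-Bound problem, real register `26` its value
divided by `T`. -/
def Incumbent (I : Instance n) (s : State) : Prop :=
  I.UBFeasible (1 - ∑ i : Fin n, s.M 7 i) (fun i => s.M 7 i) ∧
    s.R 26 = ∑ i : Fin n, I.r i * s.M 7 i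

theorem run_roundProg (hE : Env I N δ s) (hδ : 0 ≤ δ) (hN : N * δ = 1) {U : ℝ} {k : ℕ}
    (hU0 : 0 < U) (hU : s.R 10 = U) (hk : s.R 11 = k * δ) (hk6 : s.N 6 = k) (hkN : k ≤ N)
    (hD : ∀ q ≤ N, s.M 6 q = 0) (hInc : Incumbent I s) {T : ℕ}
    (hT : n * ((N + 1) * 8 + 13) + 4 + (n * ((N + 1) * ((N + 1) * 12 + 13) + 4) +
      n * ((N + 1) * 12 + 16) + 10) ≤ T) :
    Run O roundProg s T fun s' => (∀ q ≤ N, s'.M 6 q = 0) ∧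
      Incumbent I s' ∧ s.R 26 ≤ s'.R 26 ∧ I.gridValue N δ U k ≤ s'.R 26 := by
  set A : ℕ → ℕ → ℝ := fun j q => I.amount U (k * δ) (q * δ) j with hA
  have hA0 : ∀ j, A j 0 = 0 := fun j => by simp [hA, Instance.amount_zero hU0]
  refine Run.seq (T₁ := n * ((N + 1) * 8 + 13) + 4)
    (T₂ := n * ((N + 1) * ((N + 1) * 12 + 13) + 4) + n * ((N + 1) * 12 + 16) + 10)
    (run_fillProg hE hU hk) ?_ hT
  intro s₁ hF₁ hM5
  have hE₁ := hE.frame hF₁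
  refine Run.seq (T₁ := n * ((N + 1) * ((N + 1) * 12 + 13) + 4) + 2)
    (T₂ := n * ((N + 1) * 12 + 16) + 8) (run_dpProg (A := A) hE₁ hA0 hM5
    (by rw [hF₁.M 6 rfl]; exact hD)) ?_
  intro s₂ hF₂ hM6
  have hE₂ := hE₁.frame hF₂
  have hrow : ∀ q ≤ N, s₂.M 6 q = 0 := fun q hq => by
    simpa [knapsack] using hM6 0 (Nat.zero_le _) q hq
  have h26 : s₂.R 26 = s.R 26 := by rw [hF₂.R 26 rfl, hF₁.R 26 rfl]
  have hM7 : s₂.M 7 = s.M 7 := by rw [hF₂.M 7 rfl, hF₁.M 7 rfl]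
  refine Run.seq (T₁ := 4) (T₂ := n * ((N + 1) * 12 + 16) + 4)
    (Q' := fun s => s.N 8 = N - k ∧ s.R 25 = I.gridValue N δ U k) (Run.block _ _ ?_) ?_
  · have h6 : s₂.N 6 = k := by rw [hF₂.N 6 rfl, hF₁.N 6 rfl, hk6]
    have := hM6 n le_rfl (N - k) (by omega)
    simp [Instr.eval, hE₂.N0, hE₂.N3, hE₂.N4, h6, this, Instance.gridValue]
    rfl
  rintro s₃ hF₃ ⟨h8, h25⟩
  have hE₃ := hE₂.frame hF₃
  have g26 : s₃.R 26 = s.R 26 := by rw [hF₃.R 26 rfl, h26]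
  have gM7 : s₃.M 7 = s.M 7 := by rw [hF₃.M 7 rfl, hM7]
  have gM6 : s₃.M 6 = s₂.M 6 := hF₃.M 6 rfl
  refine Run.cond (c := n * ((N + 1) * 12 + 16) + 3) (fun hb => ?_)
    (fun hb => Run.instr ?_ (by omega))
  · rw [Test.Holds, g26, h25] at hb
    refine Run.seq (T₁ := 1) (T₂ := n * ((N + 1) * 12 + 16) + 2)
      (Q' := fun s => s.R 26 = I.gridValue N δ U k)
      (Run.instr (by simp [Instr.eval, h25, hE₃.R9])) ?_
    intro s₄ hF₄ k26
    have hE₄ := hE₃.frame hF₄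
    refine (run_traceProg (A := A) hE₄ (by rw [hF₄.N 8 rfl, h8]) (by omega) hA0
      (fun j hj q hq => by
        rw [hF₄.M 5 rfl, hF₃.M 5 rfl, hF₂.M 5 rfl, hM5 j hj q hq])
      (fun j hj q hq => by rw [hF₄.M 6 rfl, gM6, hM6 j hj q hq])).mono le_rfl ?_
    rintro s₅ hF₅ ⟨q, hq, hx, hsum⟩
    have l26 : s₅.R 26 = I.gridValue N δ U k := by rw [hF₅.R 26 rfl, k26]
    refine ⟨by rw [hF₅.M 6 rfl, hF₄.M 6 rfl, gM6]; exact hrow, ⟨?_, ?_⟩, ?_, l26.ge⟩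
    · exact Instance.ubFeasible_amount hδ hN hkN hU0.le q hq _ fun i => hx i i.2
    · rw [l26, Instance.gridValue]
      refine hsum.symm.trans ?_
      rw [Finset.sum_range]
      exact Finset.sum_congr rfl fun i _ => by rw [asArray_fin, hx i i.2]
    · rw [l26]
      exact hb.le
  · rw [Test.Holds, g26, h25] at hb
    have e : Instr.eval O s₃ (.addR 26 26 9) = s₃ := by
      simp [Instr.eval, hE₃.R9]
    rw [e]
    refine ⟨gM6 ▸ hrow, ?_, g26.ge, g26 ▸ not_lt.1 hb⟩
    rw [Incumbent, g26, gM7]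
    exact hInc

end

/-! ### The search over the grid -/

/-- Computes the constants of the search: `K ≥ max 4 (6 / ε)` in index register `2`, `N = n K` in
index register `3`, the unit `1 / N` in real register `12`, the first grid point in real register
`10` and the ratio of the grid in real register `13`. -/
def initProg : Prog :=
  .seq (block (.setN 1 1) [.setR 3 1, .setN 2 4, .setR 5 4, .setR 6 6, .divR 6 6 2])
    (.seq (.loop (.ltR 5 6) (block (.addR 5 5 3) [.addN 2 2 1]))
      (.seq (.instr (.divR 8 3 0))
        (.seq (forN 7 0 (.instr (.addR 7 7 3)))
          (.seq
            (forN 7 0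
              (.seq (block (.load 14 1 7) [.mulR 15 7 14, .addR 15 15 3, .divR 14 14 15])
                (.cond (.ltR 14 8) (.instr (.addR 8 14 9)) (.instr (.addR 8 8 9)))))
            (block (.mulN 3 0 2) [.addN 4 3 1, .mulR 12 7 5, .divR 12 3 12, .setR 14 2,
              .divR 10 8 14, .divR 13 3 5, .addR 13 13 3])))))

/-- Runs through the grid of largest amounts and, for each of them, through the numbers of units
for no purchase. -/
def searchProg : Prog :=
  .loop (.leR 10 3)
    (.seq (.instr (.setR 11 0))
      (.seq (forN 6 4 (.seq roundProg (.instr (.addR 11 11 12)))) (.instr (.mulR 10 10 13))))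

section

variable {O : ℕ → ℝ → ℝ} {n : ℕ} {I : Instance n} {s : State}

/-- The smallest admissible precision parameter `K`. -/
def precision (ε : ℝ) : ℕ := max 4 ⌈6 / ε⌉₊

theorem run_initProg (ε : ℝ) {T : ℕ} (hT : 3 * precision ε + 14 * n + 40 ≤ T) :
    Run O initProg (I.input ε) T fun s =>
      Env I (n * precision ε) (1 / (n * precision ε)) s ∧ s.R 2 = ε ∧
      s.R 10 = I.gridPoint (precision ε) 0 ∧ s.R 13 = 1 + 1 / precision ε ∧
      (∀ q, s.M 6 q = 0) ∧ (∀ q, s.M 7 q = 0) ∧ s.R 26 = 0 := by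
  set K := precision ε with hK
  have hK4 : 4 ≤ K := le_max_left _ _
  refine Run.seq (T₁ := 6) (T₂ := 3 * K + 14 * n + 34) (Q' := fun s => s.N 0 = n ∧ s.N 1 = 1 ∧
    s.N 2 = 4 ∧ s.N 15 = 0 ∧ s.R 0 = I.T ∧ s.R 1 = I.α ∧ s.R 2 = ε ∧ s.R 3 = 1 ∧ s.R 5 = 4 ∧
    s.R 6 = 6 / ε ∧ s.R 7 = 0 ∧ s.R 9 = 0 ∧ s.R 26 = 0 ∧ s.M 0 = asArray I.r ∧
    s.M 1 = asArray I.v ∧ s.M 2 = (asArray fun i => (I.c i : ℝ)) ∧ (∀ q, s.M 6 q = 0) ∧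
    ∀ q, s.M 7 q = 0)
    (Run.block _ _ (by simp [Instr.eval, Instance.input])) ?_
  rintro s - ⟨N0, N1, N2, N15, R0, R1, R2, R3, R5, R6, R7, R9, R26, M0, M1, M2, M6, M7⟩
  refine Run.seq (T₁ := 3 * K + 1) (T₂ := 14 * n + 33) (Q' := fun s => s.N 2 = K ∧ s.R 5 = K)
    (Run.loop (K - 4) 2 (fun j s => s.N 2 = 4 + j ∧ s.R 5 = 4 + j) (by simp [N2, R5]) ?_ ?_
      (by omega) ?_) ?_
  · rintro j s₁ hj hF ⟨h2, h5⟩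
    rw [Test.Holds, h5, hF.R 6 rfl, R6]
    have e : (4 : ℝ) + j < 6 / ε ↔ 4 + j < ⌈6 / ε⌉₊ := by
      rw [Nat.lt_ceil]
      push_cast
      rfl
    rw [e, hK, precision]
    omega
  · rintro j s₁ hj hF ⟨h2, h5⟩
    refine Run.block _ _ ?_
    have e3 : s₁.R 3 = 1 := by rw [hF.R 3 rfl, R3]
    have e1 : s₁.N 1 = 1 := by rw [hF.N 1 rfl, N1]
    simp [Instr.eval, h2, h5, e3, e1, add_assoc]
  · rintro s₁ - ⟨h2, h5⟩
    have e : 4 + (K - 4) = K := by omega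
    refine ⟨h2.trans e, h5.trans ?_⟩
    exact_mod_cast e
  rintro s₁ hF₁ ⟨h2, h5⟩
  refine Run.seq (T₁ := 1) (T₂ := 14 * n + 32) (Q' := fun s => s.R 8 = 1 / I.T)
    (Run.instr (by simp [Instr.eval, hF₁.R 3 rfl, hF₁.R 0 rfl, R3, R0])) ?_
  intro s₂ hF₂ h8
  have f1 : s₂.N 1 = 1 := by rw [hF₂.N 1 rfl, hF₁.N 1 rfl, N1]
  have f0 : s₂.N 0 = n := by rw [hF₂.N 0 rfl, hF₁.N 0 rfl, N0]
  have f3 : s₂.R 3 = 1 := by rw [hF₂.R 3 rfl, hF₁.R 3 rfl, R3]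
  have f9 : s₂.R 9 = 0 := by rw [hF₂.R 9 rfl, hF₁.R 9 rfl, R9]
  refine Run.seq (T₁ := n * 3 + 2) (T₂ := 11 * n + 30) (Q' := fun s => s.R 7 = n)
    (Run.forN 1 (fun j s => s.R 7 = j) f1 ?_ ?_ ?_ (by rw [f0])) ?_
  · simp [hF₂.R 7 rfl, hF₁.R 7 rfl, R7]
  · intro j s₃ _ _ hF h7
    refine Run.instr ?_
    simp [Instr.eval, h7, hF.R 3 rfl, f3]
  · intro s₃ _ h7
    rw [h7, f0]
  intro s₃ hF₃ h7
  have g1 : s₃.N 1 = 1 := by rw [hF₃.N 1 rfl, f1]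
  have g0 : s₃.N 0 = n := by rw [hF₃.N 0 rfl, f0]
  have g3 : s₃.R 3 = 1 := by rw [hF₃.R 3 rfl, f3]
  have g9 : s₃.R 9 = 0 := by rw [hF₃.R 9 rfl, f9]
  have gM1 : s₃.M 1 = asArray I.v := by rw [hF₃.M 1 rfl, hF₂.M 1 rfl, hF₁.M 1 rfl, M1]
  refine Run.seq (T₁ := n * 8 + 2) (T₂ := 8) (Q' := fun s => s.R 8 = I.amountBound n)
    (Run.forN 6 (fun j s => s.R 8 = I.amountBound j) g1 ?_ ?_ ?_ (by rw [g0])) ?_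
  · simp [hF₃.R 8 rfl, h8, Instance.amountBound]
  · intro j s₄ _ hj hF h8
    refine Run.seq (T₁ := 4) (T₂ := 2)
      (Q' := fun s => s.R 14 = asArray I.v j / (1 + n * asArray I.v j)) (Run.block _ _ ?_) ?_
    · simp [Instr.eval, hF.M 1 rfl, gM1, hj, hF.R 7 rfl, h7, hF.R 3 rfl, g3, add_comm]
    intro s₅ hF₅ h14
    have k8 : s₅.R 8 = I.amountBound j := by rw [hF₅.R 8 rfl, h8]
    have k9 : s₅.R 9 = 0 := by rw [hF₅.R 9 rfl, hF.R 9 rfl, g9]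
    refine Run.cond (c := 1) (fun hb => Run.instr ?_) (fun hb => Run.instr ?_)
    · rw [Test.Holds, k8, h14] at hb
      simp [Instr.eval, h14, k9, Instance.amountBound, hb.le]
    · rw [Test.Holds, k8, h14] at hb
      simp [Instr.eval, k8, k9, Instance.amountBound, not_lt.1 hb]
  · intro s₄ _ h8
    rw [h8, g0]
  intro s₄ hF₄ h8
  have k7 : s₄.R 7 = n := by rw [hF₄.R 7 rfl, h7]
  have k3 : s₄.R 3 = 1 := by rw [hF₄.R 3 rfl, g3]
  have k5 : s₄.R 5 = K := by rw [hF₄.R 5 rfl, hF₃.R 5 rfl, hF₂.R 5 rfl, h5]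
  have k0 : s₄.N 0 = n := by rw [hF₄.N 0 rfl, g0]
  have k1 : s₄.N 1 = 1 := by rw [hF₄.N 1 rfl, g1]
  have k2 : s₄.N 2 = K := by rw [hF₄.N 2 rfl, hF₃.N 2 rfl, hF₂.N 2 rfl, h2]
  refine Run.block _ _ ⟨⟨?_, ?_, ?_, ?_, ?_, ?_, ?_, ?_, ?_, ?_, ?_, ?_, ?_⟩, ?_, ?_, ?_, ?_, ?_, ?_⟩
  · simp [Instr.eval, k0]
  · simp [Instr.eval, k1]
  · simp [Instr.eval, k0, k2]
  · simp [Instr.eval, k0, k2, k1]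
  · simp [Instr.eval, hF₄.N 15 rfl, hF₃.N 15 rfl, hF₂.N 15 rfl, hF₁.N 15 rfl, N15]
  · simp [Instr.eval, hF₄.R 0 rfl, hF₃.R 0 rfl, hF₂.R 0 rfl, hF₁.R 0 rfl, R0]
  · simp [Instr.eval, hF₄.R 1 rfl, hF₃.R 1 rfl, hF₂.R 1 rfl, hF₁.R 1 rfl, R1]
  · simp [Instr.eval, k3]
  · simp [Instr.eval, hF₄.R 9 rfl, g9]
  · simp [Instr.eval, k3, k7, k5]
  · simp [Instr.eval, hF₄.M 0 rfl, hF₃.M 0 rfl, hF₂.M 0 rfl, hF₁.M 0 rfl, M0]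
  · simp [Instr.eval, hF₄.M 1 rfl, gM1]
  · simp [Instr.eval, hF₄.M 2 rfl, hF₃.M 2 rfl, hF₂.M 2 rfl, hF₁.M 2 rfl, M2]
  · simp [Instr.eval, hF₄.R 2 rfl, hF₃.R 2 rfl, hF₂.R 2 rfl, hF₁.R 2 rfl, R2]
  · simp [Instr.eval, h8, Instance.gridPoint]
  · simp [Instr.eval, k3, k5, add_comm]
  · simpa [Instr.eval, hF₄.M 6 rfl, hF₃.M 6 rfl, hF₂.M 6 rfl, hF₁.M 6 rfl] using M6
  · simpa [Instr.eval, hF₄.M 7 rfl, hF₃.M 7 rfl, hF₂.M 7 rfl, hF₁.M 7 rfl] using M7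
  · simp [Instr.eval, hF₄.R 26 rfl, hF₃.R 26 rfl, hF₂.R 26 rfl, hF₁.R 26 rfl, R26]

theorem run_searchProg {N K L : ℕ} {δ : ℝ} (hE : Env I N δ s) (hδ : 0 ≤ δ) (hN : N * δ = 1)
    (h10 : s.R 10 = I.gridPoint K 0) (h13 : s.R 13 = 1 + 1 / K) (hD : ∀ q ≤ N, s.M 6 q = 0)
    (hInc : Incumbent I s) (hL : ∀ j ≤ L, I.gridPoint K j ≤ 1 ↔ j < L) {T₀ T : ℕ}
    (hT₀ : n * ((N + 1) * 8 + 13) + 4 + (n * ((N + 1) * ((N + 1) * 12 + 13) + 4) +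
      n * ((N + 1) * 12 + 16) + 10) ≤ T₀) (hT : L * ((N + 1) * (T₀ + 3) + 5) + 1 ≤ T) :
    Run O searchProg s T fun s' => Incumbent I s' ∧
      ∀ a < L, ∀ k ≤ N, I.gridValue N δ (I.gridPoint K a) k ≤ s'.R 26 := by
  refine Run.loop L ((N + 1) * (T₀ + 3) + 4) (fun j s => s.R 10 = I.gridPoint K j ∧
    (∀ q ≤ N, s.M 6 q = 0) ∧ Incumbent I s ∧
    ∀ a < j, ∀ k ≤ N, I.gridValue N δ (I.gridPoint K a) k ≤ s.R 26)
    ⟨h10, hD, hInc, fun a ha => by omega⟩ ?_ ?_ hT fun _ _ h => h.2.2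
  · rintro j s₁ hj hF ⟨g10, -⟩
    rw [Test.Holds, g10, (hE.frame hF).R3]
    exact hL j hj
  · rintro j s₁ hj hF ⟨g10, gD, gInc, gval⟩
    have hE₁ := hE.frame hF
    refine Run.seq (T₁ := 1) (T₂ := (N + 1) * (T₀ + 3) + 3) (Q' := fun s => s.R 11 = 0)
      (Run.instr (by simp [Instr.eval])) ?_
    intro s₂ hF₂ h11
    have hE₂ := hE₁.frame hF₂
    have k10 : s₂.R 10 = I.gridPoint K j := by rw [hF₂.R 10 rfl, g10]
    have k26 : s₂.R 26 = s₁.R 26 := hF₂.R 26 rfl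
    have k7 : s₂.M 7 = s₁.M 7 := hF₂.M 7 rfl
    refine Run.seq (T₁ := (N + 1) * (T₀ + 3) + 2) (T₂ := 1)
      (Q' := fun s => (∀ q ≤ N, s.M 6 q = 0) ∧ Incumbent I s ∧
        (∀ a < j, ∀ k ≤ N, I.gridValue N δ (I.gridPoint K a) k ≤ s.R 26) ∧
        ∀ k ≤ N, I.gridValue N δ (I.gridPoint K j) k ≤ s.R 26)
      (Run.forN (T₀ + 1) (fun k s => s.R 11 = k * δ ∧ (∀ q ≤ N, s.M 6 q = 0) ∧ Incumbent I s ∧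
        (∀ a < j, ∀ k ≤ N, I.gridValue N δ (I.gridPoint K a) k ≤ s.R 26) ∧
        ∀ k' < k, I.gridValue N δ (I.gridPoint K j) k' ≤ s.R 26) hE₂.N1 ?_ ?_ ?_
        (by rw [hE₂.N4])) ?_
    · refine ⟨by simp [h11], by simpa [hF₂.M 6 rfl] using gD, ?_, ?_, fun k hk => by omega⟩
      · simpa only [Incumbent, k26, k7] using gInc
      · simpa only [k26] using gval
    · rintro k s₃ hk h6 hF₃ ⟨l11, lD, lInc, lval, lval'⟩
      rw [hE₂.N4] at hk
      have hE₃ := hE₂.frame hF₃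
      refine Run.seq (T₁ := T₀) (T₂ := 1) (run_roundProg hE₃ hδ hN (Instance.gridPoint_pos K j)
        (by rw [hF₃.R 10 rfl, k10]) l11 h6 (by omega) lD lInc hT₀) ?_
      rintro s₄ hF₄ ⟨mD, mInc, mle, mval⟩
      have hE₄ := hE₃.frame hF₄
      refine Run.instr ⟨?_, by simpa [Instr.eval] using mD,
        by simpa [Instr.eval, Incumbent] using mInc, fun a ha k' hk' => ?_, fun k' hk' => ?_⟩
      · simp [Instr.eval, hF₄.R 11 rfl, l11, hE₄.R12, add_mul]
      · simpa [Instr.eval] using (lval a ha k' hk').trans mle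
      · rcases Nat.lt_succ_iff_lt_or_eq.1 hk' with h | rfl
        · simpa [Instr.eval] using (lval' k' h).trans mle
        · simpa [Instr.eval] using mval
    · rintro s₃ - ⟨-, lD, lInc, lval, lval'⟩
      rw [hE₂.N4] at lval'
      exact ⟨lD, lInc, lval, fun k hk => lval' k (by omega)⟩
    · rintro s₃ hF₃ ⟨lD, lInc, lval, lval'⟩
      have l10 : s₃.R 10 = I.gridPoint K j := by rw [hF₃.R 10 rfl, k10]
      have l13 : s₃.R 13 = 1 + 1 / K := by rw [hF₃.R 13 rfl, hF₂.R 13 rfl, hF.R 13 rfl, h13]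
      refine Run.instr ⟨?_, by simpa [Instr.eval] using lD,
        by simpa [Instr.eval, Incumbent] using lInc, fun a ha => ?_⟩
      · simp [Instr.eval, l10, l13, Instance.gridPoint, pow_succ, mul_assoc]
      · rcases Nat.lt_succ_iff_lt_or_eq.1 ha with h | rfl
        · simpa [Instr.eval] using lval a h
        · simpa [Instr.eval] using lval'

/-! ### Bisection -/

theorem bisectStep_invariant (g : ℝ → ℝ) (target x : ℝ) (hx : 0 ≤ x) (h0 : g 0 ≤ target)
    (h1 : target < g x) (m : ℕ) {J : ℝ × ℝ} (hJ : J = (bisectStep g target)^[m] (0, x)) :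
    0 ≤ J.1 ∧ J.1 ≤ J.2 ∧ J.2 ≤ x ∧ J.2 - J.1 = x * (1 / 2) ^ m ∧ g J.1 ≤ target ∧
      target < g J.2 := by
  induction m generalizing J with
  | zero => subst hJ; simp [hx, h0, h1]
  | succ m ih =>
    rw [Function.iterate_succ_apply'] at hJ
    obtain ⟨a, b, c, d, e, f⟩ := ih rfl
    set J' := (bisectStep g target)^[m] (0, x)
    subst hJ
    rw [bisectStep, pow_succ]
    split_ifs with h
    · exact ⟨by dsimp only; linarith, by dsimp only; linarith, c, by dsimp only; linarith, h, f⟩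
    · exact ⟨a, by dsimp only; linarith, by dsimp only; linarith, by dsimp only; linarith, e,
        not_le.1 h⟩

/-- Lowers the purchase probabilities that violate the balance and writes the result to array `3`.
Array `8` receives the values of `G`, real register `30` their minimum over the
products with positive amount, `32` the target and `33` half the precision. The interval of the
bisection is held in the real registers `40` and `41`, the power of `1 / 2` that bounds its relative
length in `42`. -/
def bisectProg : Prog :=
  .seq (.instr (.addR 30 0 9))
    (.seq
      (forN 7 0
        (.seq (block (.load 14 7 7) [.call 31 7 14, .store 8 7 31])
          (.cond (.ltR 9 14)
            (.cond (.ltR 31 30) (.instr (.addR 30 31 9)) (.instr (.addR 30 30 9)))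
            (.instr (.addR 30 30 9)))))
      (.seq (block (.divR 32 30 1) [.subR 33 3 1, .setR 34 2, .divR 35 2 34])
        (.seq (.cond (.ltR 35 33) (.instr (.divR 33 35 34)) (.instr (.divR 33 33 34)))
          (forN 7 0
            (.seq (block (.load 41 7 7) [.load 44 8 7])
              (.cond (.leR 44 32) (.instr (.store 3 7 41))
                (.seq (block (.setR 40 0) [.setR 42 1])
                  (.seq
                    (.loop (.ltR 33 42)
                      (.seq (block (.addR 43 40 41) [.divR 43 43 34, .call 44 7 43])
                        (.seq
                          (.cond (.leR 44 32) (.instr (.addR 40 43 9)) (.instr (.addR 41 43 9)))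
                          (.instr (.divR 42 42 34)))))
                    (.instr (.store 3 7 40))))))))))

theorem oracle_apply (i : Fin n) {p : ℝ} (h0 : 0 ≤ p) (h1 : p ≤ 1) :
    I.oracle i p = I.G i p := by
  simp [Instance.oracle, h0, h1]

theorem run_bisectProg {N : ℕ} {δ : ℝ} (hE : Env I N δ s) {ε : ℝ} (hε : s.R 2 = ε)
    {x0 : ℝ} {x : Fin n → ℝ} (hx : I.UBFeasible x0 x) (hM : ∀ i : Fin n, s.M 7 i = x i) {L : ℕ}
    (hL : ∀ j ≤ L, min (ε / 2) (1 - I.α) / 2 < (1 / 2 : ℝ) ^ j ↔ j < L) {T : ℕ}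
    (hT : n * (L * 8 + 20) + 20 ≤ T) :
    Run I.oracle bisectProg s T fun s' => ∃ gm, 0 ≤ gm ∧ ((∃ i, 0 < x i) → gm = I.Gmin x) ∧
      ∀ i : Fin n, (I.G i (x i) ≤ gm / I.α → s'.M 3 i = x i) ∧
        (gm / I.α < I.G i (x i) →
          s'.M 3 i = ((bisectStep (I.G i) (gm / I.α))^[L] (0, x i)).1) := by
  have hG0 : ∀ i, 0 ≤ I.G i (x i) := fun i =>
    expectedSales_nonneg _ _ (hx.nonneg i) (hx.le_one i)
  refine Run.seq (T₁ := 1) (T₂ := n * (L * 8 + 20) + 19) (Q' := fun s => s.R 30 = I.T)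
    (Run.instr (by simp [Instr.eval, hE.R0, hE.R9])) ?_
  intro s₁ hF₁ h30
  have hE₁ := hE.frame hF₁
  have hM₁ : ∀ i : Fin n, s₁.M 7 i = x i := by rw [hF₁.M 7 rfl]; exact hM
  refine Run.seq (T₁ := n * 8 + 2) (T₂ := n * (L * 8 + 12) + 17)
    (Q' := fun s => (∀ i : Fin n, s.M 8 i = I.G i (x i)) ∧ 0 ≤ s.R 30 ∧
      ((∃ i, 0 < x i) → s.R 30 = I.Gmin x))
    (Run.forN 6 (fun j s => (∀ i : Fin n, (i : ℕ) < j → s.M 8 i = I.G i (x i)) ∧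
      (s.R 30 = I.T ∨ ∃ i, 0 < x i ∧ s.R 30 = I.G i (x i)) ∧
      ∀ i : Fin n, (i : ℕ) < j → 0 < x i → s.R 30 ≤ I.G i (x i)) hE₁.N1 ?_ ?_ ?_
      (by rw [hE₁.N0])) ?_ (by linarith)
  · simp [h30]
  · rintro j s₂ hj h7 hF₂ ⟨g8, g30, gle⟩
    rw [hE₁.N0] at hj
    have hE₂ := hE₁.frame hF₂
    have hxj : s₂.M 7 j = x ⟨j, hj⟩ := by rw [hF₂.M 7 rfl]; exact hM₁ ⟨j, hj⟩
    have hO := oracle_apply (I := I) ⟨j, hj⟩ (hx.nonneg ⟨j, hj⟩) (hx.le_one ⟨j, hj⟩)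
    dsimp only at hO
    refine Run.seq (T₁ := 3) (T₂ := 3) (Q' := fun s => s.R 14 = x ⟨j, hj⟩ ∧
      s.R 31 = I.G ⟨j, hj⟩ (x ⟨j, hj⟩) ∧
      s.M 8 = Function.update (s₂.M 8) j (I.G ⟨j, hj⟩ (x ⟨j, hj⟩))) (Run.block _ _ ?_) ?_
    · simp [Instr.eval, h7, hxj, hO]
    rintro s₃ hF₃ ⟨k14, k31, k8⟩
    have hE₃ := hE₂.frame hF₃
    have k30 : s₃.R 30 = s₂.R 30 := hF₃.R 30 rfl
    have hM8 : ∀ i : Fin n, (i : ℕ) < j + 1 → s₃.M 8 i = I.G i (x i) := by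
      intro i hi
      rw [k8]
      rcases Nat.lt_succ_iff_lt_or_eq.1 hi with h | h
      · rw [Function.update_of_ne h.ne, g8 i h]
      · obtain rfl : i = ⟨j, hj⟩ := Fin.ext h
        rw [Function.update_self]
    refine Run.cond (c := 2) (fun hb => ?_) (fun hb => Run.instr ⟨?_, ?_, ?_⟩)
    · rw [Test.Holds, hE₃.R9, k14] at hb
      refine Run.cond (c := 1) (fun hc => Run.instr ⟨?_, ?_, ?_⟩) (fun hc => Run.instr ⟨?_, ?_, ?_⟩)
      · simpa [Instr.eval] using hM8
      · exact .inr ⟨⟨j, hj⟩, hb, by simp [Instr.eval, k31, hE₃.R9]⟩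
      · rw [Test.Holds, k31, k30] at hc
        intro i hi hxi
        rcases Nat.lt_succ_iff_lt_or_eq.1 hi with h | h
        · simpa [Instr.eval, k31, hE₃.R9] using hc.le.trans (gle i h hxi)
        · obtain rfl : i = ⟨j, hj⟩ := Fin.ext h
          simp [Instr.eval, k31, hE₃.R9]
      · simpa [Instr.eval] using hM8
      · simpa [Instr.eval, k30, hE₃.R9] using g30
      · rw [Test.Holds, k31, k30] at hc
        intro i hi hxi
        rcases Nat.lt_succ_iff_lt_or_eq.1 hi with h | h
        · simpa [Instr.eval, k30, hE₃.R9] using gle i h hxi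
        · obtain rfl : i = ⟨j, hj⟩ := Fin.ext h
          simpa [Instr.eval, k30, hE₃.R9] using hc
    · simpa [Instr.eval] using hM8
    · simpa [Instr.eval, k30, hE₃.R9] using g30
    · rw [Test.Holds, hE₃.R9, k14] at hb
      intro i hi hxi
      rcases Nat.lt_succ_iff_lt_or_eq.1 hi with h | h
      · simpa [Instr.eval, k30, hE₃.R9] using gle i h hxi
      · obtain rfl : i = ⟨j, hj⟩ := Fin.ext h
        exact absurd hxi hb
  · rintro s₂ - ⟨g8, g30, gle⟩
    rw [hE₁.N0] at g8 gle
    refine ⟨fun i => g8 i i.2, ?_, fun ⟨i, hi⟩ => ?_⟩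
    · rcases g30 with h | ⟨i, -, h⟩
      · rw [h]
        exact Nat.cast_nonneg _
      · rw [h]
        exact hG0 i
    · obtain ⟨j, hj, e⟩ := I.exists_Gmin_eq hi
      refine le_antisymm (e ▸ gle j j.2 hj) ?_
      rcases g30 with h | ⟨i, hi, h⟩
      -- No value of `G` exceeds the initial value `T`.
      · rw [h, e]
        exact (expectedSales_le _ _ (hx.nonneg j) (hx.le_one j)).trans
          (mul_le_of_le_one_right (Nat.cast_nonneg _) (hx.le_one j))
      · rw [h]
        exact I.Gmin_le hi
  rintro s₂ hF₂ ⟨h8, hgm0, hgm⟩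
  have hE₂ := hE₁.frame hF₂
  obtain ⟨gm, hgmdef⟩ : ∃ gm, s₂.R 30 = gm := ⟨_, rfl⟩
  rw [hgmdef] at hgm0 hgm
  have hM₂ : ∀ i : Fin n, s₂.M 7 i = x i := by rw [hF₂.M 7 rfl]; exact hM₁
  have h2 : s₂.R 2 = ε := by rw [hF₂.R 2 rfl, hF₁.R 2 rfl, hε]
  refine Run.seq (T₁ := 4) (T₂ := n * (L * 8 + 12) + 12) (Q' := fun s => s.R 32 = gm / I.α ∧
    s.R 33 = 1 - I.α ∧ s.R 34 = 2 ∧ s.R 35 = ε / 2)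
    (Run.block _ _ (by simp [Instr.eval, hgmdef, hE₂.R1, hE₂.R3, h2])) ?_
  rintro s₃ hF₃ ⟨k32, k33, k34, k35⟩
  have hE₃ := hE₂.frame hF₃
  refine Run.seq (T₁ := 2) (T₂ := n * (L * 8 + 12) + 3)
    (Q' := fun s => s.R 33 = min (ε / 2) (1 - I.α) / 2)
    (Run.cond (c := 1) (fun hb => Run.instr ?_) (fun hb => Run.instr ?_)) ?_
  · rw [Test.Holds, k35, k33] at hb
    simp [Instr.eval, k34, k35, hb.le]
  · rw [Test.Holds, k35, k33] at hb
    simp [Instr.eval, k34, k33, not_lt.1 hb]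
  intro s₄ hF₄ l33
  have hE₄ := hE₃.frame hF₄
  set tgt := gm / I.α with htgt
  have htgt0 : 0 ≤ tgt := div_nonneg hgm0 I.α_pos.le
  have l32 : s₄.R 32 = tgt := by rw [hF₄.R 32 rfl, k32]
  have l34 : s₄.R 34 = 2 := by rw [hF₄.R 34 rfl, k34]
  have hM₄ : ∀ i : Fin n, s₄.M 7 i = x i := by rw [hF₄.M 7 rfl, hF₃.M 7 rfl]; exact hM₂
  have h8₄ : ∀ i : Fin n, s₄.M 8 i = I.G i (x i) := by
    rw [hF₄.M 8 rfl, hF₃.M 8 rfl]; exact h8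
  refine Run.forN (L * 8 + 8) (fun j s => ∀ i : Fin n, (i : ℕ) < j →
    (I.G i (x i) ≤ tgt → s.M 3 i = x i) ∧
    (tgt < I.G i (x i) → s.M 3 i = ((bisectStep (I.G i) tgt)^[L] (0, x i)).1)) hE₄.N1 ?_ ?_ ?_
    (by rw [hE₄.N0]; linarith)
  · intro i hi
    omega
  · intro j s₅ hj h7 hF₅ hI
    rw [hE₄.N0] at hj
    have hE₅ := hE₄.frame hF₅
    refine Run.seq (T₁ := 2) (T₂ := L * 8 + 6) (Q' := fun s => s.R 41 = x ⟨j, hj⟩ ∧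
      s.R 44 = I.G ⟨j, hj⟩ (x ⟨j, hj⟩)) (Run.block _ _ ?_) ?_
    · simp [Instr.eval, h7, hF₅.M 7 rfl, hF₅.M 8 rfl, hM₄ ⟨j, hj⟩, h8₄ ⟨j, hj⟩]
    rintro s₆ hF₆ ⟨m41, m44⟩
    have hE₆ := hE₅.frame hF₆
    have m32 : s₆.R 32 = tgt := by rw [hF₆.R 32 rfl, hF₅.R 32 rfl, l32]
    have m33 : s₆.R 33 = min (ε / 2) (1 - I.α) / 2 := by rw [hF₆.R 33 rfl, hF₅.R 33 rfl, l33]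
    have m34 : s₆.R 34 = 2 := by rw [hF₆.R 34 rfl, hF₅.R 34 rfl, l34]
    have m7 : s₆.N 7 = j := by rw [hF₆.N 7 rfl, h7]
    have mM3 : s₆.M 3 = s₅.M 3 := hF₆.M 3 rfl
    refine Run.cond (c := L * 8 + 5) (fun hb => Run.instr ?_ (by omega)) (fun hb => ?_)
    · rw [Test.Holds, m44, m32] at hb
      intro i hi
      rcases Nat.lt_succ_iff_lt_or_eq.1 hi with h | h
      · simpa [Instr.eval, m7, h.ne, mM3] using hI i h
      · obtain rfl : i = ⟨j, hj⟩ := Fin.ext h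
        refine ⟨fun _ => by simp [Instr.eval, m7, m41], fun h' => absurd hb (not_le.2 h')⟩
    · rw [Test.Holds, m44, m32, not_le] at hb
      refine Run.seq (T₁ := 2) (T₂ := L * 8 + 2) (Q' := fun s => s.R 40 = 0 ∧ s.R 42 = 1)
        (Run.block _ _ (by simp [Instr.eval])) ?_
      rintro s₇ hF₇ ⟨o40, o42⟩
      have hE₇ := hE₆.frame hF₇
      refine Run.seq (T₁ := L * 8 + 1) (T₂ := 1)
        (Q' := fun s => s.R 40 = ((bisectStep (I.G ⟨j, hj⟩) tgt)^[L] (0, x ⟨j, hj⟩)).1)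
        (Run.loop L 7 (fun m s => s.R 42 = (1 / 2) ^ m ∧
          (s.R 40, s.R 41) = (bisectStep (I.G ⟨j, hj⟩) tgt)^[m] (0, x ⟨j, hj⟩)) ?_ ?_ ?_ (by omega)
          fun _ _ h => congrArg Prod.fst h.2) ?_
      · simp [o40, o42, hF₇.R 41 rfl, m41]
      · rintro m s₈ hm hF₈ ⟨p42, -⟩
        rw [Test.Holds, p42, hF₈.R 33 rfl, hF₇.R 33 rfl, m33]
        exact hL m hm
      · rintro m s₈ hm hF₈ ⟨p42, pJ⟩
        have hE₈ := hE₇.frame hF₈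
        obtain ⟨a, b, c, -, -, -⟩ := bisectStep_invariant (I.G ⟨j, hj⟩) tgt (x ⟨j, hj⟩)
          (hx.nonneg _) ((expectedSales_zero _ _).trans_le htgt0) hb m pJ
        dsimp only at a b c
        have hx1 := hx.le_one ⟨j, hj⟩
        have hO := oracle_apply (I := I) ⟨j, hj⟩ (p := (s₈.R 40 + s₈.R 41) / 2) (by linarith)
          (by linarith)
        dsimp only at hO
        have p34 : s₈.R 34 = 2 := by rw [hF₈.R 34 rfl, hF₇.R 34 rfl, m34]
        have p32 : s₈.R 32 = tgt := by rw [hF₈.R 32 rfl, hF₇.R 32 rfl, m32]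
        have p7 : s₈.N 7 = j := by rw [hF₈.N 7 rfl, hF₇.N 7 rfl, m7]
        refine Run.seq (T₁ := 3) (T₂ := 3) (Q' := fun s =>
          s.R 43 = (s₈.R 40 + s₈.R 41) / 2 ∧ s.R 44 = I.G ⟨j, hj⟩ ((s₈.R 40 + s₈.R 41) / 2))
          (Run.block _ _ (by simp [Instr.eval, p34, p7, hO])) ?_
        rintro s₉ hF₉ ⟨q43, q44⟩
        have hE₉ := hE₈.frame hF₉
        have q32 : s₉.R 32 = tgt := by rw [hF₉.R 32 rfl, p32]
        rw [Function.iterate_succ_apply', ← pJ]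
        refine Run.seq (T₁ := 2) (T₂ := 1) (Q' := fun s => (s.R 40, s.R 41) =
          bisectStep (I.G ⟨j, hj⟩) tgt (s₈.R 40, s₈.R 41))
          (Run.cond (c := 1) (fun hc => Run.instr ?_) (fun hc => Run.instr ?_)) ?_
        · rw [Test.Holds, q44, q32] at hc
          rw [bisectStep, if_pos hc]
          simp [Instr.eval, q43, hE₉.R9, hF₉.R 41 rfl]
        · rw [Test.Holds, q44, q32] at hc
          rw [bisectStep, if_neg hc]
          simp [Instr.eval, q43, hE₉.R9, hF₉.R 40 rfl]
        · intro s' hF' hJ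
          refine Run.instr ⟨?_, by simpa [Instr.eval] using hJ⟩
          simp [Instr.eval, hF'.R 42 rfl, hF'.R 34 rfl, hF₉.R 42 rfl, hF₉.R 34 rfl, p34, p42,
            pow_succ, div_eq_mul_inv]
      · intro s₈ hF₈ p40
        have p7 : s₈.N 7 = j := by rw [hF₈.N 7 rfl, hF₇.N 7 rfl, m7]
        have pM3 : s₈.M 3 = s₅.M 3 := by rw [hF₈.M 3 rfl, hF₇.M 3 rfl, mM3]
        refine Run.instr fun i hi => ?_
        rcases Nat.lt_succ_iff_lt_or_eq.1 hi with h | h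
        · simpa [Instr.eval, p7, h.ne, pM3] using hI i h
        · obtain rfl : i = ⟨j, hj⟩ := Fin.ext h
          refine ⟨fun h' => absurd hb (not_lt.2 h'), fun _ => by simp [Instr.eval, p7, p40]⟩
  · intro s₅ _ hI
    rw [hE₄.N0] at hI
    exact ⟨gm, hgm0, hgm, fun i => hI i i.2⟩

end

/-! ### Running times -/

theorem lt_pow_of_log_div_lt {a b c : ℝ} {m : ℕ} (hb : 0 < b) (hc : 0 < c) (hcb : c ≤ Real.log b)
    (ha : 0 < a) (hm : Real.log a / c < m) : a < b ^ m := by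
  rw [← Real.log_lt_log_iff ha (pow_pos hb m), Real.log_pow]
  rw [div_lt_iff₀ hc] at hm
  exact hm.trans_le (mul_le_mul_of_nonneg_left hcb (Nat.cast_nonneg m))

/-- The first time at which a monotone condition holds. -/
theorem exists_threshold {P : ℕ → Prop} {m : ℕ} (hm : P m) :
    ∃ L ≤ m, P L ∧ ∀ j ≤ L, ¬ P j ↔ j < L := by
  classical
  have hex : ∃ L, P L := ⟨m, hm⟩
  refine ⟨Nat.find hex, Nat.find_min' hex hm, Nat.find_spec hex, fun j hj => ?_⟩
  refine ⟨fun h => lt_of_le_of_ne hj fun e => h (e ▸ Nat.find_spec hex), Nat.find_min hex⟩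

namespace Instance

variable {n : ℕ} {I : Instance n}

/-- The quantity in which the running time of the optimization phase is polynomial. -/
def sizeBound (I : Instance n) (ε : ℝ) : ℝ := I.inputSize + 1 / ε + Real.log (1 / (1 - I.α))

theorem log_inv_nonneg {a : ℝ} (h0 : 0 < a) (h1 : a ≤ 1) : 0 ≤ Real.log (1 / a) :=
  Real.log_nonneg (by rw [le_div_iff₀ h0]; linarith)

theorem log_T_nonneg (I : Instance n) : 0 ≤ Real.log I.T := Real.log_natCast_nonneg _

theorem sum_abs_log_nonneg (I : Instance n) : 0 ≤ ∑ i, |Real.log (I.v i)| :=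
  Finset.sum_nonneg fun _ _ => abs_nonneg _

theorem sizeBound_ge {ε : ℝ} (hα : I.α < 1) (hε : 0 < ε) :
    I.inputSize ≤ I.sizeBound ε ∧ (n : ℝ) ≤ I.sizeBound ε ∧ 1 / ε ≤ I.sizeBound ε ∧
      Real.log (1 / (1 - I.α)) ≤ I.sizeBound ε := by
  have h1 := I.log_T_nonneg
  have h2 := I.sum_abs_log_nonneg
  have h3 := log_inv_nonneg I.α_pos I.α_le_one
  have h4 := log_inv_nonneg (sub_pos.2 hα) (sub_le_self _ I.α_pos.le)
  have h5 : 0 < 1 / ε := one_div_pos.2 hε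
  have h6 : (0 : ℝ) ≤ n := Nat.cast_nonneg n
  rw [sizeBound, inputSize]
  refine ⟨?_, ?_, ?_, ?_⟩ <;> linarith

theorem log_two_div_amountBound_le (I : Instance n) :
    Real.log (2 / I.amountBound n) ≤ 1 + I.inputSize := by
  set X := n + Real.log I.T + ∑ i, |Real.log (I.v i)| with hX
  have h1 := I.log_T_nonneg
  have h2 := I.sum_abs_log_nonneg
  have h3 := log_inv_nonneg I.α_pos I.α_le_one
  have hn : (0 : ℝ) ≤ n := Nat.cast_nonneg n
  have hT : (0 : ℝ) < I.T := Nat.cast_pos.2 I.T_pos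
  have hb : Real.exp (-X) ≤ I.amountBound n := by
    refine amountBound_ge n le_rfl ?_ fun i => ?_
    · rw [Real.exp_neg, ← one_div]
      refine one_div_le_one_div_of_le hT ?_
      rw [← Real.log_le_iff_le_exp hT]
      linarith
    · have hv := I.v_pos i
      have hle : |Real.log (I.v i)| ≤ ∑ j, |Real.log (I.v j)| :=
        Finset.single_le_sum (f := fun j => |Real.log (I.v j)|) (fun j _ => abs_nonneg _)
          (Finset.mem_univ i)
      set E := Real.exp |Real.log (I.v i)| with hE
      have hE1 : 1 ≤ E := Real.one_le_exp (abs_nonneg _)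
      have hEv : 1 ≤ E * I.v i := by
        have : Real.exp (-Real.log (I.v i)) ≤ E := Real.exp_le_exp.2 (neg_le_abs _)
        rw [Real.exp_neg, Real.exp_log hv] at this
        calc 1 = (I.v i)⁻¹ * I.v i := (inv_mul_cancel₀ hv.ne').symm
          _ ≤ _ := mul_le_mul_of_nonneg_right this hv.le
      have hexp : (n + 1) * E ≤ Real.exp X := by
        have : Real.exp (n + |Real.log (I.v i)|) ≤ Real.exp X := Real.exp_le_exp.2 (by linarith)
        rw [Real.exp_add] at this
        exact (mul_le_mul_of_nonneg_right (Real.add_one_le_exp _) (by positivity)).trans this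
      rw [Real.exp_neg, ← one_div, div_le_div_iff₀ (Real.exp_pos X) (by positivity)]
      have := mul_le_mul_of_nonneg_left hexp hv.le
      nlinarith [mul_le_mul_of_nonneg_left hE1 (mul_nonneg hn hv.le)]
  have hB := amountBound_pos (I := I) n le_rfl
  rw [Real.log_div two_ne_zero hB.ne']
  have h4 : -X ≤ Real.log (I.amountBound n) := (Real.le_log_iff_exp_le hB).2 hb
  have h5 := Real.log_two_lt_d9
  rw [inputSize, ← hX]
  linarith

theorem precision_le {ε : ℝ} (hε : 0 < ε) {z : ℝ} (h1 : 1 ≤ z) (hz : 1 / ε ≤ z) :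
    (precision ε : ℝ) ≤ 7 * z := by
  rw [precision, Nat.cast_max]
  refine max_le (by push_cast; linarith) ?_
  have h6 : 6 / ε = 6 * (1 / ε) := by ring
  have := (Nat.ceil_lt_add_one (show 0 ≤ 6 / ε by positivity)).le
  linarith

/-- The number of grid points in `[0, 1]`. -/
theorem exists_grid_length [NeZero n] {ε : ℝ} (hα : I.α < 1) (hε : 0 < ε) :
    ∃ L : ℕ, (L : ℝ) ≤ 18 * I.sizeBound ε ^ 2 ∧ 1 < I.gridPoint (precision ε) L ∧
      ∀ j ≤ L, I.gridPoint (precision ε) j ≤ 1 ↔ j < L := by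
  obtain ⟨hz1, hz2, hz3, -⟩ := sizeBound_ge hα hε
  set z := I.sizeBound ε
  have hz : 1 ≤ z := le_trans (by exact_mod_cast NeZero.one_le) hz2
  set K := precision ε
  have hK : (K : ℝ) ≤ 7 * z := precision_le hε hz hz3
  have hK0 : (0 : ℝ) < K := by
    have : 4 ≤ K := le_max_left _ _
    exact_mod_cast (by omega : 0 < K)
  have hB := amountBound_pos (I := I) n le_rfl
  have hB1 : I.amountBound n ≤ 1 := by
    refine (amountBound_le_inv n).trans ?_
    have : (1 : ℝ) ≤ I.T := by exact_mod_cast I.T_pos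
    rw [div_le_one (by linarith)]
    exact this
  have hY : 1 ≤ 2 / I.amountBound n := by
    rw [le_div_iff₀ hB]
    linarith
  have hlogY := Real.log_nonneg hY
  have hlog := I.log_two_div_amountBound_le
  have hc : 1 / ((K : ℝ) + 1) ≤ Real.log (1 + 1 / K) := by
    refine le_trans (le_of_eq ?_) (Real.one_sub_inv_le_log_of_pos (by positivity))
    field_simp
    ring
  set m := ⌊Real.log (2 / I.amountBound n) / (1 / ((K : ℝ) + 1))⌋₊ + 1 with hm
  have hlt : 1 < I.gridPoint K m := by
    have := lt_pow_of_log_div_lt (m := m) (show (0 : ℝ) < 1 + 1 / K by positivity)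
      (by positivity) hc (show 0 < 2 / I.amountBound n by positivity)
      (by rw [hm, Nat.cast_add_one]; exact Nat.lt_floor_add_one _)
    rw [div_lt_iff₀ hB] at this
    rw [gridPoint]
    linarith
  obtain ⟨L, hLm, hL, hLj⟩ := exists_threshold (P := fun j => 1 < I.gridPoint K j) hlt
  refine ⟨L, ?_, hL, fun j hj => by rw [← hLj j hj, not_lt]⟩
  have h1 : (L : ℝ) ≤ m := by exact_mod_cast hLm
  have h2 : (m : ℝ) ≤ Real.log (2 / I.amountBound n) / (1 / ((K : ℝ) + 1)) + 1 := by
    rw [hm]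
    push_cast
    have := Nat.floor_le (show 0 ≤ Real.log (2 / I.amountBound n) / (1 / ((K : ℝ) + 1)) by
      positivity)
    linarith
  have h3 : Real.log (2 / I.amountBound n) / (1 / ((K : ℝ) + 1)) ≤ (2 * z) * (8 * z) := by
    rw [div_div_eq_mul_div, div_one]
    exact mul_le_mul (by linarith) (by linarith) (by positivity) (by positivity)
  nlinarith

/-- The number of steps of each bisection. -/
theorem exists_bisection_length [NeZero n] {ε : ℝ} (hα : I.α < 1) (hε : 0 < ε) :
    ∃ L : ℕ, (L : ℝ) ≤ 12 * I.sizeBound ε ∧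
      (1 / 2 : ℝ) ^ L ≤ min (ε / 2) (1 - I.α) / 2 ∧
      ∀ j ≤ L, min (ε / 2) (1 - I.α) / 2 < (1 / 2 : ℝ) ^ j ↔ j < L := by
  obtain ⟨-, hz2, hz3, hz4⟩ := sizeBound_ge hα hε
  set z := I.sizeBound ε
  have hz : 1 ≤ z := le_trans (by exact_mod_cast NeZero.one_le) hz2
  set e := min (ε / 2) (1 - I.α) with he
  have he0 : 0 < e := lt_min (by linarith) (by linarith)
  have he1 : e ≤ 1 := (min_le_right _ _).trans (by linarith [I.α_pos])
  have hlog2 := Real.log_two_gt_d9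
  have hlog2' := Real.log_two_lt_d9
  have hY : Real.log (2 / e) ≤ 4 * z + 1 := by
    rcases min_choice (ε / 2) (1 - I.α) with h | h
    · rw [he, h]
      have e4 : 2 / (ε / 2) = 4 * (1 / ε) := by field_simp; norm_num
      rw [e4]
      have := Real.log_le_sub_one_of_pos (show 0 < 4 * (1 / ε) by positivity)
      linarith
    · rw [he, h, ← mul_one_div, Real.log_mul two_ne_zero
        (one_div_ne_zero (sub_pos.2 hα).ne')]
      linarith
  have hY0 : 0 ≤ Real.log (2 / e) := Real.log_nonneg (by rw [le_div_iff₀ he0]; linarith)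
  set m := ⌊Real.log (2 / e) / (1 / 2)⌋₊ + 1 with hm
  have hlt : (1 / 2 : ℝ) ^ m ≤ e / 2 := by
    have := lt_pow_of_log_div_lt (m := m) two_pos one_half_pos (by linarith : 1 / 2 ≤ Real.log 2)
      (show 0 < 2 / e by positivity) (by rw [hm]; exact_mod_cast Nat.lt_floor_add_one _)
    rw [one_div, inv_pow, inv_le_comm₀ (by positivity) (by positivity), inv_div]
    exact this.le
  obtain ⟨L, hLm, hL, hLj⟩ := exists_threshold (P := fun j => (1 / 2 : ℝ) ^ j ≤ e / 2) hlt
  refine ⟨L, ?_, hL, fun j hj => by rw [← hLj j hj, not_le]⟩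
  have h1 : (L : ℝ) ≤ m := by exact_mod_cast hLm
  have h2 : (m : ℝ) ≤ Real.log (2 / e) / (1 / 2) + 1 := by
    rw [hm]
    push_cast
    have := Nat.floor_le (show 0 ≤ Real.log (2 / e) / (1 / 2) by positivity)
    linarith
  linarith

/-- The results of the search and of the bisection are a possible output of the algorithm. -/
theorem isOutput_of_bisection {ε₁ ε₂ x0 gm : ℝ} {xt xh : Fin n → ℝ} {L : ℕ} (hε₂ : 0 ≤ ε₂)
    (happrox : I.IsUBApprox (1 - ε₁) x0 xt) (hL : (1 / 2 : ℝ) ^ L ≤ ε₂ / 2) (hgm0 : 0 ≤ gm)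
    (hgm : (∃ i, 0 < xt i) → gm = I.Gmin xt)
    (hxh : ∀ i, (I.G i (xt i) ≤ gm / I.α → xh i = xt i) ∧
      (gm / I.α < I.G i (xt i) → xh i = ((bisectStep (I.G i) (gm / I.α))^[L] (0, xt i)).1)) :
    I.IsOutput ε₁ ε₂ x0 xt xh ∧ I.ByBisection xt xh := by
  refine ⟨⟨happrox, fun i hi => ?_, fun i hi hk => ?_, fun i hi hk => ?_⟩, fun i hi hk => ?_⟩
  · rw [(hxh i).1, hi]
    rw [hi]
    exact (expectedSales_zero _ _).trans_le (div_nonneg hgm0 I.α_pos.le)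
  · exact (hxh i).1 (by rwa [hgm ⟨i, hi⟩])
  · rw [← hgm ⟨i, hi⟩] at hk ⊢
    rw [(hxh i).2 hk]
    obtain ⟨a, b, c, d, e, f⟩ := bisectStep_invariant (I.G i) (gm / I.α) (xt i) hi.le
      ((expectedSales_zero _ _).trans_le (div_nonneg hgm0 I.α_pos.le)) hk L rfl
    set J := (bisectStep (I.G i) (gm / I.α))^[L] (0, xt i)
    refine ⟨⟨a, b.trans c⟩, ?_, e⟩
    have h1 := expectedSales_sub_le I.T (I.c i) a b (c.trans (happrox.1.le_one i))
    change I.G i J.2 - I.G i J.1 ≤ _ at h1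
    have h2 : 1 / 2 * (I.T * xt i) ≤ gm / I.α := by
      rw [hgm ⟨i, hi⟩]
      refine happrox.1.mul_le_Gmin_div (by norm_num) (fun j => le_trans ?_ (happrox.1.G_ge j)) hi
      exact mul_le_mul_of_nonneg_right (le_max_left _ _)
        (mul_nonneg (Nat.cast_nonneg _) (happrox.1.nonneg j))
    rw [d] at h1
    have h3 : I.T * (xt i * (1 / 2) ^ L) ≤ ε₂ * (gm / I.α) := by
      calc I.T * (xt i * (1 / 2) ^ L) = (I.T * xt i) * (1 / 2) ^ L := by ring
        _ ≤ (I.T * xt i) * (ε₂ / 2) := mul_le_mul_of_nonneg_left hL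
            (mul_nonneg (Nat.cast_nonneg _) hi.le)
        _ = ε₂ * (1 / 2 * (I.T * xt i)) := by ring
        _ ≤ _ := mul_le_mul_of_nonneg_left h2 hε₂
    linarith
  · rw [← hgm ⟨i, hi⟩] at hk ⊢
    exact ⟨L, (hxh i).2 hk⟩

theorem isUBApprox_of_grid [NeZero n] {ε x0 : ℝ} {x : Fin n → ℝ} (hε : 0 < ε) {L : ℕ}
    (hL : 1 < I.gridPoint (precision ε) L) (hx : I.UBFeasible x0 x)
    (hval : ∀ a < L, ∀ k ≤ n * precision ε, I.gridValue (n * precision ε)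
      (1 / (n * precision ε)) (I.gridPoint (precision ε) a) k ≤ ∑ i, I.r i * x i) :
    I.IsUBApprox (1 - ε / 2) x0 x := by
  refine ⟨hx, fun y0 y hy => ?_⟩
  have hT : (0 : ℝ) ≤ I.T := Nat.cast_nonneg _
  have hy0 : 0 ≤ ∑ i, I.r i * y i :=
    Finset.sum_nonneg fun i _ => mul_nonneg (I.r_pos i).le (hy.nonneg i)
  suffices (1 - ε / 2) * ∑ i, I.r i * y i ≤ ∑ i, I.r i * x i by
    calc _ = I.T * ((1 - ε / 2) * ∑ i, I.r i * y i) := by rw [ubValue]; ring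
      _ ≤ _ := mul_le_mul_of_nonneg_left this hT
  by_cases hpos : ∃ i, 0 < y i
  · obtain ⟨i, hi⟩ := hpos
    have hK4 : 4 ≤ precision ε := le_max_left _ _
    obtain ⟨a, ha, k, hk, h⟩ := hy.exists_grid_ge hi hK4 hL
    refine le_trans (mul_le_mul_of_nonneg_right ?_ hy0) (h.trans (hval a ha k hk))
    have hK : 6 / ε ≤ precision ε := (Nat.le_ceil _).trans (by exact_mod_cast le_max_right _ _)
    have hK0 : (0 : ℝ) < precision ε := (by positivity : 0 < 6 / ε).trans_le hK
    rw [div_le_iff₀ hε] at hK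
    have : 3 / (precision ε : ℝ) ≤ ε / 2 := by
      rw [div_le_div_iff₀ hK0 two_pos]
      linarith
    linarith
  · have : ∑ i, I.r i * y i = 0 := Finset.sum_eq_zero fun i _ => by
      rw [le_antisymm (not_lt.1 fun h => hpos ⟨i, h⟩) (hy.nonneg i), mul_zero]
    rw [this, mul_zero]
    exact Finset.sum_nonneg fun i _ => mul_nonneg (I.r_pos i).le (hx.nonneg i)

end Instance

/-- The optimization phase: an approximate solution of the Upper-Bound problem, then bisection. -/
def buildProg : Prog := .seq initProg (.seq searchProg bisectProg)

theorem Instance.run_buildProg {n : ℕ} [NeZero n] (I : Instance n) (hα : I.α < 1) {ε : ℝ}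
    (hε : 0 < ε) {L L' T₀ : ℕ} (hL1 : 1 < I.gridPoint (precision ε) L)
    (hL : ∀ j ≤ L, I.gridPoint (precision ε) j ≤ 1 ↔ j < L)
    (hL1' : (1 / 2 : ℝ) ^ L' ≤ min (ε / 2) (1 - I.α) / 2)
    (hL' : ∀ j ≤ L', min (ε / 2) (1 - I.α) / 2 < (1 / 2 : ℝ) ^ j ↔ j < L')
    (hT₀ : n * ((n * precision ε + 1) * 8 + 13) + 4 +
      (n * ((n * precision ε + 1) * ((n * precision ε + 1) * 12 + 13) + 4) +
      n * ((n * precision ε + 1) * 12 + 16) + 10) ≤ T₀) :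
    Run I.oracle buildProg (I.input ε) (3 * precision ε + 14 * n + 40 +
      ((L * ((n * precision ε + 1) * (T₀ + 3) + 5) + 1) + (n * (L' * 8 + 20) + 20))) fun s =>
      ∃ x0 xt, I.IsOutput (ε / 2) (min (ε / 2) (1 - I.α)) x0 xt (fun i => s.M 3 i) ∧
        I.ByBisection xt (fun i => s.M 3 i) := by
  have hn : (0 : ℝ) < n := Nat.cast_pos.2 (NeZero.pos n)
  have hK0 : (0 : ℝ) < precision ε := by
    have : 4 ≤ precision ε := le_max_left _ _
    exact_mod_cast (by omega : 0 < precision ε)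
  refine Run.seq (run_initProg ε le_rfl) ?_ le_rfl
  rintro s₁ - ⟨hE, h2, h10, h13, h6, h7, h26⟩
  have hInc : Incumbent I s₁ := by
    rw [Incumbent]
    simp only [h7, h26, mul_zero, Finset.sum_const_zero, and_true]
    exact ⟨by simp, fun _ => le_rfl, fun i => by simpa using (I.v_pos i).le,
      fun i => by positivity, fun _ => .inl rfl⟩
  refine Run.seq (run_searchProg hE (by positivity) (by push_cast; field_simp) h10 h13
    (fun q _ => h6 q) hInc hL hT₀ le_rfl) ?_ le_rfl
  rintro s₂ hF ⟨hInc₂, hval⟩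
  have hE₂ := hE.frame hF
  rw [hInc₂.2] at hval
  have happrox := isUBApprox_of_grid hε hL1 hInc₂.1 hval
  refine (run_bisectProg hE₂ (by rw [hF.R 2 rfl, h2]) hInc₂.1 (fun i => rfl) hL' le_rfl).mono
    le_rfl ?_
  rintro s₃ - ⟨gm, hgm0, hgm, hxh⟩
  exact ⟨_, _, isOutput_of_bisection (le_min (by linarith) (by linarith)) happrox hL1' hgm0 hgm hxh⟩

theorem buildProg_time {z n K L L' : ℝ} (hz : 1 ≤ z) (hn0 : 0 ≤ n) (hK0 : 0 ≤ K)
    (hL0 : 0 ≤ L') (hn : n ≤ z) (hK : K ≤ 7 * z) (hL : L ≤ 18 * z ^ 2) (hL' : L' ≤ 12 * z) :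
    3 * K + 14 * n + 40 + ((L * ((n * K + 1) * (100 * n * (n * K + 1) ^ 2 + 10 + 3) + 5) + 1) +
      (n * (L' * 8 + 20) + 20)) ≤ 1000000 * z ^ 9 := by
  have hz0 : 0 ≤ z := by linarith
  have hp : ∀ i, i ≤ 9 → z ^ i ≤ z ^ 9 := fun i hi => pow_le_pow_right₀ hz hi
  have h1 : (1 : ℝ) ≤ z ^ 9 := one_le_pow₀ hz
  have hM : n * K + 1 ≤ 8 * z ^ 2 := by
    have := mul_le_mul hn hK hK0 hz0
    nlinarith
  have hM0 : 0 ≤ n * K + 1 := by positivity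
  calc _ ≤ 3 * (7 * z) + 14 * z + 40 +
        ((18 * z ^ 2 * (8 * z ^ 2 * (100 * z * (8 * z ^ 2) ^ 2 + 10 + 3) + 5) + 1) +
        (z * (12 * z * 8 + 20) + 20)) := by gcongr
    _ = 921600 * z ^ 9 + 1872 * z ^ 4 + 186 * z ^ 2 + 55 * z ^ 1 + 61 := by ring
    _ ≤ _ := by linarith [hp 4 (by norm_num), hp 2 (by norm_num), hp 1 (by norm_num)]

end BMS

end

theorem theorem3 :
    -- for every outcome of the algorithm: the policy exists, is feasible, and is near-optimal
    (∀ (n : ℕ) [NeZero n] (I : BMS.Instance n), I.α < 1 → ∀ ε : ℝ, 0 < ε →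
      ∀ (x0 : ℝ) (xt xh : Fin n → ℝ),
        I.IsOutput (ε / 2) (min (ε / 2) (1 - I.α)) x0 xt xh →
        (∃ π : BMS.Policy n, I.Implements xh π) ∧
        ∀ π : BMS.Policy n, I.Implements xh π →
          I.IsApprox (max (1 / 2 - ε) (1 - 1 / √(I.cmin : ℝ) - ε)) π) ∧
    -- the optimization phase (approximate solution of Upper-Bound, then bisection)
    (∃ (build : BMS.Prog) (C k : ℕ),
      ∀ (n : ℕ) [NeZero n] (I : BMS.Instance n), I.α < 1 → ∀ ε : ℝ, 0 < ε →
        ∃ (m : ℕ) (s : BMS.State) (x0 : ℝ) (xt xh : Fin n → ℝ),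
          BMS.Exec I.oracle build (I.input ε) m s ∧
          (m : ℝ) ≤ C * (I.inputSize + 1 / ε + Real.log (1 / (1 - I.α))) ^ k ∧
          (∀ i : Fin n, s.M 3 i = xh i) ∧
          I.IsOutput (ε / 2) (min (ε / 2) (1 - I.α)) x0 xt xh ∧
          I.ByBisection xt xh) ∧
    -- the computation of the distribution over assortments in one period
    (∃ (sample : BMS.Prog) (C k : ℕ), sample.CallFree ∧
      ∀ (n : ℕ) [NeZero n] (I : BMS.Instance n), I.α < 1 → ∀ ε : ℝ, 0 < ε →
        ∀ (x0 : ℝ) (xt xh : Fin n → ℝ),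
          I.IsOutput (ε / 2) (min (ε / 2) (1 - I.α)) x0 xt xh →
          ∀ sold : Fin n → ℕ, ∃ (m : ℕ) (s : BMS.State),
            BMS.Exec I.oracle sample (I.periodInput (I.purchaseProb xh sold)) m s ∧
            m ≤ C * n ^ k ∧
            I.DescribesDistribution (I.purchaseProb xh sold) s) ∧
    -- the cost of one evaluation of `G` by arithmetic operations alone
    (∃ (evalG : BMS.Prog) (C : ℕ), evalG.CallFree ∧
      ∀ (T c : ℕ), 0 < T → 0 < c → ∀ p : ℝ, 0 ≤ p → p ≤ 1 →
        ∃ (m : ℕ) (s : BMS.State),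
          BMS.Exec (fun _ _ => 0) evalG (BMS.evalInput T c p) m s ∧ m ≤ C * T ∧
          s.R 0 = BMS.expectedSales T c p) := by
  refine ⟨fun n _ I hα ε hε x0 xt xh h =>
    ⟨BMS.Instance.exists_implements h.attainable, fun π hπ => h.isApprox hε hα hπ⟩,
    ⟨BMS.buildProg, 1000000, 9, fun n _ I hα ε hε => ?_⟩,
    ⟨BMS.sampleProg, 91, 2, BMS.sampleProg_callFree, fun n _ I _ ε _ x0 xt xh h sold => ?_⟩,
    ⟨BMS.evalProg, 37, BMS.evalProg_callFree, fun T c hT _ p _ hp => ?_⟩⟩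
  · obtain ⟨L, hLz, hL1, hL⟩ := BMS.Instance.exists_grid_length hα hε
    obtain ⟨L', hLz', hL1', hL'⟩ := BMS.Instance.exists_bisection_length hα hε
    obtain ⟨-, hn, hz, -⟩ := BMS.Instance.sizeBound_ge hα hε
    have hn1 : 1 ≤ n := NeZero.one_le
    have hz1 : 1 ≤ I.sizeBound ε := le_trans (by exact_mod_cast hn1) hn
    obtain ⟨m, s, hex, hm, x0, xt, hout, hbis⟩ := I.run_buildProg hα hε hL1 hL hL1' hL'
      (T₀ := 100 * n * (n * BMS.precision ε + 1) ^ 2 + 10) (by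
        set M := n * BMS.precision ε + 1
        have h1 : 1 ≤ M := Nat.le_add_left _ _
        have h2 : M ≤ M ^ 2 := Nat.le_self_pow two_ne_zero M
        have h3 : n * M ≤ n * M ^ 2 := Nat.mul_le_mul_left n h2
        have h4 : n ≤ n * M := Nat.le_mul_of_pos_right n h1
        nlinarith)
    refine ⟨m, s, x0, xt, fun i => s.M 3 i, hex, ?_, fun _ => rfl, hout, hbis⟩
    have hb := BMS.buildProg_time hz1 (Nat.cast_nonneg n) (Nat.cast_nonneg (BMS.precision ε))
      (Nat.cast_nonneg L') hn (BMS.Instance.precision_le hε hz1 hz) hLz hLz'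
    refine le_trans ?_ (hb.trans_eq (by norm_num [BMS.Instance.sizeBound]))
    exact_mod_cast hm
  · obtain ⟨m, s, hex, hm, hs⟩ := I.run_sampleProg I.oracle _ (h.attainable sold)
    refine ⟨m, s, hex, hm.trans ?_, hs⟩
    have hn1 : 1 ≤ n := NeZero.one_le
    nlinarith
  · obtain ⟨m, s, hex, hm, hs⟩ := BMS.run_evalProg (fun _ _ => 0) T c p hp
    exact ⟨m, s, hex, by omega, hs⟩
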